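/- Let $n \ge 3$ and place $2n$ points on the unit circle, labeled clockwise $1_\circ, 2_\bullet, 3_\circ, 4_\bullet, \dots, (2n-1)_\circ, (2n)_\bullet$. The hollow (resp. solid) polygon is the convex hull of the hollow points $i_\circ$ (resp. solid points $i_\bullet$); its diagonals are all segments joining two of its vertices, boundary edges included, and a diagonal is internal if it is not a boundary edge. A dissection is a set of pairwise non-crossing internal diagonals of one of the two polygons; $\overline{D}$ denotes $D$ together with all boundary edges of that polygon. The cells of $D$ are the closures of the connected components of the polygon minus the diagonals of $D$. Let $D_\circ$ be a hollow dissection. A solid diagonal $\delta_\bullet$ is a $D_\circ$-accordion diagonal if the set of diagonals of $\overline{D}_\circ$ crossed by $\delta_\bullet$ is connected. A $D_\circ$-accordion dissection is a set of pairwise non-crossing internal $D_\circ$-accordion diagonals; it is maximal if it is maximal for inclusion. Let $D_\bullet$ be a maximal $D_\circ$-accordion dissection, $\delta_\circ \in D_\circ$ and $\delta_\bullet \in D_\bullet$. If $\delta_\circ$ and $\delta_\bullet$ cross, let $\mu_\circ, \nu_\circ$ be the other diagonals of $\overline{D}_\circ$ crossed by $\delta_\bullet$ in the two cells of $D_\circ$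 containing $\delta_\circ$, and let $\varepsilon_\circ(\delta_\circ \in D_\circ \mid \delta_\bullet)$ be $1$, $-1$ or $0$ depending on whether $\mu_\circ \delta_\circ \nu_\circ$ forms a $\mathsf{Z}$, an $\mathsf{S}$, or a $\mathsf{V}$ (this does not depend on $D_\bullet$ and is defined for every $D_\circ$-accordion diagonal $\delta_\bullet$). Similarly let $\mu_\bullet, \nu_\bullet$ be the other diagonals of $\overline{D}_\bullet$ crossed by $\delta_\circ$ in the two cells of $D_\bullet$ containing $\delta_\bullet$, and let $\varepsilon_\bullet(\delta_\circ \mid \delta_\bullet \in D_\bullet)$ be $1$, $-1$ or $0$ depending on whether $\mu_\bullet \delta_\bullet \nu_\bullet$ forms an $\mathsf{S}$, a $\mathsf{Z}$, or a $\mathsf{V}$. Both signs are $0$ if $\delta_\circ$ and $\delta_\bullet$ do not cross. In the Euclidean space $\mathbb{R}^{D_\circ}$ with canonical basis $(e_{\delta_\circ})_{\delta_\circ \in D_\circ}$, define $$ g(D_\circ \mid \delta_\bullet) = \sum_{\delta_\circ \in D_\circ} \varepsilon_\circ(\delta_\circ \in D_\circ \mid \delta_\bullet)\, e_{\delta_\circ},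 \qquad c(D_\circ \mid \delta_\bullet \in D_\bullet) = \sum_{\delta_\circ \in D_\circ} \varepsilon_\bullet(\delta_\circ \mid \delta_\bullet \in D_\bullet)\, e_{\delta_\circ}. $$ The $g$-vector fan $\mathcal{F}^g(D_\circ)$ is the collection of the cones $\mathbb{R}_{\ge 0}\{ g(D_\circ \mid \delta_\bullet) : \delta_\bullet \in D_\bullet\}$ for all $D_\circ$-accordion dissections $D_\bullet$. The $D_\circ$-height $\omega(D_\circ \mid \gamma_\bullet)$ of a solid diagonal $\gamma_\bullet$ is the number of $D_\circ$-accordion diagonals that cross $\gamma_\bullet$. The $D_\circ$-accordiohedron $\mathrm{Acco}(D_\circ) \subset \mathbb{R}^{D_\circ}$ is the convex hull of the points $\sum_{\delta_\bullet \in D_\bullet} \omega(D_\circ \mid \delta_\bullet)\, c(D_\circ \mid \delta_\bullet \in D_\bullet)$ for all maximal $D_\circ$-accordion dissections $D_\bullet$. Theorem. Let $D_\circ \subseteq D_\circ'$ be two hollow dissections, and identify $\mathbb{R}^{D_\circ}$ with the subspace of $\mathbb{R}^{D_\circ'}$ spanned by $\{e_{\delta_\circ} : \delta_\circ \in D_\circ\}$.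 Let $P \subset \mathbb{R}^{D_\circ}$ be the orthogonal projection of $\mathrm{Acco}(D_\circ')$ on $\mathbb{R}^{D_\circ}$. Then the $g$-vector fan $\mathcal{F}^g(D_\circ)$ is the (outer) normal fan of $P$, that is, the collection of the normal cones of all nonempty faces of $P$. Moreover $P$ is equal to each of the following two sets: - the convex hull of the points $\sum_{\delta_\bullet \in D_\bullet} \omega(D_\circ' \mid \delta_\bullet)\, c(D_\circ \mid \delta_\bullet \in D_\bullet)$ for all maximal $D_\circ$-accordion dissections $D_\bullet$; - the intersection of the half-spaces $\{ x \in \mathbb{R}^{D_\circ} : \langle g(D_\circ \mid \gamma_\bullet), x\rangle \le \omega(D_\circ' \mid \gamma_\bullet) \}$ for all $D_\circ$-accordion diagonals $\gamma_\bullet$. -/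

import Mathlib

open scoped InnerProductSpace

namespace AccordionComplex

/-! ### Points on the circle and diagonals

The `2n` points on the circle are the labels modulo `2n`, in clockwise order: `Fin (2 * n)`, the
label `2n` being `0`.  Odd labels are the hollow vertices, even labels are the solid vertices. -/

/-- The four points `a, b, c, d` are distinct and appear in this clockwise cyclic order. -/
def Clockwise {m : ℕ} (a b c d : Fin m) : Prop :=
  (a < b ∧ b < c ∧ c < d) ∨ (b < c ∧ c < d ∧ d < a) ∨
    (c < d ∧ d < a ∧ a < b) ∨ (d < a ∧ a < b ∧ b < c)

/-- The open segments `ab` and `cd` cross: their endpoints alternate around the circle. -/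
def SegmentsCross {m : ℕ} (a b c d : Fin m) : Prop :=
  Clockwise a c b d ∨ Clockwise a d b c

/-- The diagonals (boundary edges included) of the polygon whose vertices are the labels of
parity `c`.  An unordered pair of distinct vertices is stored with its smaller label first. -/
abbrev Diagonal (n c : ℕ) : Type :=
  {p : Fin (2 * n) × Fin (2 * n) // p.1 < p.2 ∧ p.1.val % 2 = c ∧ p.2.val % 2 = c}

/-- Diagonals of the hollow polygon. -/
abbrev HollowDiagonal (n : ℕ) : Type := Diagonal n 1

/-- Diagonals of the solid polygon. -/
abbrev SolidDiagonal (n : ℕ) : Type := Diagonal n 0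

/-- Boundary edges: the two endpoints are consecutive vertices of the polygon. -/
def IsBoundary {n c : ℕ} (δ : Diagonal n c) : Prop :=
  δ.1.2.val = δ.1.1.val + 2 ∨ δ.1.1.val + 2 * n = δ.1.2.val + 2

/-- Two diagonals (of the same polygon or not) cross. -/
def Crosses {n c c' : ℕ} (δ : Diagonal n c) (η : Diagonal n c') : Prop :=
  SegmentsCross δ.1.1 δ.1.2 η.1.1 η.1.2

/-- The two endpoints of `δ` are `a` and `b`. -/
def Joins {n c : ℕ} (δ : Diagonal n c) (a b : Fin (2 * n)) : Prop :=
  (δ.1.1 = a ∧ δ.1.2 = b) ∨ (δ.1.1 = b ∧ δ.1.2 = a)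

/-- Two diagonals share an endpoint. -/
def Incident {n c : ℕ} (α β : Diagonal n c) : Prop :=
  α.1.1 = β.1.1 ∨ α.1.1 = β.1.2 ∨ α.1.2 = β.1.1 ∨ α.1.2 = β.1.2

/-! ### Dissections, cells and accordions -/

/-- A dissection: a set of pairwise non-crossing internal diagonals. -/
def IsDissection {n c : ℕ} (D : Finset (Diagonal n c)) : Prop :=
  (∀ δ ∈ D, ¬ IsBoundary δ) ∧ ∀ δ ∈ D, ∀ η ∈ D, ¬ Crosses δ η

/-- The diagonals of `D` together with all boundary edges of the polygon. -/
def withBoundary {n c : ℕ} (D : Finset (Diagonal n c)) : Set (Diagonal n c) :=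
  {δ | δ ∈ D ∨ IsBoundary δ}

/-- `C` is the vertex set of a cell of the dissection `D`: a maximal set of vertices of the
polygon no two of which are strictly separated by a diagonal of `D`. -/
def IsCell {n c : ℕ} (D : Finset (Diagonal n c)) (C : Finset (Fin (2 * n))) : Prop :=
  (∀ v ∈ C, v.val % 2 = c) ∧
  (∀ u ∈ C, ∀ v ∈ C, ∀ δ ∈ D, ¬ SegmentsCross δ.1.1 δ.1.2 u v) ∧
  ∀ w : Fin (2 * n), w.val % 2 = c →
    (∀ u ∈ C, ∀ δ ∈ D, ¬ SegmentsCross δ.1.1 δ.1.2 u w) → w ∈ C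

/-- The diagonals of `D` and boundary edges that are crossed by a diagonal `η` of the polygon of
the other colour.  This is a cut of `D`, since such an `η` crosses two boundary edges. -/
def crossed {n c c' : ℕ} (D : Finset (Diagonal n c)) (η : Diagonal n c') :
    Set (Diagonal n c) :=
  {δ | δ ∈ withBoundary D ∧ Crosses δ η}

/-- A set of (non-crossing) diagonals is connected: any two of them are linked by a chain of
diagonals of the set in which consecutive ones share an endpoint. -/
def IsConnectedSet {n c : ℕ} (A : Set (Diagonal n c)) : Prop :=
  ∀ α ∈ A, ∀ β ∈ A, Relation.ReflTransGen (fun x y => y ∈ A ∧ Incident x y) α β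

/-- `η` is a `D`-accordion diagonal: the cut of `D` crossed by `η` is connected. -/
def IsAccordionDiagonal {n c c' : ℕ} (D : Finset (Diagonal n c)) (η : Diagonal n c') : Prop :=
  IsConnectedSet (crossed D η)

/-- A `D`-accordion dissection: a set of non-crossing internal `D`-accordion diagonals. -/
def IsAccordionDissection {n c c' : ℕ} (D : Finset (Diagonal n c))
    (E : Finset (Diagonal n c')) : Prop :=
  IsDissection E ∧ ∀ η ∈ E, IsAccordionDiagonal D η

/-- An inclusion-maximal `D`-accordion dissection. -/
def IsMaximalAccordionDissection {n c c' : ℕ} (D : Finset (Diagonal n c))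
    (E : Finset (Diagonal n c')) : Prop :=
  Maximal (IsAccordionDissection D) E

/-! ### Slaloms, `g`-vectors and `c`-vectors -/

/-- `δ` is crossed by `η`, and `μ`, `ν` are the other diagonals of `D` (or boundary edges) crossed
by `η` in the two cells of `D` containing `δ`. -/
def AreNeighbours {n c c' : ℕ} (D : Finset (Diagonal n c)) (η : Diagonal n c')
    (μ δ ν : Diagonal n c) : Prop :=
  Crosses δ η ∧ μ ∈ crossed D η ∧ ν ∈ crossed D η ∧ μ ≠ δ ∧ ν ≠ δ ∧
  ∃ C C' : Finset (Fin (2 * n)), IsCell D C ∧ IsCell D C' ∧ C ≠ C' ∧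
    δ.1.1 ∈ C ∧ δ.1.2 ∈ C ∧ δ.1.1 ∈ C' ∧ δ.1.2 ∈ C' ∧
    μ.1.1 ∈ C ∧ μ.1.2 ∈ C ∧ ν.1.1 ∈ C' ∧ ν.1.2 ∈ C'

/-- `μ δ ν` is a path `u - p - q - w` that has the shape of the letter `Z`: reading the letter
from its upper left end `u` along `p` (upper right) and `q` (lower left) to `w` (lower right), the
clockwise order is `u, p, w, q`. -/
def IsZ {n c : ℕ} (μ δ ν : Diagonal n c) : Prop :=
  ∃ u p q w, Joins μ u p ∧ Joins δ p q ∧ Joins ν q w ∧ Clockwise u p w q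

/-- `μ δ ν` is a path `u - p - q - w` that has the shape of the letter `S`, the mirror image
of `Z`. -/
def IsS {n c : ℕ} (μ δ ν : Diagonal n c) : Prop :=
  ∃ u p q w, Joins μ u p ∧ Joins δ p q ∧ Joins ν q w ∧ Clockwise u q w p

open Classical in
/-- `1`, `-1` or `0` depending on whether `η` slaloms on `δ ∈ D` as a `Z`, as an `S`, or does not
slalom on `δ` (in particular if `δ` and `η` do not cross). -/
noncomputable def slalomSign {n c c' : ℕ} (D : Finset (Diagonal n c)) (δ : Diagonal n c)
    (η : Diagonal n c') : ℤ :=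
  if ∃ μ ν, AreNeighbours D η μ δ ν ∧ IsZ μ δ ν then 1
  else if ∃ μ ν, AreNeighbours D η μ δ ν ∧ IsS μ δ ν then -1
  else 0

/-- The `g`-vector of the solid diagonal `η` with respect to `D`. -/
noncomputable def gVector {n : ℕ} (D : Finset (HollowDiagonal n)) (η : SolidDiagonal n) :
    EuclideanSpace ℝ D :=
  WithLp.toLp 2 fun δ => (slalomSign D δ.1 η : ℝ)

/-- The `c`-vector of `η ∈ E` with respect to `D`.  Its coordinate at `δ` is `1`, `-1` or `0`
depending on whether `δ` slaloms on `η` as an `S`, as a `Z`, or not (the sign convention is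
opposite to that of `g`-vectors). -/
noncomputable def cVector {n : ℕ} (D : Finset (HollowDiagonal n)) (E : Finset (SolidDiagonal n))
    (η : SolidDiagonal n) : EuclideanSpace ℝ D :=
  WithLp.toLp 2 fun δ => (-slalomSign E η δ.1 : ℝ)

/-- The collection of cones spanned by the `g`-vectors of the `D`-accordion dissections. -/
noncomputable def gVectorFan {n : ℕ} (D : Finset (HollowDiagonal n)) :
    Set (Set (EuclideanSpace ℝ D)) :=
  {K | ∃ E : Finset (SolidDiagonal n), IsAccordionDissection D E ∧
    K = (Submodule.span NNReal (gVector D '' (E : Set (SolidDiagonal n))) :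
      Set (EuclideanSpace ℝ D))}

/-! ### Accordiohedra -/

/-- The `D`-height of `γ`: the number of `D`-accordion diagonals that cross `γ`. -/
noncomputable def height {n : ℕ} (D : Finset (HollowDiagonal n)) (γ : SolidDiagonal n) : ℕ :=
  Set.ncard {η : SolidDiagonal n | IsAccordionDiagonal D η ∧ Crosses η γ}

/-- The sum over `η ∈ E` of the `D'`-height of `η` times the `c`-vector of `η ∈ E` with respect
to `D`. -/
noncomputable def heightPoint {n : ℕ} (D' D : Finset (HollowDiagonal n))
    (E : Finset (SolidDiagonal n)) : EuclideanSpace ℝ D :=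
  ∑ η ∈ E, (height D' η : ℝ) • cVector D E η

/-- The `D`-accordiohedron. -/
noncomputable def Acco {n : ℕ} (D : Finset (HollowDiagonal n)) : Set (EuclideanSpace ℝ D) :=
  convexHull ℝ {x | ∃ E, IsMaximalAccordionDissection D E ∧ x = heightPoint D D E}

/-! ### Normal fans and coordinate projections -/

/-- The (outer) normal fan of `P`: the collection of the normal cones of all nonempty faces
of `P`. -/
def normalFan {V : Type*} [NormedAddCommGroup V] [InnerProductSpace ℝ V] (P : Set V) :
    Set (Set V) :=
  {K | ∃ F : Set V, F.Nonempty ∧ IsExposed ℝ P F ∧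
    K = {v | ∀ x ∈ F, ∀ y ∈ P, ⟪v, y⟫_ℝ ≤ ⟪v, x⟫_ℝ}}

open Classical in
/-- For `D ⊆ D'`, the natural identification of `ℝ^D` with a subspace of `ℝ^D'` (extension
by zero). -/
noncomputable def coordEmbedding {n : ℕ} (D D' : Finset (HollowDiagonal n)) :
    EuclideanSpace ℝ D →ₗ[ℝ] EuclideanSpace ℝ D' where
  toFun x := WithLp.toLp 2 fun δ => if h : δ.1 ∈ D then x ⟨δ.1, h⟩ else 0
  map_add' x y := by
    ext δ
    by_cases h : δ.1 ∈ D <;> simp [h]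
  map_smul' a x := by
    ext δ
    by_cases h : δ.1 ∈ D <;> simp [h]

/-- The subspace of `ℝ^D'` spanned by the basis vectors `e_δ` with `δ ∈ D`. -/
noncomputable def coordSubspace {n : ℕ} (D D' : Finset (HollowDiagonal n)) :
    Submodule ℝ (EuclideanSpace ℝ D') :=
  Submodule.span ℝ {x | ∃ δ : D', δ.1 ∈ D ∧ x = EuclideanSpace.single δ 1}

/-- The orthogonal projection of the `D'`-accordiohedron on `ℝ^D`, as a subset of `ℝ^D`. -/
noncomputable def projectedAcco {n : ℕ} (D D' : Finset (HollowDiagonal n)) :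
    Set (EuclideanSpace ℝ D) :=
  coordEmbedding D D' ⁻¹' ((coordSubspace D D').starProjection '' Acco D')

end AccordionComplex

open AccordionComplex

namespace AccordionComplex

/-! ### Integer lifts of the labels -/

/-! Let Q be the polyhedron of all x with ⟨g(γ), x⟩ ≤ ω(γ) for every D-accordion diagonal γ, where g
is taken with respect to D and the height ω with respect to D'. For a maximal D-accordion dissection
E let p_E be its height point. Three facts carry the proof.

Exchange (`exists_exchange`). If two D-accordion diagonals γ, γ' cross, one pair μ, ν of opposite
sides of their quadrilateral consists of D-accordion diagonals with g(γ) + g(γ') = g(μ) + g(ν),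
while crossings with any fixed set containing γ', hence heights, strictly drop. For a triangulation
the slalom signs are shear coordinates, that is, half of an alternating sum of crossing indicators,
and the relation can be read off. A general D is completed to a triangulation T. The D-accordion
diagonals are exactly the chords with sign 0 on T \ D; on such a diagonal the signs of μ and ν add
up to 0, and opposite nonzero signs would force μ and ν to cross.

Duality (`sum_slalomSign_mul`). The c-vectors of a maximal E are biorthogonal to its g-vectors, so
all inequalities of E are tight at p_E. Induction on the number of crossings with E, by exchange,
then shows that p_E lies in Q and that no other internal diagonal is tight there
(`inner_heightPoint_le`).

Completeness (`exists_mem_cone`). Rotating the diagonals of D gives g-vectors ±e_δ, so every vector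
is a nonnegative combination of g-vectors. A combination with the least total number of crossings is
supported on noncrossing diagonals, by exchange.

The rest is convexity. A vector in the relative interior of the cone of E attains its maximum over Q
exactly on the face where E is tight, and this face contains p_M for each maximal M ⊇ E. Hence a
closed convex subset of Q that meets all these faces is Q (`eq_heightPolyhedron`). This applies to
the hull of the p_M, and also to the projection of Acco(D'), because g(D' | γ) is g(D | γ) extended
by zero for D-accordion diagonals γ. The normal cone of the face of E is the cone of E because any
diagonal of a maximal dissection can be avoided by another one that keeps the rest
(`exists_isMaximal_exchange`).

Circle points are lifted to integers, so that statements on cyclic order become linear inequalities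
in a window of length 2n. -/

/-- The label of an integer modulo `2n`. -/
def pt {n : ℕ} [NeZero n] (z : ℤ) : Fin (2 * n) :=
  ⟨(z % (2 * n)).toNat, by
    have := NeZero.pos n
    have := Int.emod_lt_of_pos z (b := 2 * n) (by omega)
    have := Int.emod_nonneg z (b := 2 * n) (by omega)
    omega⟩

lemma pt_val {n : ℕ} [NeZero n] (z : ℤ) : ((pt z : Fin (2 * n)).val : ℤ) = z % (2 * n) := by
  have := NeZero.pos n
  exact Int.toNat_of_nonneg (Int.emod_nonneg z (by omega))

lemma pt_coe {n : ℕ} [NeZero n] (v : Fin (2 * n)) : pt (v.val : ℤ) = v := by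
  apply Fin.ext
  have h := pt_val (n := n) (v.val : ℤ)
  rw [Int.emod_eq_of_lt (by omega) (by have := v.2; omega)] at h
  exact_mod_cast h

lemma pt_add {n : ℕ} [NeZero n] (z : ℤ) : (pt (z + 2 * n) : Fin (2 * n)) = pt z := by
  apply Fin.ext
  have h := pt_val (n := n) (z + 2 * n)
  rw [Int.add_emod_right, ← pt_val] at h
  exact_mod_cast h

lemma pt_sub {n : ℕ} [NeZero n] (z : ℤ) : (pt (z - 2 * n) : Fin (2 * n)) = pt z := by
  rw [← pt_add, sub_add_cancel]

/-- On a window of length `2n`, the labels are obtained by subtracting `t` or `t + 2n`. -/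
lemma pt_window {n : ℕ} [NeZero n] (m : ℤ) : ∃ t : ℤ, ∀ z, m ≤ z → z < m + 2 * n →
    ((pt z : Fin (2 * n)).val : ℤ) = z - t ∨ ((pt z : Fin (2 * n)).val : ℤ) = z - t - 2 * n := by
  have hn := NeZero.pos n
  refine ⟨2 * n * (m / (2 * n)), fun z h1 h2 => ?_⟩
  have e1 := Int.mul_ediv_add_emod m (2 * n)
  have e2 := Int.emod_nonneg m (b := 2 * n) (by omega)
  have e3 := Int.emod_lt_of_pos m (b := 2 * n) (by omega)
  rw [pt_val]
  set t := 2 * (n : ℤ) * (m / (2 * n)) with ht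
  by_cases h : z - t < 2 * n
  · left
    rw [← Int.emod_eq_of_lt (a := z - t) (b := 2 * n) (by omega) h, ht, Int.sub_mul_emod_self_left]
  · right
    rw [← Int.emod_eq_of_lt (a := z - t - 2 * n) (b := 2 * n) (by omega) (by omega),
      Int.sub_emod_right, ht, Int.sub_mul_emod_self_left]

lemma pt_inj {n : ℕ} [NeZero n] (m : ℤ) {a b : ℤ} (ha : m ≤ a) (ha' : a < m + 2 * n)
    (hb : m ≤ b) (hb' : b < m + 2 * n) (h : (pt a : Fin (2 * n)) = pt b) : a = b := by
  obtain ⟨t, ht⟩ := pt_window (n := n) m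
  have h1 := ht a ha ha'
  have h2 := ht b hb hb'
  rw [h] at h1
  omega

lemma exists_pt {n : ℕ} [NeZero n] (m : ℤ) (v : Fin (2 * n)) :
    ∃ z, m ≤ z ∧ z < m + 2 * n ∧ pt z = v := by
  have hn := NeZero.pos n
  have e2 := Int.emod_nonneg (v.val - m) (b := 2 * n) (by omega)
  have e3 := Int.emod_lt_of_pos (v.val - m) (b := 2 * n) (by omega)
  refine ⟨m + (v.val - m) % (2 * n), by omega, by omega, ?_⟩
  conv_rhs => rw [← pt_coe v]
  apply Fin.ext
  have h := pt_val (n := n) (m + (v.val - m) % (2 * n))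
  rw [Int.add_emod_emod, add_sub_cancel, ← pt_val (n := n) (v.val : ℤ), Nat.cast_inj] at h
  exact h

/-- The clockwise order in terms of lifts that lie in a common window. -/
lemma clockwise_pt_iff {n : ℕ} [NeZero n] (m : ℤ) {a b c d : ℤ}
    (ha : m ≤ a) (ha' : a < m + 2 * n) (hb : m ≤ b) (hb' : b < m + 2 * n)
    (hc : m ≤ c) (hc' : c < m + 2 * n) (hd : m ≤ d) (hd' : d < m + 2 * n) :
    Clockwise (pt a : Fin (2 * n)) (pt b) (pt c) (pt d) ↔
      (a < b ∧ b < c ∧ c < d) ∨ (b < c ∧ c < d ∧ d < a) ∨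
      (c < d ∧ d < a ∧ a < b) ∨ (d < a ∧ a < b ∧ b < c) := by
  obtain ⟨t, ht⟩ := pt_window (n := n) m
  have h1 := ht a ha ha'
  have h2 := ht b hb hb'
  have h3 := ht c hc hc'
  have h4 := ht d hd hd'
  have l1 := (pt a : Fin (2 * n)).2
  have l2 := (pt b : Fin (2 * n)).2
  have l3 := (pt c : Fin (2 * n)).2
  have l4 := (pt d : Fin (2 * n)).2
  simp only [Clockwise, Fin.lt_def]
  generalize (pt a : Fin (2 * n)).val = A at *
  generalize (pt b : Fin (2 * n)).val = B at *
  generalize (pt c : Fin (2 * n)).val = C at *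
  generalize (pt d : Fin (2 * n)).val = E at *
  clear ht
  rcases h1 with h1 | h1 <;> rcases h2 with h2 | h2 <;> rcases h3 with h3 | h3 <;>
    rcases h4 with h4 | h4 <;> constructor <;> (rintro (h | h | h | h) <;> omega)

/-- The crossing relation in terms of lifts that lie in a common window. -/
lemma segmentsCross_pt_iff {n : ℕ} [NeZero n] (m : ℤ) {x y a b : ℤ}
    (hx : m ≤ x) (hx' : x < m + 2 * n) (hy : m ≤ y) (hy' : y < m + 2 * n)
    (ha : m ≤ a) (ha' : a < m + 2 * n) (hb : m ≤ b) (hb' : b < m + 2 * n) :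
    SegmentsCross (pt x : Fin (2 * n)) (pt y) (pt a) (pt b) ↔
      ((x < a ∧ a < y ∧ y < b) ∨ (a < y ∧ y < b ∧ b < x) ∨
        (y < b ∧ b < x ∧ x < a) ∨ (b < x ∧ x < a ∧ a < y)) ∨
      ((x < b ∧ b < y ∧ y < a) ∨ (b < y ∧ y < a ∧ a < x) ∨
        (y < a ∧ a < x ∧ x < b) ∨ (a < x ∧ x < b ∧ b < y)) := by
  rw [SegmentsCross, clockwise_pt_iff m hx hx' ha ha' hy hy' hb hb',
    clockwise_pt_iff m hx hx' hb hb' hy hy' ha ha']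


/-! ### Crossings and endpoints -/

lemma Clockwise.rotate {m : ℕ} {a b c d : Fin m} (h : Clockwise a b c d) :
    Clockwise b c d a := by
  rcases h with h | h | h | h
  exacts [Or.inr (Or.inr (Or.inr h)), Or.inl h, Or.inr (Or.inl h), Or.inr (Or.inr (Or.inl h))]

lemma segmentsCross_comm_right {m : ℕ} {a b c d : Fin m} :
    SegmentsCross a b c d ↔ SegmentsCross a b d c := Or.comm

lemma segmentsCross_comm_left {m : ℕ} {a b c d : Fin m} :
    SegmentsCross a b c d ↔ SegmentsCross b a c d :=
  ⟨fun h => h.symm.imp (·.rotate.rotate) (·.rotate.rotate),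
    fun h => h.symm.imp (·.rotate.rotate) (·.rotate.rotate)⟩

lemma segmentsCross_comm {m : ℕ} {a b c d : Fin m} :
    SegmentsCross a b c d ↔ SegmentsCross c d a b :=
  ⟨fun h => h.symm.imp (·.rotate.rotate.rotate) (·.rotate),
    fun h => h.symm.imp (·.rotate.rotate.rotate) (·.rotate)⟩

lemma not_segmentsCross_self {m : ℕ} {a b c : Fin m} : ¬ SegmentsCross a b c c := by
  simp only [SegmentsCross, Clockwise]; omega

/-- The chords `xy` and `ab` between integer lifts cross. -/
def Cr (n : ℕ) [NeZero n] (x y a b : ℤ) : Prop :=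
  SegmentsCross (pt x : Fin (2 * n)) (pt y) (pt a) (pt b)

section

set_option linter.unusedSectionVars false

variable {n c c' : ℕ} [NeZero n]

lemma Cr.symm {x y a b : ℤ} (h : Cr n x y a b) : Cr n a b x y := segmentsCross_comm.1 h

lemma Cr.swap_left {x y a b : ℤ} (h : Cr n x y a b) : Cr n y x a b := segmentsCross_comm_left.1 h

lemma cr_of_lt {x y a b : ℤ} (h1 : x < a) (h2 : a < y) (h3 : y < b) (h4 : b < x + 2 * n) :
    Cr n x y a b :=
  (segmentsCross_pt_iff x (by omega) (by omega) (by omega) (by omega) (by omega) (by omega)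
    (by omega) (by omega)).2 (by omega)

lemma cr_iff (m : ℤ) {x y a b : ℤ}
    (hx : m ≤ x) (hx' : x < m + 2 * n) (hy : m ≤ y) (hy' : y < m + 2 * n)
    (ha : m ≤ a) (ha' : a < m + 2 * n) (hb : m ≤ b) (hb' : b < m + 2 * n) :
    Cr n x y a b ↔
      ((x < a ∧ a < y ∧ y < b) ∨ (a < y ∧ y < b ∧ b < x) ∨
        (y < b ∧ b < x ∧ x < a) ∨ (b < x ∧ x < a ∧ a < y)) ∨
      ((x < b ∧ b < y ∧ y < a) ∨ (b < y ∧ y < a ∧ a < x) ∨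
        (y < a ∧ a < x ∧ x < b) ∨ (a < x ∧ x < b ∧ b < y)) :=
  segmentsCross_pt_iff m hx hx' hy hy' ha ha' hb hb'

/-- A chord crosses `xy` iff exactly one of its endpoints lies between `x` and `y`. -/
lemma cr_iff_of_lt {x y a b : ℤ} (hxy : x < y) (hyx : y < x + 2 * n)
    (ha : x ≤ a) (ha' : a < x + 2 * n) (hb : x ≤ b) (hb' : b < x + 2 * n) :
    Cr n x y a b ↔ (x < a ∧ a < y ∧ y < b) ∨ (x < b ∧ b < y ∧ y < a) := by
  rw [cr_iff x le_rfl (by omega) hxy.le hyx ha ha' hb hb']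
  constructor
  · rintro ((h | h | h | h) | (h | h | h | h)) <;> omega
  · rintro (h | h)
    · exact Or.inl (Or.inl h)
    · exact Or.inr (Or.inl h)

lemma Joins.symm {δ : Diagonal n c} {a b : Fin (2 * n)} (h : Joins δ a b) : Joins δ b a :=
  Or.symm h

lemma Joins.unique {δ δ' : Diagonal n c} {a b : Fin (2 * n)} (h : Joins δ a b)
    (h' : Joins δ' a b) : δ = δ' := by
  have h1 := δ.2.1
  have h2 := δ'.2.1
  apply Subtype.ext
  rcases h with ⟨e1, e2⟩ | ⟨e1, e2⟩ <;> rcases h' with ⟨e3, e4⟩ | ⟨e3, e4⟩ <;>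
    rw [Fin.lt_def] at h1 h2 <;> ext <;> simp_all <;> omega

lemma Joins.crosses_iff {δ : Diagonal n c} {η : Diagonal n c'} {a b i j : Fin (2 * n)}
    (h : Joins δ a b) (h' : Joins η i j) : Crosses δ η ↔ SegmentsCross a b i j := by
  unfold Crosses
  rcases h with ⟨e1, e2⟩ | ⟨e1, e2⟩ <;> rcases h' with ⟨e3, e4⟩ | ⟨e3, e4⟩ <;> subst e1 e2 e3 e4
  · rfl
  · exact segmentsCross_comm_right
  · exact segmentsCross_comm_left
  · exact segmentsCross_comm_left.trans segmentsCross_comm_right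

lemma Crosses.symm {δ : Diagonal n c} {η : Diagonal n c'} (h : Crosses δ η) : Crosses η δ :=
  segmentsCross_comm.1 h

lemma not_crosses_self (δ : Diagonal n c) : ¬ Crosses δ δ := by
  simp only [Crosses, SegmentsCross, Clockwise]; omega

lemma pt_parity (z : ℤ) : (((pt z : Fin (2 * n)).val % 2 : ℕ) : ℤ) = z % 2 := by
  push_cast
  rw [pt_val]
  exact Int.emod_emod_of_dvd z (Dvd.intro _ rfl)

lemma joins_self (δ : Diagonal n c) : Joins δ (pt δ.1.1.val) (pt δ.1.2.val) := by
  rw [pt_coe, pt_coe]; exact Or.inl ⟨rfl, rfl⟩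

lemma Joins.parity {δ : Diagonal n c} {a b : ℤ} (h : Joins δ (pt a) (pt b)) :
    a % 2 = c ∧ b % 2 = c := by
  have h1 := δ.2.2
  rw [← pt_parity (n := n), ← pt_parity (n := n)]
  rcases h with ⟨e1, e2⟩ | ⟨e1, e2⟩ <;> rw [← e1, ← e2] <;> omega

lemma exists_joins {a b : ℤ} (ha : a % 2 = c) (hb : b % 2 = c)
    (hab : (pt a : Fin (2 * n)) ≠ pt b) : ∃ δ : Diagonal n c, Joins δ (pt a) (pt b) := by
  rw [← pt_parity (n := n), Nat.cast_inj] at ha hb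
  rcases lt_or_gt_of_ne hab with h | h
  · exact ⟨⟨(pt a, pt b), h, ha, hb⟩, Or.inl ⟨rfl, rfl⟩⟩
  · exact ⟨⟨(pt b, pt a), h, hb, ha⟩, Or.inr ⟨rfl, rfl⟩⟩

lemma exists_joins_of_lt {a b : ℤ} (ha : a % 2 = c) (hb : b % 2 = c)
    (hab : a < b) (hba : b < a + 2 * n) : ∃ δ : Diagonal n c, Joins δ (pt a) (pt b) :=
  exists_joins ha hb fun h => by
    have := pt_inj a (by omega) (by omega) (by omega) (by omega) h
    omega

lemma Joins.isBoundary_iff {δ : Diagonal n c} {a b : ℤ} (h : Joins δ (pt a) (pt b))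
    (hab : a < b) (hba : b < a + 2 * n) : IsBoundary δ ↔ b = a + 2 ∨ b + 2 = a + 2 * n := by
  obtain ⟨t, ht⟩ := pt_window (n := n) a
  have h1 := ht a (by omega) (by omega)
  have h2 := ht b (by omega) (by omega)
  have l0 := δ.2.1
  have l1 := δ.1.1.2
  have l2 := δ.1.2.2
  rw [Fin.lt_def] at l0
  unfold IsBoundary
  rcases h with ⟨e1, e2⟩ | ⟨e1, e2⟩ <;> [rw [← e1] at h1; rw [← e2] at h1] <;>
    [rw [← e2] at h2; rw [← e1] at h2] <;> omega

/-- A diagonal that joins `a` to something else. -/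
lemma exists_lift (δ : Diagonal n c) : ∃ p q : ℤ, p < q ∧ q < p + 2 * n ∧ Joins δ (pt p) (pt q) :=
  ⟨_, _, by have := δ.2.1; rw [Fin.lt_def] at this; omega, by have := δ.1.2.2; omega, joins_self δ⟩

/-- If the diagonal `δ` crosses the chord `ij`, it joins some `x` between `i` and `j` to some
`y` on the other side. -/
lemma exists_lift_of_cr {δ : Diagonal n c} {i j : ℤ} (hij : i < j) (hji : j < i + 2 * n)
    {u v : Fin (2 * n)} (hδ : Joins δ u v)
    (h : SegmentsCross u v (pt i) (pt j)) :
    ∃ x y, i < x ∧ x < j ∧ j < y ∧ y < i + 2 * n ∧ Joins δ (pt x) (pt y) := by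
  obtain ⟨x, hx, hx', rfl⟩ := exists_pt i u
  obtain ⟨y, hy, hy', rfl⟩ := exists_pt i v
  rw [segmentsCross_pt_iff i hx hx' hy hy' (by omega) (by omega) (by omega) (by omega)] at h
  by_cases hxy : x < y
  · exact ⟨x, y, by omega, by omega, by omega, by omega, hδ⟩
  · exact ⟨y, x, by omega, by omega, by omega, by omega, hδ.symm⟩

/-! ### Dissections as periodic relations on the integers -/

/-- The integers `a` and `b` are lifts of the endpoints of a diagonal of `D` or of a boundary
edge. -/
def bar (D : Finset (Diagonal n c)) (a b : ℤ) : Prop :=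
  ∃ δ ∈ withBoundary D, Joins δ (pt a) (pt b)

lemma bar.symm {D : Finset (Diagonal n c)} {a b : ℤ} (h : bar D a b) : bar D b a :=
  let ⟨δ, h1, h2⟩ := h; ⟨δ, h1, h2.symm⟩

lemma bar.symm_iff {D : Finset (Diagonal n c)} {a b : ℤ} : bar D a b ↔ bar D b a :=
  ⟨bar.symm, bar.symm⟩

lemma bar_add_iff {D : Finset (Diagonal n c)} {a b : ℤ} : bar D a (b + 2 * n) ↔ bar D a b := by
  simp only [bar, pt_add]

lemma bar_sub_iff {D : Finset (Diagonal n c)} {a b : ℤ} : bar D a (b - 2 * n) ↔ bar D a b := by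
  simp only [bar, pt_sub]

lemma bar.parity {D : Finset (Diagonal n c)} {a b : ℤ} (h : bar D a b) :
    a % 2 = c ∧ b % 2 = c :=
  let ⟨_, _, h2⟩ := h; h2.parity

lemma bar.mono {D D' : Finset (Diagonal n c)} (hD : D ⊆ D') {a b : ℤ} (h : bar D a b) :
    bar D' a b :=
  let ⟨δ, h1, h2⟩ := h; ⟨δ, h1.imp_left (@hD δ), h2⟩

lemma bar_of_mem {D : Finset (Diagonal n c)} {δ : Diagonal n c} (h : δ ∈ D) {a b : ℤ}
    (hab : Joins δ (pt a) (pt b)) : bar D a b := ⟨δ, Or.inl h, hab⟩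

lemma Joins.mem_withBoundary {D : Finset (Diagonal n c)} {δ : Diagonal n c} {a b : ℤ}
    (hδ : Joins δ (pt a) (pt b)) (h : bar D a b) : δ ∈ withBoundary D := by
  obtain ⟨δ', h1, h2⟩ := h
  rwa [hδ.unique h2]

lemma bar_add_two (D : Finset (Diagonal n c)) (hn : 3 ≤ n) {a : ℤ} (ha : a % 2 = c) :
    bar D a (a + 2) := by
  obtain ⟨δ, hδ⟩ := exists_joins_of_lt (n := n) (c := c) (a := a) (b := a + 2) ha (by omega)
    (by omega) (by omega)
  exact ⟨δ, Or.inr ((hδ.isBoundary_iff (by omega) (by omega)).2 (Or.inl rfl)), hδ⟩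

/-- Diagonals of a dissection do not cross each other, nor the boundary edges. -/
lemma bar.not_cross {D : Finset (Diagonal n c)} (hD : IsDissection D) {a b p q : ℤ}
    (h : bar D a b) (h' : bar D p q) (h1 : a < p) (h2 : p < b) (h3 : b < q)
    (h4 : q < a + 2 * n) : False := by
  have p1 := h.parity
  have p2 := h'.parity
  obtain ⟨δ, hδ, j1⟩ := h
  obtain ⟨δ', hδ', j2⟩ := h'
  rcases hδ with hδ | hδ
  · rcases hδ' with hδ' | hδ'
    · exact hD.2 δ hδ δ' hδ' ((j1.crosses_iff j2).2 (cr_of_lt h1 h2 h3 h4))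
    -- No vertex of the right parity lies strictly on the short side of a boundary edge.
    · rw [j2.isBoundary_iff (by omega) (by omega)] at hδ'
      omega
  · rw [j1.isBoundary_iff (by omega) (by omega)] at hδ
    omega

/-! ### Slaloms without cells -/

/-- A set of vertices that are pairwise not separated by the dissection lies in a cell. -/
lemma exists_isCell (D : Finset (Diagonal n c)) (S : Finset (Fin (2 * n)))
    (h1 : ∀ v ∈ S, v.val % 2 = c)
    (h2 : ∀ u ∈ S, ∀ v ∈ S, ∀ δ ∈ D, ¬ SegmentsCross δ.1.1 δ.1.2 u v) :
    ∃ C, IsCell D C ∧ S ⊆ C := by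
  obtain ⟨C, hSC, hC⟩ := Finite.exists_le_maximal
    (p := fun S : Finset (Fin (2 * n)) => (∀ v ∈ S, v.val % 2 = c) ∧
      ∀ u ∈ S, ∀ v ∈ S, ∀ δ ∈ D, ¬ SegmentsCross δ.1.1 δ.1.2 u v) ⟨h1, h2⟩
  refine ⟨C, ⟨hC.prop.1, hC.prop.2, fun w hw hw' => ?_⟩, hSC⟩
  refine hC.le_of_ge (y := insert w C) ⟨?_, ?_⟩ (Finset.subset_insert _ _)
    (Finset.mem_insert_self w C)
  · intro v hv
    rcases Finset.mem_insert.1 hv with rfl | hv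
    exacts [hw, hC.prop.1 v hv]
  · intro u hu v hv δ hδ
    rcases Finset.mem_insert.1 hu with hu | hu <;> rcases Finset.mem_insert.1 hv with hv | hv
    · rw [hu, hv]; exact not_segmentsCross_self
    · rw [hu]; exact fun h => hw' v hv δ hδ (segmentsCross_comm_right.1 h)
    · rw [hv]; exact hw' u hu δ hδ
    · exact hC.prop.2 u hu v hv δ hδ

/-- Two chords of `D` from `p` with nothing of `D` between them lie in a common cell. -/
lemma exists_isCell_of_bar {D : Finset (Diagonal n c)} (hD : IsDissection D) {p q u : ℤ}
    (hpq : bar D p q) (hpu : bar D p u)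
    (h1 : p < q) (h2 : q < p + 2 * n) (h3 : p < u) (h4 : u < p + 2 * n)
    (hno : ∀ e, bar D p e → (q < e ∧ e < u) ∨ (u < e ∧ e < q) → False) :
    ∃ C, IsCell D C ∧ pt p ∈ C ∧ pt q ∈ C ∧ pt u ∈ C := by
  have hpp := hpq.parity
  have hpp' := hpu.parity
  have key : ∀ x y : ℤ, (x = p ∨ x = q ∨ x = u) → (y = p ∨ y = q ∨ y = u) → x < y →
      ∀ δ ∈ D, ¬ SegmentsCross δ.1.1 δ.1.2 (pt x) (pt y) := by
    intro x y hx hy hxy δ hδ h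
    obtain ⟨a, b, h5, h6, h7, h8, hj⟩ := exists_lift_of_cr hxy
      (by rcases hx with rfl | rfl | rfl <;> rcases hy with rfl | rfl | rfl <;> omega)
      (Or.inl ⟨rfl, rfl⟩ : Joins δ δ.1.1 δ.1.2) h
    have hab := bar_of_mem hδ hj
    have hba := (bar_sub_iff.2 hab).symm
    clear hj h
    -- A diagonal ab separating the two outer ends z < w crosses pw, or ends at p between them
    -- (excluded by `hno`), or crosses pz, according to the position of b relative to p + 2n.
    have main : ∀ z w, bar D p z → bar D p w → x = z → y = w → p < z → w < p + 2 * n →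
        (∀ e, bar D p e → z < e → e < w → False) → False := by
      rintro z w hz hw rfl rfl h9 h10 hno
      rcases lt_trichotomy b (p + 2 * n) with hb | rfl | hb
      · exact hw.not_cross hD hab (by omega) h6 h7 hb
      · exact hno a (bar_add_iff.1 hab).symm h5 h6
      · exact hz.not_cross hD hba (by omega) (by omega) h5 (by omega)
    rcases hx with rfl | rfl | rfl <;> rcases hy with rfl | rfl | rfl
    · omega
    · exact hpq.not_cross hD hab h5 h6 h7 h8
    · exact hpu.not_cross hD hab h5 h6 h7 h8
    · omega
    · omega
    · exact main x y hpq hpu rfl rfl h1 h4 fun e he e1 e2 => hno e he (Or.inl ⟨e1, e2⟩)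
    · omega
    · exact main x y hpu hpq rfl rfl h3 h2 fun e he e1 e2 => hno e he (Or.inr ⟨e1, e2⟩)
    · omega
  obtain ⟨C, hC, hS⟩ := exists_isCell D {pt p, pt q, pt u} (by
    intro v hv
    have : (v.val % 2 : ℕ) = (c : ℤ) := by
      simp only [Finset.mem_insert, Finset.mem_singleton] at hv
      rcases hv with rfl | rfl | rfl <;> rw [pt_parity] <;> omega
    exact_mod_cast this) (by
    have aux : ∀ v ∈ ({pt p, pt q, pt u} : Finset (Fin (2 * n))),
        ∃ x, (x = p ∨ x = q ∨ x = u) ∧ v = pt x := by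
      intro v hv
      simp only [Finset.mem_insert, Finset.mem_singleton] at hv
      rcases hv with rfl | rfl | rfl
      exacts [⟨p, by simp⟩, ⟨q, by simp⟩, ⟨u, by simp⟩]
    intro v hv w hw δ hδ h
    obtain ⟨x, hx, rfl⟩ := aux v hv
    obtain ⟨y, hy, rfl⟩ := aux w hw
    rcases lt_trichotomy x y with hxy | rfl | hxy
    · exact key x y hx hy hxy δ hδ h
    · exact not_segmentsCross_self h
    · exact key y x hy hx hxy δ hδ (segmentsCross_comm_right.1 h))
  exact ⟨C, hC, hS (by simp), hS (by simp), hS (by simp)⟩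

lemma Joins.crossed_iff {D : Finset (Diagonal n c)} {η : Diagonal n c'} {i j : ℤ}
    (hη : Joins η (pt i) (pt j)) {δ : Diagonal n c} {x y : ℤ} (hδ : Joins δ (pt x) (pt y)) :
    δ ∈ crossed D η ↔ bar D x y ∧ Cr n x y i j :=
  and_congr ⟨fun h => ⟨δ, h, hδ⟩, fun h => hδ.mem_withBoundary h⟩ (hδ.crosses_iff hη)

/-- If a chord crosses `pq` and `pu`, it crosses all chords from `p` between them. -/
lemma Cr.between {p q u e i j : ℤ} (h1 : Cr n p q i j) (h2 : Cr n p u i j) (hp : p < q)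
    (hqe : q < e) (heu : e < u) (hu : u < p + 2 * n) : Cr n p e i j := by
  have aux : ∀ k : ℤ, ∃ k', p ≤ k' ∧ k' < p + 2 * n ∧ (pt k' : Fin (2 * n)) = pt k :=
    fun k => exists_pt p (pt k)
  obtain ⟨i', hi, hi', ei⟩ := aux i
  obtain ⟨j', hj, hj', ej⟩ := aux j
  unfold Cr at h1 h2 ⊢
  rw [← ei, ← ej] at h1 h2 ⊢
  change Cr n _ _ _ _ at h1 h2
  change Cr n _ _ _ _
  rw [cr_iff_of_lt (by omega) (by omega) hi hi' hj hj'] at h1 h2 ⊢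
  omega

/-- The first diagonal after `pq` around `p` that is crossed by `ij`. -/
lemma exists_next_bar {D : Finset (Diagonal n c)} (hD : IsDissection D) {p q u i j : ℤ}
    (hpq : bar D p q) (hpu : bar D p u) (hc : Cr n p q i j) (hcu : Cr n p u i j)
    (h1 : p < q) (h2 : q < u) (h3 : u < p + 2 * n) :
    ∃ u', q < u' ∧ u' < p + 2 * n ∧ bar D p u' ∧ Cr n p u' i j ∧
      ∃ C, IsCell D C ∧ pt p ∈ C ∧ pt q ∈ C ∧ pt u' ∈ C := by
  obtain ⟨u', ⟨h4, h5, h6, h7⟩, hmin⟩ := Int.exists_least_of_bdd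
    (P := fun u => q < u ∧ u < p + 2 * n ∧ bar D p u ∧ Cr n p u i j)
    ⟨q, fun z hz => hz.1.le⟩ ⟨u, h2, h3, hpu, hcu⟩
  refine ⟨u', h4, h5, h6, h7, exists_isCell_of_bar hD hpq h6 h1 (by omega) (by omega) h5 ?_⟩
  rintro e he (⟨e1, e2⟩ | ⟨e1, e2⟩)
  · have := hmin e ⟨e1, by omega, he, hc.between h7 h1 e1 e2 h5⟩
    omega
  · omega

/-- The last diagonal before `pq` around `p` that is crossed by `ij`. -/
lemma exists_prev_bar {D : Finset (Diagonal n c)} (hD : IsDissection D) {p q u i j : ℤ}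
    (hpq : bar D p q) (hpu : bar D p u) (hc : Cr n p q i j) (hcu : Cr n p u i j)
    (h1 : p < u) (h2 : u < q) (h3 : q < p + 2 * n) :
    ∃ u', p < u' ∧ u' < q ∧ bar D p u' ∧ Cr n p u' i j ∧
      ∃ C, IsCell D C ∧ pt p ∈ C ∧ pt q ∈ C ∧ pt u' ∈ C := by
  obtain ⟨u', ⟨h4, h5, h6, h7⟩, hmax⟩ := Int.exists_greatest_of_bdd
    (P := fun u => p < u ∧ u < q ∧ bar D p u ∧ Cr n p u i j)
    ⟨q, fun z hz => hz.2.1.le⟩ ⟨u, h1, h2, hpu, hcu⟩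
  refine ⟨u', h4, h5, h6, h7,
    exists_isCell_of_bar hD hpq h6 (by omega) (by omega) (by omega) (by omega) ?_⟩
  rintro e he (⟨e1, e2⟩ | ⟨e1, e2⟩)
  · omega
  · have := hmax e ⟨by omega, e2, he, h7.between hc h4 e1 e2 h3⟩
    omega

/-- The cells C and C' differ because δ belongs to D and separates u ∈ C from w ∈ C'. -/
lemma areNeighbours_of_cells {D : Finset (Diagonal n c)} {η : Diagonal n c'}
    {δ μ ν : Diagonal n c} {p q u w i j : ℤ} (hδD : δ ∈ D)
    (hη : Joins η (pt i) (pt j)) (hδ : Joins δ (pt p) (pt q)) (hμ : Joins μ (pt u) (pt p))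
    (hν : Joins ν (pt q) (pt w)) (hpu : bar D p u) (hqw : bar D q w) (hc : Cr n p q i j)
    (hcu : Cr n p u i j) (hcw : Cr n q w i j) {C C' : Finset (Fin (2 * n))} (hC : IsCell D C)
    (hC' : IsCell D C') (hp : pt p ∈ C) (hq : pt q ∈ C) (hu : pt u ∈ C) (hp' : pt p ∈ C')
    (hq' : pt q ∈ C') (hw : pt w ∈ C') (hs : Cr n p q u w) :
    AreNeighbours D η μ δ ν := by
  have ends : ∀ {α : Diagonal n c} {a b : Fin (2 * n)} {C : Finset (Fin (2 * n))},
      Joins α a b → a ∈ C → b ∈ C → α.1.1 ∈ C ∧ α.1.2 ∈ C := by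
    rintro α a b C (⟨h1, h2⟩ | ⟨h1, h2⟩) ha hb <;> rw [h1, h2]
    exacts [⟨ha, hb⟩, ⟨hb, ha⟩]
  have hsep : SegmentsCross δ.1.1 δ.1.2 (pt u) (pt w) := by
    rcases hδ with ⟨h1, h2⟩ | ⟨h1, h2⟩ <;> rw [h1, h2]
    exacts [hs, hs.swap_left]
  refine ⟨(hδ.crosses_iff hη).2 hc, (hη.crossed_iff hμ).2 ⟨hpu.symm, hcu.swap_left⟩,
    (hη.crossed_iff hν).2 ⟨hqw, hcw⟩, ?_, ?_, C, C', hC, hC', ?_, (ends hδ hp hq).1,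
    (ends hδ hp hq).2, (ends hδ hp' hq').1, (ends hδ hp' hq').2, (ends hμ hu hp).1,
    (ends hμ hu hp).2, (ends hν hq' hw).1, (ends hν hq' hw).2⟩
  · rintro rfl
    rcases hδ with ⟨h1, h2⟩ | ⟨h1, h2⟩ <;> rcases hμ with ⟨h3, h4⟩ | ⟨h3, h4⟩ <;>
      simp_all [SegmentsCross, Clockwise] <;> omega
  · rintro rfl
    rcases hδ with ⟨h1, h2⟩ | ⟨h1, h2⟩ <;> rcases hν with ⟨h3, h4⟩ | ⟨h3, h4⟩ <;>
      simp_all [SegmentsCross, Clockwise] <;> omega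
  · rintro rfl
    exact hC.2.1 _ hu _ hw δ hδD hsep

lemma Joins.eq_or {δ : Diagonal n c} {a b a' b' : Fin (2 * n)} (h : Joins δ a b)
    (h' : Joins δ a' b') : (a' = a ∧ b' = b) ∨ (a' = b ∧ b' = a) := by
  rcases h with ⟨h1, h2⟩ | ⟨h1, h2⟩ <;> rcases h' with ⟨h3, h4⟩ | ⟨h3, h4⟩ <;> grind

lemma clockwise_lift {p q : ℤ} {u w : Fin (2 * n)} (h1 : p < q) (h2 : q < p + 2 * n)
    (h : Clockwise u (pt p) w (pt q)) :
    ∃ u' w', p < w' ∧ w' < q ∧ q < u' ∧ u' < p + 2 * n ∧ pt u' = u ∧ pt w' = w := by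
  obtain ⟨u', hu, hu', rfl⟩ := exists_pt p u
  obtain ⟨w', hw, hw', rfl⟩ := exists_pt p w
  rw [clockwise_pt_iff p hu hu' (by omega) (by omega) hw hw' (by omega) (by omega)] at h
  exact ⟨u', w', by omega, by omega, by omega, by omega, rfl, rfl⟩

/-- `ij` slaloms as a `Z` on the chord `pq` of `D`. -/
def ZSlalom (D : Finset (Diagonal n c)) (p q i j : ℤ) : Prop :=
  Cr n p q i j ∧ (∃ u, q < u ∧ u < p + 2 * n ∧ bar D p u ∧ Cr n p u i j) ∧
    ∃ w, p < w ∧ w < q ∧ bar D q w ∧ Cr n q w i j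

/-- `ij` slaloms as an `S` on the chord `pq` of `D`. -/
def SSlalom (D : Finset (Diagonal n c)) (p q i j : ℤ) : Prop :=
  Cr n p q i j ∧ (∃ u, p < u ∧ u < q ∧ bar D p u ∧ Cr n p u i j) ∧
    ∃ w, q < w ∧ w < p + 2 * n ∧ bar D q w ∧ Cr n q w i j

/-- Cells can be forgotten: as soon as some crossed chord at p lies on the correct side of pq, the
crossed chord at p nearest to pq shares a cell with pq, and it turns the same way. The same holds at
q. -/
lemma exists_isZ_iff {D : Finset (Diagonal n c)} (hD : IsDissection D) {δ : Diagonal n c}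
    {η : Diagonal n c'} {p q i j : ℤ} (hδD : δ ∈ D) (hδ : Joins δ (pt p) (pt q))
    (h1 : p < q) (h2 : q < p + 2 * n) (hη : Joins η (pt i) (pt j)) :
    (∃ μ ν, AreNeighbours D η μ δ ν ∧ IsZ μ δ ν) ↔ ZSlalom D p q i j := by
  have hpq := bar_of_mem hδD hδ
  constructor
  · rintro ⟨μ, ν, hnb, u, p', q', w, hμ, hδ', hν, hcw⟩
    have hc := (hδ.crosses_iff hη).1 hnb.1
    rcases hδ.eq_or hδ' with ⟨rfl, rfl⟩ | ⟨rfl, rfl⟩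
    · obtain ⟨u, w, h3, h4, h5, h6, rfl, rfl⟩ := clockwise_lift h1 h2 hcw
      have hu := (hη.crossed_iff hμ.symm).1 hnb.2.1
      have hw := (hη.crossed_iff hν).1 hnb.2.2.1
      exact ⟨hc, ⟨u, h5, h6, hu⟩, ⟨w, h3, h4, hw⟩⟩
    · obtain ⟨w, u, h3, h4, h5, h6, rfl, rfl⟩ := clockwise_lift h1 h2 hcw.rotate.rotate
      have hu := (hη.crossed_iff hμ.symm).1 hnb.2.1
      have hw := (hη.crossed_iff hν).1 hnb.2.2.1
      exact ⟨hc, ⟨w, h5, h6, hw⟩, ⟨u, h3, h4, hu⟩⟩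
  · rintro ⟨hc, ⟨u, h3, h4, h5, h6⟩, ⟨w, h7, h8, h9, h10⟩⟩
    obtain ⟨u, h3, h4, h5, h6, C, hC, hp, hq, hu⟩ := exists_next_bar hD hpq h5 hc h6 h1 h3 h4
    -- Seen from q the window starts at q, so the ends p and w are replaced by p + 2n and w + 2n.
    obtain ⟨w, h7, h8, h9, h10, C', hC', hq', hp', hw⟩ := exists_next_bar hD
      (bar_add_iff.2 hpq.symm) (u := w + 2 * n) (p := q) (q := p + 2 * n) (i := i) (j := j)
      (bar_add_iff.2 h9) (by unfold Cr; rw [pt_add]; exact hc.swap_left)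
      (by unfold Cr; rw [pt_add]; exact h10) (by omega) (by omega) (by omega)
    rw [pt_add] at hp'
    obtain ⟨μ, mμ, hμ⟩ := h5
    obtain ⟨ν, mν, hν⟩ := h9
    have hcl : Clockwise (pt u : Fin (2 * n)) (pt p) (pt w) (pt q) := by
      rw [← pt_sub w, clockwise_pt_iff p] <;> omega
    refine ⟨μ, ν, areNeighbours_of_cells hδD hη hδ hμ.symm hν ⟨μ, mμ, hμ⟩ ⟨ν, mν, hν⟩ hc h6 h10
      hC hC' hp hq hu hp' hq' hw (Or.inr hcl.rotate), pt u, pt p, pt q, pt w, hμ.symm, hδ, hν, hcl⟩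

lemma exists_isS_iff {D : Finset (Diagonal n c)} (hD : IsDissection D) {δ : Diagonal n c}
    {η : Diagonal n c'} {p q i j : ℤ} (hδD : δ ∈ D) (hδ : Joins δ (pt p) (pt q))
    (h1 : p < q) (h2 : q < p + 2 * n) (hη : Joins η (pt i) (pt j)) :
    (∃ μ ν, AreNeighbours D η μ δ ν ∧ IsS μ δ ν) ↔ SSlalom D p q i j := by
  have hpq := bar_of_mem hδD hδ
  constructor
  · rintro ⟨μ, ν, hnb, u, p', q', w, hμ, hδ', hν, hcw⟩
    have hc := (hδ.crosses_iff hη).1 hnb.1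
    rcases hδ.eq_or hδ' with ⟨rfl, rfl⟩ | ⟨rfl, rfl⟩
    · obtain ⟨w, u, h3, h4, h5, h6, rfl, rfl⟩ := clockwise_lift h1 h2 hcw.rotate.rotate
      have hu := (hη.crossed_iff hμ.symm).1 hnb.2.1
      have hw := (hη.crossed_iff hν).1 hnb.2.2.1
      exact ⟨hc, ⟨u, h3, h4, hu⟩, ⟨w, h5, h6, hw⟩⟩
    · obtain ⟨u, w, h3, h4, h5, h6, rfl, rfl⟩ := clockwise_lift h1 h2 hcw
      have hu := (hη.crossed_iff hμ.symm).1 hnb.2.1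
      have hw := (hη.crossed_iff hν).1 hnb.2.2.1
      exact ⟨hc, ⟨w, h3, h4, hw⟩, ⟨u, h5, h6, hu⟩⟩
  · rintro ⟨hc, ⟨u, h3, h4, h5, h6⟩, ⟨w, h7, h8, h9, h10⟩⟩
    obtain ⟨u, h3, h4, h5, h6, C, hC, hp, hq, hu⟩ := exists_prev_bar hD hpq h5 hc h6 h3 h4 h2
    obtain ⟨w, h7, h8, h9, h10, C', hC', hq', hp', hw⟩ := exists_prev_bar hD
      (bar_add_iff.2 hpq.symm) (u := w) (p := q) (q := p + 2 * n) (i := i) (j := j)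
      h9 (by unfold Cr; rw [pt_add]; exact hc.swap_left) h10 (by omega) (by omega) (by omega)
    rw [pt_add] at hp'
    obtain ⟨μ, mμ, hμ⟩ := h5
    obtain ⟨ν, mν, hν⟩ := h9
    have hcl : Clockwise (pt u : Fin (2 * n)) (pt q) (pt w) (pt p) := by
      rw [clockwise_pt_iff p] <;> omega
    refine ⟨μ, ν, areNeighbours_of_cells hδD hη hδ hμ.symm hν ⟨μ, mμ, hμ⟩ ⟨ν, mν, hν⟩ hc h6 h10
      hC hC' hp hq hu hp' hq' hw (Or.inl hcl.rotate.rotate.rotate), pt u, pt p, pt q, pt w,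
      hμ.symm, hδ, hν, hcl⟩

open Classical in
lemma slalomSign_eq_ite_slalom {D : Finset (Diagonal n c)} (hD : IsDissection D)
    {δ : Diagonal n c} {η : Diagonal n c'} {p q i j : ℤ} (hδD : δ ∈ D)
    (hδ : Joins δ (pt p) (pt q)) (h1 : p < q) (h2 : q < p + 2 * n) (hη : Joins η (pt i) (pt j)) :
    slalomSign D δ η = if ZSlalom D p q i j then 1 else if SSlalom D p q i j then -1 else 0 := by
  unfold slalomSign
  simp only [exists_isZ_iff hD hδD hδ h1 h2 hη, exists_isS_iff hD hδD hδ h1 h2 hη]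

/-! ### The chain of diagonals crossed by a chord -/

lemma cr_sub_mid {x y a b : ℤ} : Cr n x (y - 2 * n) a b ↔ Cr n x y a b := by
  unfold Cr; rw [pt_sub]

lemma cr_iff_of_lt' {x y i j : ℤ} (hij : i < j) (hji : j < i + 2 * n)
    (hx : i ≤ x) (hx' : x < i + 2 * n) (hy : i ≤ y) (hy' : y < i + 2 * n) :
    Cr n x y i j ↔ (i < x ∧ x < j ∧ j < y) ∨ (i < y ∧ y < j ∧ j < x) :=
  ⟨fun h => (cr_iff_of_lt hij hji hx hx' hy hy').1 h.symm,
    fun h => ((cr_iff_of_lt hij hji hx hx' hy hy').2 h).symm⟩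

/-- The chord `xy` of `D` is crossed by `ij`. -/
structure Cut (D : Finset (Diagonal n c)) (i j x y : ℤ) : Prop where
  left : i < x
  right : x < j
  left' : j < y
  right' : y < i + 2 * n
  bar : bar D x y

/-- Some chord of `D` that shares the endpoint `x` is crossed by `ij` before `xy`. -/
def PX (D : Finset (Diagonal n c)) (i _j x y : ℤ) : Prop := ∃ y', y < y' ∧ y' < i + 2 * n ∧ bar D x y'

/-- Some chord of `D` that shares the endpoint `x` is crossed by `ij` after `xy`. -/
def NX (D : Finset (Diagonal n c)) (_i j x y : ℤ) : Prop := ∃ y', j < y' ∧ y' < y ∧ bar D x y'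

/-- Some chord of `D` that shares the endpoint `y` is crossed by `ij` before `xy`. -/
def PY (D : Finset (Diagonal n c)) (i _j x y : ℤ) : Prop := ∃ x', i < x' ∧ x' < x ∧ bar D x' y

/-- Some chord of `D` that shares the endpoint `y` is crossed by `ij` after `xy`. -/
def NY (D : Finset (Diagonal n c)) (_i j x y : ℤ) : Prop := ∃ x', x < x' ∧ x' < j ∧ bar D x' y

lemma Cut.cr {D : Finset (Diagonal n c)} {i j x y : ℤ} (h : Cut D i j x y) : Cr n x y i j := by
  obtain ⟨h1, h2, h3, h4, -⟩ := h
  rw [cr_iff_of_lt'] <;> omega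

lemma Cut.zSlalom_iff {D : Finset (Diagonal n c)} {i j x y : ℤ} (h : Cut D i j x y) :
    ZSlalom D x y i j ↔ PX D i j x y ∧ NY D i j x y := by
  have hc := h.cr
  obtain ⟨h1, h2, h3, h4, h5⟩ := h
  refine (and_iff_right hc).trans (and_congr ⟨?_, ?_⟩ ⟨?_, ?_⟩)
  · rintro ⟨u, h6, h7, h8, h9⟩
    refine ⟨u, h6, ?_, h8⟩
    by_contra hu
    rw [← cr_sub_mid, cr_iff_of_lt'] at h9 <;> omega
  · rintro ⟨u, h6, h7, h8⟩
    exact ⟨u, h6, by omega, h8, by rw [cr_iff_of_lt'] <;> omega⟩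
  · rintro ⟨w, h6, h7, h8, h9⟩
    refine ⟨w, h6, ?_, h8.symm⟩
    rw [cr_iff_of_lt'] at h9 <;> omega
  · rintro ⟨w, h6, h7, h8⟩
    exact ⟨w, h6, by omega, h8.symm, by rw [cr_iff_of_lt'] <;> omega⟩

lemma Cut.sSlalom_iff {D : Finset (Diagonal n c)} {i j x y : ℤ} (h : Cut D i j x y) :
    SSlalom D x y i j ↔ PY D i j x y ∧ NX D i j x y := by
  have hc := h.cr
  obtain ⟨h1, h2, h3, h4, h5⟩ := h
  rw [and_comm (a := PY D i j x y)]
  refine (and_iff_right hc).trans (and_congr ⟨?_, ?_⟩ ⟨?_, ?_⟩)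
  · rintro ⟨u, h6, h7, h8, h9⟩
    refine ⟨u, ?_, h7, h8⟩
    rw [cr_iff_of_lt'] at h9 <;> omega
  · rintro ⟨u, h6, h7, h8⟩
    exact ⟨u, by omega, by omega, h8, by rw [cr_iff_of_lt'] <;> omega⟩
  · rintro ⟨w, h6, h7, h8, h9⟩
    by_cases hw : w < i + 2 * n
    · rw [cr_iff_of_lt'] at h9 <;> omega
    · rw [← cr_sub_mid, cr_iff_of_lt'] at h9 <;> try omega
      exact ⟨w - 2 * n, by omega, by omega, (bar_sub_iff.2 h8).symm⟩
  · rintro ⟨w, h6, h7, h8⟩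
    refine ⟨w + 2 * n, by omega, by omega, bar_add_iff.2 h8.symm, ?_⟩
    rw [← cr_sub_mid, cr_iff_of_lt'] <;> omega

open Classical in
/-- The slalom sign in terms of the chain of diagonals crossed by a chord. -/
lemma slalomSign_eq_ite {D : Finset (Diagonal n c)} (hD : IsDissection D) {δ : Diagonal n c}
    {η : Diagonal n c'} {x y i j : ℤ} (hδD : δ ∈ D) (hδ : Joins δ (pt x) (pt y))
    (h : Cut D i j x y) (hη : Joins η (pt i) (pt j)) :
    slalomSign D δ η = if PX D i j x y ∧ NY D i j x y then 1 else
      if PY D i j x y ∧ NX D i j x y then -1 else 0 := by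
  have h1 := h.left
  have h2 := h.right
  have h3 := h.left'
  have h4 := h.right'
  simp only [slalomSign_eq_ite_slalom hD hδD hδ (show x < y by omega) (by omega) hη,
    h.zSlalom_iff, h.sSlalom_iff]

lemma slalomSign_of_not_crosses {D : Finset (Diagonal n c)} {δ : Diagonal n c}
    {η : Diagonal n c'} (h : ¬ Crosses δ η) : slalomSign D δ η = 0 := by
  unfold slalomSign
  rw [if_neg, if_neg]
  all_goals rintro ⟨μ, ν, h', -⟩; exact h h'.1

/-- Since the chords do not cross, those cut by ij are nested: along ij, x moves up while y moves
down. This is the linear order behind "before" and "after". -/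
lemma Cut.le {D : Finset (Diagonal n c)} (hD : IsDissection D) {i j x y x' y' : ℤ}
    (h : Cut D i j x y) (h' : Cut D i j x' y') (hx : x < x') : y' ≤ y := by
  by_contra hy
  have h1 := h.left
  have h2 := h'.right
  have h3 := h.left'
  have h4 := h'.right'
  exact h.bar.not_cross hD h'.bar hx (by omega) (by omega) (by omega)

/-- An earlier chord at x and an earlier chord at y would cross each other. -/
lemma PX.not_PY {D : Finset (Diagonal n c)} (hD : IsDissection D) {i j x y : ℤ}
    (hx : x < j) (hy : j < y) (h : PX D i j x y) : ¬ PY D i j x y := by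
  obtain ⟨y', h1, h2, h3⟩ := h
  rintro ⟨x', h4, h5, h6⟩
  exact h6.not_cross hD h3 h5 (by omega) h1 (by omega)

lemma NX.not_NY {D : Finset (Diagonal n c)} (hD : IsDissection D) {i j x y : ℤ}
    (hx : i < x) (hy : y < i + 2 * n) (h : NX D i j x y) : ¬ NY D i j x y := by
  obtain ⟨y', h1, h2, h3⟩ := h
  rintro ⟨x', h4, h5, h6⟩
  exact h3.not_cross hD h6 h4 (by omega) h2 (by omega)

/-- Every chord crossed by `ij` except the last one shares an endpoint with a later one. -/
def Acc (D : Finset (Diagonal n c)) (i j : ℤ) : Prop :=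
  ∀ x y, Cut D i j x y → (x = j - 1 ∧ y = j + 1) ∨ NX D i j x y ∨ NY D i j x y

lemma exists_cut {D : Finset (Diagonal n c)} {η : Diagonal n c'} {δ : Diagonal n c} {i j : ℤ}
    (hij : i < j) (hji : j < i + 2 * n) (hη : Joins η (pt i) (pt j)) (h : δ ∈ crossed D η) :
    ∃ x y, Cut D i j x y ∧ Joins δ (pt x) (pt y) := by
  have hj := joins_self δ
  obtain ⟨x, y, h1, h2, h3, h4, h5⟩ := exists_lift_of_cr hij hji hj ((hη.crossed_iff hj).1 h).2
  exact ⟨x, y, ⟨h1, h2, h3, h4, ⟨δ, h.1, h5⟩⟩, h5⟩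

lemma Cut.mem_crossed {D : Finset (Diagonal n c)} {η : Diagonal n c'} {δ : Diagonal n c}
    {i j x y : ℤ} (hη : Joins η (pt i) (pt j)) (h : Cut D i j x y) (hδ : Joins δ (pt x) (pt y)) :
    δ ∈ crossed D η :=
  (hη.crossed_iff hδ).2 ⟨h.bar, h.cr⟩

lemma Cut.incident_iff {D : Finset (Diagonal n c)} {i j x y x' y' : ℤ} (h : Cut D i j x y)
    (h' : Cut D i j x' y') {δ δ' : Diagonal n c} (hδ : Joins δ (pt x) (pt y))
    (hδ' : Joins δ' (pt x') (pt y')) : Incident δ δ' ↔ x = x' ∨ y = y' := by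
  have inj : ∀ {a b : ℤ}, i < a → a < i + 2 * n → i < b → b < i + 2 * n →
      ((pt a : Fin (2 * n)) = pt b ↔ a = b) := fun ha ha' hb hb' =>
    ⟨pt_inj i ha.le ha' hb.le hb', fun h => h ▸ rfl⟩
  obtain ⟨h1, h2, h3, h4, -⟩ := h
  obtain ⟨h5, h6, h7, h8, -⟩ := h'
  unfold Incident
  rcases hδ with ⟨e1, e2⟩ | ⟨e1, e2⟩ <;> rcases hδ' with ⟨e3, e4⟩ | ⟨e3, e4⟩ <;>
    rw [e1, e2, e3, e4, inj, inj, inj, inj] <;> omega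

lemma cut_first (D : Finset (Diagonal n c)) (hn : 3 ≤ n) {i j : ℤ} (hi : (i + 1) % 2 = c)
    (hj : (j + 1) % 2 = c) (hij : i < j) (hji : j < i + 2 * n) :
    Cut D i j (i + 1) (i + 2 * n - 1) :=
  ⟨by omega, by omega, by omega, by omega, by
    have := (bar_add_two D hn (a := i + 2 * n - 1) (by omega)).symm
    rwa [show i + 2 * (n : ℤ) - 1 + 2 = i + 1 + 2 * n by ring, bar.symm_iff, bar_add_iff,
      bar.symm_iff] at this⟩

lemma cut_last (D : Finset (Diagonal n c)) (hn : 3 ≤ n) {i j : ℤ} (hi : (i + 1) % 2 = c)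
    (hj : (j + 1) % 2 = c) (hij : i < j) (hji : j < i + 2 * n) :
    Cut D i j (j - 1) (j + 1) :=
  ⟨by omega, by omega, by omega, by omega, by
    have := bar_add_two D hn (a := j - 1) (by omega)
    rwa [show j - 1 + 2 = j + 1 by ring] at this⟩

lemma parity_swap (hcc : c + c' = 1) {i : ℤ} (hi : i % 2 = c') : (i + 1) % 2 = c := by omega

/-- The crossed chords are linearly ordered, so connectedness means that there is no gap. If xy
shares no endpoint with a later chord, incidence paths from xy never pass it and miss the last
chord. Conversely, moving to later chords shrinks y - x and ends at the last one. -/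
theorem isAccordionDiagonal_iff (D : Finset (Diagonal n c)) (hD : IsDissection D) (hn : 3 ≤ n)
    (hcc : c + c' = 1) {η : Diagonal n c'} {i j : ℤ} (hij : i < j) (hji : j < i + 2 * n)
    (hη : Joins η (pt i) (pt j)) : IsAccordionDiagonal D η ↔ Acc D i j := by
  have pi := parity_swap hcc hη.parity.1
  have pj := parity_swap hcc hη.parity.2
  have hlast := cut_last D hn pi pj hij hji
  obtain ⟨δl, -, hδl⟩ := hlast.bar
  constructor
  · intro h x y hxy
    by_contra hcon
    obtain ⟨δ, -, hδ⟩ := id hxy.bar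
    have hδc := hxy.mem_crossed hη hδ
    have hpath := h δ hδc δl (hlast.mem_crossed hη hδl)
    -- Invariant of the path: it stays among the chords not later than xy.
    have key : ∀ ε, Relation.ReflTransGen (fun x y => y ∈ crossed D η ∧ Incident x y) δ ε →
        ε ∈ crossed D η ∧ ∀ x' y', Cut D i j x' y' → Joins ε (pt x') (pt y') →
          x' ≤ x ∧ y ≤ y' := by
      intro ε hε
      induction hε with
      | refl =>
        refine ⟨hδc, fun x' y' h' hj' => ?_⟩
        have : x = x' ∧ y = y' := by
          have := h'.left; have := h'.left'; have := h'.right; have := h'.right'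
          have := hxy.left; have := hxy.left'; have := hxy.right; have := hxy.right'
          rcases hδ.eq_or hj' with ⟨e1, e2⟩ | ⟨e1, e2⟩
          · exact ⟨(pt_inj i (by omega) (by omega) (by omega) (by omega) e1).symm,
              (pt_inj i (by omega) (by omega) (by omega) (by omega) e2).symm⟩
          · have := pt_inj i (by omega) (by omega) (by omega) (by omega) e1
            omega
        omega
      | @tail ε ε' _ hstep ih =>
        refine ⟨hstep.1, fun x' y' h' hj' => ?_⟩
        obtain ⟨a, b, hab, hjab⟩ := exists_cut hij hji hη ih.1
        have hle := ih.2 a b hab hjab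
        have hinc := (hab.incident_iff h' hjab hj').1 hstep.2
        have c1 := fun e => hxy.le hD h' e
        have c2 := fun e => h'.le hD hxy e
        by_contra hcon'
        apply hcon
        right
        by_cases hx : x' = x
        · left; subst hx
          exact ⟨y', h'.left', by omega, h'.bar⟩
        · right
          have : x < x' := by omega
          have := c1 this
          have : y' = y := by omega
          subst this
          exact ⟨x', by omega, h'.right, h'.bar⟩
    have := (key δl hpath).2 _ _ hlast hδl
    have := hxy.right; have := hxy.left'
    exact hcon (Or.inl (by omega))
  · intro h
    have key : ∀ k : ℕ, ∀ x y, Cut D i j x y → y - x ≤ k → ∀ δ : Diagonal n c,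
        Joins δ (pt x) (pt y) →
        Relation.ReflTransGen (fun x y => y ∈ crossed D η ∧ Incident x y) δ δl ∧
        Relation.ReflTransGen (fun x y => y ∈ crossed D η ∧ Incident x y) δl δ := by
      intro k
      induction k with
      | zero => intro x y h1 h2; have := h1.right; have := h1.left'; omega
      | succ k ih =>
        intro x y h1 h2 δ hδ
        have step : ∀ x' y', Cut D i j x' y' → y' - x' ≤ k → (x = x' ∨ y = y') →
            Relation.ReflTransGen (fun x y => y ∈ crossed D η ∧ Incident x y) δ δl ∧
            Relation.ReflTransGen (fun x y => y ∈ crossed D η ∧ Incident x y) δl δ := by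
          intro x' y' h' hk he
          obtain ⟨δ', -, hδ'⟩ := id h'.bar
          obtain ⟨r1, r2⟩ := ih x' y' h' hk δ' hδ'
          exact ⟨.head ⟨h'.mem_crossed hη hδ', (h1.incident_iff h' hδ hδ').2 he⟩ r1,
            .tail r2 ⟨h1.mem_crossed hη hδ, (h'.incident_iff h1 hδ' hδ).2
              (he.imp Eq.symm Eq.symm)⟩⟩
        rcases h x y h1 with ⟨rfl, rfl⟩ | ⟨y', h3, h4, h5⟩ | ⟨x', h3, h4, h5⟩
        · rw [hδ.unique hδl]
          exact ⟨.refl, .refl⟩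
        · exact step x y' ⟨h1.left, h1.right, h3, by have := h1.right'; omega, h5⟩ (by omega)
            (Or.inl rfl)
        · exact step x' y ⟨by have := h1.left; omega, h4, h1.left', h1.right', h5⟩ (by omega)
            (Or.inr rfl)
    intro α hα β hβ
    obtain ⟨x, y, h1, h2⟩ := exists_cut hij hji hη hα
    obtain ⟨x', y', h3, h4⟩ := exists_cut hij hji hη hβ
    exact (key (y - x).toNat x y h1 (by omega) α h2).1.trans
      (key (y' - x').toNat x' y' h3 (by omega) β h4).2

/-- Every chord crossed by `ij` except the first one shares an endpoint with an earlier one. -/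
lemma Acc.prev {D : Finset (Diagonal n c)} (hD : IsDissection D) (hn : 3 ≤ n)
    (hcc : c + c' = 1) {η : Diagonal n c'} {i j : ℤ} (hij : i < j) (hji : j < i + 2 * n)
    (hη : Joins η (pt i) (pt j)) (h : Acc D i j) {x y : ℤ} (hxy : Cut D i j x y) :
    (x = i + 1 ∧ y = i + 2 * n - 1) ∨ PX D i j x y ∨ PY D i j x y := by
  -- Traversing the diagonal from j to i + 2n reverses the chain and turns "later" into "earlier".
  have h' := (isAccordionDiagonal_iff D hD hn hcc hij hji hη).2 h
  rw [isAccordionDiagonal_iff D hD hn hcc (i := j) (j := i + 2 * n) hji (by omega)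
    (by rw [pt_add]; exact hη.symm)] at h'
  have h1 := hxy.left
  have h2 := hxy.right
  have h3 := hxy.left'
  have h4 := hxy.right'
  rcases h' y (x + 2 * n) ⟨h3, h4, by omega, by omega, bar_add_iff.2 hxy.bar.symm⟩ with
    h5 | ⟨x', h5, h6, h7⟩ | ⟨y', h5, h6, h7⟩
  · exact Or.inl (by omega)
  · exact Or.inr (Or.inr ⟨x' - 2 * n, by omega, by omega, (bar_sub_iff.2 h7).symm⟩)
  · exact Or.inr (Or.inl ⟨y', h5, h6, (bar_add_iff.1 h7).symm⟩)

/-! ### Refining a dissection -/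

lemma Cut.mono {D T : Finset (Diagonal n c)} (hDT : D ⊆ T) {i j x y : ℤ} (h : Cut D i j x y) :
    Cut T i j x y := ⟨h.left, h.right, h.left', h.right', h.bar.mono hDT⟩

lemma PX.mono {D T : Finset (Diagonal n c)} (hDT : D ⊆ T) {i j x y : ℤ} (h : PX D i j x y) :
    PX T i j x y := let ⟨z, h1, h2, h3⟩ := h; ⟨z, h1, h2, h3.mono hDT⟩

lemma NX.mono {D T : Finset (Diagonal n c)} (hDT : D ⊆ T) {i j x y : ℤ} (h : NX D i j x y) :
    NX T i j x y := let ⟨z, h1, h2, h3⟩ := h; ⟨z, h1, h2, h3.mono hDT⟩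

lemma PY.mono {D T : Finset (Diagonal n c)} (hDT : D ⊆ T) {i j x y : ℤ} (h : PY D i j x y) :
    PY T i j x y := let ⟨z, h1, h2, h3⟩ := h; ⟨z, h1, h2, h3.mono hDT⟩

lemma NY.mono {D T : Finset (Diagonal n c)} (hDT : D ⊆ T) {i j x y : ℤ} (h : NY D i j x y) :
    NY T i j x y := let ⟨z, h1, h2, h3⟩ := h; ⟨z, h1, h2, h3.mono hDT⟩

/-- If `ij` is an accordion for `D`, it does not slalom on the diagonals added to `D`. -/
lemma Acc.of_not_bar {D T : Finset (Diagonal n c)} (hT : IsDissection T) (hDT : D ⊆ T)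
    (hn : 3 ≤ n) {i j : ℤ} (hij : i < j) (hji : j < i + 2 * n) (pi : (i + 1) % 2 = c)
    (pj : (j + 1) % 2 = c) (h : Acc D i j) {x y : ℤ} (hxy : Cut T i j x y) (hnb : ¬ bar D x y) :
    (PX T i j x y ∧ NX T i j x y) ∨ (PY T i j x y ∧ NY T i j x y) := by
  -- ab is the innermost chord of D around xy. Its successor in D lies past xy and shares an end
  -- with ab; noncrossing forces xy to share this end too, so xy lies inside a fan.
  obtain ⟨m, ⟨a, b, hm, ha, hb, hab⟩, hmax⟩ := Int.exists_greatest_of_bdd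
    (P := fun m => ∃ a b, m = a - b ∧ a ≤ x ∧ y ≤ b ∧ Cut D i j a b)
    ⟨x - y, by rintro z ⟨a, b, rfl, h1, h2, -⟩; omega⟩
    ⟨_, _, _, rfl, by have := hxy.left; omega, by have := hxy.right'; omega,
      cut_first D hn pi pj hij hji⟩
  subst hm
  have hne : ¬ (a = x ∧ b = y) := by rintro ⟨rfl, rfl⟩; exact hnb hab.bar
  have h1 := hab.left; have h2 := hab.right; have h3 := hab.left'; have h4 := hab.right'
  have h5 := hxy.right; have h6 := hxy.left'
  rcases h a b hab with ⟨rfl, rfl⟩ | ⟨b', h7, h8, h9⟩ | ⟨a', h7, h8, h9⟩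
  · omega
  · have hab' : Cut D i j a b' := ⟨h1, h2, h7, by omega, h9⟩
    have hby : b' < y := by
      by_contra hc
      have := hmax _ ⟨a, b', rfl, ha, by omega, hab'⟩
      omega
    have hax : a = x := by
      by_contra hc
      have := (hab'.mono hDT).le hT hxy (by omega)
      omega
    subst hax
    exact Or.inl ⟨⟨b, by omega, h4, hab.bar.mono hDT⟩, ⟨b', h7, hby, h9.mono hDT⟩⟩
  · have hab' : Cut D i j a' b := ⟨by omega, h8, h3, h4, h9⟩
    have hby : x < a' := by
      by_contra hc
      have := hmax _ ⟨a', b, rfl, by omega, hb, hab'⟩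
      omega
    have hax : b = y := by
      have := hxy.le hT (hab'.mono hDT) (by omega)
      omega
    subst hax
    exact Or.inr ⟨⟨a, h1, by omega, hab.bar.mono hDT⟩, ⟨a', hby, h8, h9.mono hDT⟩⟩

/-- The converse of `Acc.of_not_bar`. -/
lemma Acc.of_forall {D T : Finset (Diagonal n c)} (hn : 3 ≤ n) {i j : ℤ} (hij : i < j)
    (hji : j < i + 2 * n) (pi : (i + 1) % 2 = c)
    (pj : (j + 1) % 2 = c) (hDT : D ⊆ T) (h : Acc T i j)
    (hno : ∀ x y, Cut T i j x y → ¬ bar D x y →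
      ¬ (PX T i j x y ∧ NY T i j x y) ∧ ¬ (PY T i j x y ∧ NX T i j x y)) : Acc D i j := by
  intro x y hxy
  have h1 := hxy.left; have h2 := hxy.right; have h3 := hxy.left'; have h4 := hxy.right'
  rcases h x y (hxy.mono hDT) with h5 | ⟨y', h5, h6, h7⟩ | ⟨x', h5, h6, h7⟩
  · exact Or.inl h5
  · obtain ⟨b, ⟨h8, h9, h10⟩, hmin⟩ := Int.exists_least_of_bdd
      (P := fun b => j < b ∧ b < y ∧ bar T x b) ⟨j, fun z hz => hz.1.le⟩ ⟨y', h5, h6, h7⟩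
    right; left
    refine ⟨b, h8, h9, ?_⟩
    by_contra hb
    have hcut : Cut T i j x b := ⟨h1, h2, h8, by omega, h10⟩
    rcases h x b hcut with ⟨rfl, rfl⟩ | ⟨b', h11, h12, h13⟩ | h11
    · exact hb (cut_last D hn pi pj hij hji).bar
    · have := hmin b' ⟨h11, by omega, h13⟩
      omega
    · exact (hno x b hcut hb).1 ⟨⟨y, h9, h4, hxy.bar.mono hDT⟩, h11⟩
  · obtain ⟨a, ⟨h8, h9, h10⟩, hmax⟩ := Int.exists_greatest_of_bdd
      (P := fun a => x < a ∧ a < j ∧ bar T a y) ⟨j, fun z hz => hz.2.1.le⟩ ⟨x', h5, h6, h7⟩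
    right; right
    refine ⟨a, h8, h9, ?_⟩
    by_contra hb
    have hcut : Cut T i j a y := ⟨by omega, h9, h3, h4, h10⟩
    rcases h a y hcut with ⟨rfl, rfl⟩ | h11 | ⟨a', h11, h12, h13⟩
    · exact hb (cut_last D hn pi pj hij hji).bar
    · exact (hno a y hcut hb).2 ⟨⟨x, h1, h8, hxy.bar.mono hDT⟩, h11⟩
    · have := hmax a' ⟨by omega, h12, h13⟩
      omega

/-- Apart from the two ends of the chain, D already supplies an earlier and a later chord incident
to δ. In T too, the earlier ones can share only one endpoint of δ, and likewise the later ones, so T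
sees the same turn. -/
lemma Acc.slalomSign_eq {D T : Finset (Diagonal n c)} (hT : IsDissection T) (hD : IsDissection D)
    (hDT : D ⊆ T) (hn : 3 ≤ n) (hcc : c + c' = 1) {η : Diagonal n c'} {i j : ℤ}
    (hij : i < j) (hji : j < i + 2 * n) (hη : Joins η (pt i) (pt j)) (h : Acc D i j)
    {δ : Diagonal n c} (hδT : δ ∈ D) : slalomSign T δ η = slalomSign D δ η := by
  have pi := parity_swap hcc hη.parity.1
  have pj := parity_swap hcc hη.parity.2
  by_cases hx : Crosses δ η
  swap
  · rw [slalomSign_of_not_crosses hx, slalomSign_of_not_crosses hx]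
  obtain ⟨x, y, hxy, hδ⟩ := exists_cut (D := D) hij hji hη ⟨Or.inl hδT, hx⟩
  have h1 := hxy.left; have h2 := hxy.right; have h3 := hxy.left'; have h4 := hxy.right'
  rw [slalomSign_eq_ite hT (hDT hδT) hδ (hxy.mono hDT) hη, slalomSign_eq_ite hD hδT hδ hxy hη]
  have hP : PX D i j x y ∨ PY D i j x y ∨ (¬ PX T i j x y ∧ ¬ PY T i j x y) := by
    rcases h.prev hD hn hcc hij hji hη hxy with ⟨rfl, rfl⟩ | h | h
    · right; right
      constructor <;> rintro ⟨z, z1, z2, -⟩ <;> omega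
    · exact Or.inl h
    · exact Or.inr (Or.inl h)
  have hN : NX D i j x y ∨ NY D i j x y ∨ (¬ NX T i j x y ∧ ¬ NY T i j x y) := by
    rcases h x y hxy with ⟨rfl, rfl⟩ | h | h
    · right; right
      constructor <;> rintro ⟨z, z1, z2, -⟩ <;> omega
    · exact Or.inl h
    · exact Or.inr (Or.inl h)
  have hPT : ¬ (PX T i j x y ∧ PY T i j x y) := fun h => h.1.not_PY hT h2 h3 h.2
  have hNT : ¬ (NX T i j x y ∧ NY T i j x y) := fun h => h.1.not_NY hT h1 h4 h.2
  have m1 : PX D i j x y → PX T i j x y := PX.mono hDT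
  have m2 : PY D i j x y → PY T i j x y := PY.mono hDT
  have m3 : NX D i j x y → NX T i j x y := NX.mono hDT
  have m4 : NY D i j x y → NY T i j x y := NY.mono hDT
  have e1 : PX T i j x y ∧ NY T i j x y ↔ PX D i j x y ∧ NY D i j x y := by
    refine ⟨fun ⟨a, b⟩ => ⟨?_, ?_⟩, fun h => ⟨m1 h.1, m4 h.2⟩⟩
    · rcases hP with h | h | h
      exacts [h, (hPT ⟨a, m2 h⟩).elim, (h.1 a).elim]
    · rcases hN with h | h | h
      exacts [(hNT ⟨m3 h, b⟩).elim, h, (h.2 b).elim]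
  have e2 : PY T i j x y ∧ NX T i j x y ↔ PY D i j x y ∧ NX D i j x y := by
    refine ⟨fun ⟨a, b⟩ => ⟨?_, ?_⟩, fun h => ⟨m2 h.1, m3 h.2⟩⟩
    · rcases hP with h | h | h
      exacts [(hPT ⟨m1 h, a⟩).elim, h, (h.2 a).elim]
    · rcases hN with h | h | h
      exacts [h, (hNT ⟨b, m4 h⟩).elim, (h.1 b).elim]
  classical exact if_congr e1 rfl (if_congr e2 rfl rfl)

/-- The slalom signs of an accordion diagonal of `D` with respect to a finer dissection. -/
theorem slalomSign_of_subset {D T : Finset (Diagonal n c)} (hT : IsDissection T)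
    (hD : IsDissection D) (hDT : D ⊆ T) (hn : 3 ≤ n) (hcc : c + c' = 1) {η : Diagonal n c'}
    (h : IsAccordionDiagonal D η) {δ : Diagonal n c} (hδT : δ ∈ T) :
    (δ ∈ D → slalomSign T δ η = slalomSign D δ η) ∧ (δ ∉ D → slalomSign T δ η = 0) := by
  obtain ⟨i, j, hij, hji, hη⟩ := exists_lift η
  rw [isAccordionDiagonal_iff D hD hn hcc hij hji hη] at h
  refine ⟨h.slalomSign_eq hT hD hDT hn hcc hij hji hη, fun hδD => ?_⟩
  by_cases hx : Crosses δ η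
  swap
  · rw [slalomSign_of_not_crosses hx]
  obtain ⟨x, y, hxy, hδ⟩ := exists_cut (D := T) hij hji hη ⟨Or.inl hδT, hx⟩
  have h1 := hxy.left; have h2 := hxy.right; have h3 := hxy.left'; have h4 := hxy.right'
  have hnb : ¬ bar D x y := fun hb => (hδ.mem_withBoundary hb).elim hδD (hT.1 δ hδT)
  rw [slalomSign_eq_ite hT hδT hδ hxy hη]
  have hPT : PX T i j x y → ¬ PY T i j x y := fun h => h.not_PY hT h2 h3
  have hNT : NX T i j x y → ¬ NY T i j x y := fun h => h.not_NY hT h1 h4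
  have := h.of_not_bar hT hDT hn hij hji (parity_swap hcc hη.parity.1)
    (parity_swap hcc hη.parity.2) hxy hnb
  rw [if_neg (by tauto), if_neg (by tauto)]

/-- The converse of the vanishing in `slalomSign_of_subset`: deleting a diagonal disconnects the
chain only if the chord turns there as a Z or an S, since inside a fan its neighbours still share an
endpoint. -/
theorem isAccordionDiagonal_of_slalomSign {D T : Finset (Diagonal n c)} (hT : IsDissection T)
    (hD : IsDissection D) (hDT : D ⊆ T) (hn : 3 ≤ n) (hcc : c + c' = 1) {η : Diagonal n c'}
    (h : IsAccordionDiagonal T η) (h0 : ∀ δ ∈ T, δ ∉ D → slalomSign T δ η = 0) :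
    IsAccordionDiagonal D η := by
  obtain ⟨i, j, hij, hji, hη⟩ := exists_lift η
  rw [isAccordionDiagonal_iff _ ‹_› hn hcc hij hji hη] at h ⊢
  refine h.of_forall hn hij hji (parity_swap hcc hη.parity.1) (parity_swap hcc hη.parity.2) hDT
    fun x y hxy hnb => ?_
  have h1 := hxy.left; have h2 := hxy.right; have h3 := hxy.left'; have h4 := hxy.right'
  obtain ⟨δ, hδT, hδ⟩ := id hxy.bar
  have hδD : δ ∉ withBoundary D := fun h => hnb ⟨δ, h, hδ⟩
  have hδT : δ ∈ T := hδT.resolve_right fun h => hδD (Or.inr h)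
  have hs := h0 δ hδT fun h => hδD (Or.inl h)
  rw [slalomSign_eq_ite hT hδT hδ hxy hη] at hs
  constructor
  · intro h; rw [if_pos h] at hs; omega
  · intro h
    split_ifs at hs with h'
    exact absurd hs (by decide)

/-! ### The two sides of a chord -/

/-- The label `x` lies on the arc from `i` to `j`. -/
def Side (n : ℕ) [NeZero n] (i j x : ℤ) : Prop :=
  ∃ x', (pt x' : Fin (2 * n)) = pt x ∧ i < x' ∧ x' < j

lemma side_iff (m : ℤ) {i j x : ℤ} (hi : m ≤ i) (hj : j < m + 2 * n) (hx : m ≤ x)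
    (hx' : x < m + 2 * n) : Side n i j x ↔ i < x ∧ x < j := by
  constructor
  · rintro ⟨x', h1, h2, h3⟩
    obtain rfl := pt_inj m (by omega) (by omega) hx hx' h1
    exact ⟨h2, h3⟩
  · exact fun h => ⟨x, rfl, h⟩

lemma side_congr {i j x y : ℤ} (h : (pt x : Fin (2 * n)) = pt y) : Side n i j x ↔ Side n i j y := by
  unfold Side; rw [h]

lemma cr_congr_left {x y x' y' i j : ℤ} (h : (pt x : Fin (2 * n)) = pt x')
    (h' : (pt y : Fin (2 * n)) = pt y') : Cr n x y i j ↔ Cr n x' y' i j := by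
  unfold Cr; rw [h, h']

lemma pt_ne_of_parity {x i : ℤ} (h : x % 2 ≠ i % 2) : (pt x : Fin (2 * n)) ≠ pt i := by
  intro he
  rw [← pt_parity (n := n), ← pt_parity (n := n) i, he] at h
  exact h rfl

/-- A chord crosses `ij` iff its endpoints are on different sides of it. -/
lemma cr_iff_side {i j x y : ℤ} (hij : i < j) (hji : j < i + 2 * n)
    (hxi : x % 2 ≠ i % 2) (hxj : x % 2 ≠ j % 2) (hyi : y % 2 ≠ i % 2) (hyj : y % 2 ≠ j % 2) :
    Cr n x y i j ↔ ¬ (Side n i j x ↔ Side n i j y) := by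
  obtain ⟨x', h1, h2, h3⟩ := exists_pt i (pt x : Fin (2 * n))
  obtain ⟨y', h4, h5, h6⟩ := exists_pt i (pt y : Fin (2 * n))
  have hne : x' ≠ i ∧ x' ≠ j ∧ y' ≠ i ∧ y' ≠ j := by
    refine ⟨?_, ?_, ?_, ?_⟩ <;> rintro rfl
    exacts [pt_ne_of_parity hxi h3.symm, pt_ne_of_parity hxj h3.symm,
      pt_ne_of_parity hyi h6.symm, pt_ne_of_parity hyj h6.symm]
  rw [← cr_congr_left h3 h6, ← side_congr h3, ← side_congr h6, side_iff i le_rfl hji h1 h2,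
    side_iff i le_rfl hji h4 h5, cr_iff_of_lt' hij hji h1 h2 h4 h5]
  omega

lemma cr_iff_of_window (m : ℤ) {i j x y : ℤ} (hij : i < j) (hi : m ≤ i) (hj : j < m + 2 * n)
    (hx : m ≤ x) (hx' : x < m + 2 * n) (hy : m ≤ y) (hy' : y < m + 2 * n) :
    Cr n x y i j ↔ (i < x ∧ x < j ∧ (y < i ∨ j < y)) ∨ (i < y ∧ y < j ∧ (x < i ∨ j < x)) := by
  rw [cr_iff m hx hx' hy hy' hi (by omega) (by omega) hj]
  constructor
  · rintro ((h | h | h | h) | (h | h | h | h)) <;> omega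
  · rintro (⟨h, h', h'' | h''⟩ | ⟨h, h', h'' | h''⟩) <;> omega

/-! ### Triangulations -/

lemma IsDissection.exists_maximal {D : Finset (Diagonal n c)} (hD : IsDissection D) :
    ∃ T, D ⊆ T ∧ Maximal IsDissection T :=
  Finite.exists_le_maximal hD

/-- Saturation: otherwise the chord ab could be inserted. The predicate A covers both triangulations
(no condition) and maximal accordion dissections. -/
lemma bar_of_maximal_of_forall {A : Diagonal n c → Prop} {T : Finset (Diagonal n c)}
    (hT : Maximal (fun T => IsDissection T ∧ ∀ δ ∈ T, A δ) T) {a b : ℤ}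
    (ha : a % 2 = c) (hb : b % 2 = c) (hab : a < b) (hba : b < a + 2 * n)
    (hA : ∀ δ : Diagonal n c, Joins δ (pt a) (pt b) → A δ)
    (h : ∀ p q, bar T p q → a < p → p < b → b < q → q < a + 2 * n → False) : bar T a b := by
  classical
  obtain ⟨δ, hδ⟩ := exists_joins_of_lt (n := n) ha hb hab hba
  refine ⟨δ, ?_, hδ⟩
  by_contra hcon
  simp only [withBoundary, Set.mem_ofPred_eq, not_or] at hcon
  have hno : ∀ ε ∈ T, ¬ Crosses ε δ := by
    intro ε hε hx
    have hj := joins_self ε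
    obtain ⟨x, y, h1, h2, h3, h4, h5⟩ := exists_lift_of_cr hab hba hj ((hj.crosses_iff hδ).1 hx)
    exact h x y (bar_of_mem hε h5) h1 h2 h3 h4
  refine hcon.1 (hT.le_of_ge (y := insert δ T) ⟨⟨?_, ?_⟩, ?_⟩ (Finset.subset_insert _ _)
    (Finset.mem_insert_self δ T))
  · intro ε hε
    rcases Finset.mem_insert.1 hε with hε | hε
    exacts [hε ▸ hcon.2, hT.prop.1.1 ε hε]
  · intro ε hε ε' hε'
    rcases Finset.mem_insert.1 hε with e | hε <;> rcases Finset.mem_insert.1 hε' with e' | hε'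
    · rw [e, e']; exact not_crosses_self δ
    · rw [e]; exact fun h => hno ε' hε' h.symm
    · rw [e']; exact hno ε hε
    · exact hT.prop.1.2 ε hε ε' hε'
  · intro ε hε
    rcases Finset.mem_insert.1 hε with hε | hε
    exacts [hε ▸ hA δ hδ, hT.prop.2 ε hε]

lemma bar_of_maximal {T : Finset (Diagonal n c)} (hT : Maximal IsDissection T) {a b : ℤ}
    (ha : a % 2 = c) (hb : b % 2 = c) (hab : a < b) (hba : b < a + 2 * n)
    (h : ∀ p q, bar T p q → a < p → p < b → b < q → q < a + 2 * n → False) : bar T a b :=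
  bar_of_maximal_of_forall (A := fun _ => True) (by simpa using hT) ha hb hab hba
    (fun _ _ => trivial) h

/-- Every diagonal of a triangulation is the side of a triangle. -/
lemma exists_triangle {T : Finset (Diagonal n c)} (hT : Maximal IsDissection T) (hn : 3 ≤ n)
    {p q : ℤ} (h : bar T p q) (h1 : p + 2 < q) (h2 : q < p + 2 * n) :
    ∃ r, p < r ∧ r < q ∧ bar T p r ∧ bar T r q := by
  have hp := h.parity
  obtain ⟨r, ⟨h3, h4, h5⟩, hmax⟩ := Int.exists_greatest_of_bdd
    (P := fun r => p < r ∧ r < q ∧ bar T p r) ⟨q, fun z hz => hz.2.1.le⟩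
    ⟨p + 2, by omega, h1, bar_add_two T hn hp.1⟩
  refine ⟨r, h3, h4, h5, bar_of_maximal hT h5.parity.2 hp.2 h4 (by omega) ?_⟩
  intro a b hab h6 h7 h8 h9
  -- As r is the last neighbour of p before q, a chord separating r from q crosses pq, contradicts
  -- the choice of r, or crosses pr.
  rcases lt_trichotomy b (p + 2 * n) with hb | rfl | hb
  · exact h.not_cross hT.prop hab (by omega) h7 h8 hb
  · have := hmax a ⟨by omega, h7, (bar_add_iff.1 hab).symm⟩
    omega
  · exact h5.not_cross hT.prop (bar_sub_iff.2 hab).symm (by omega) (by omega) h6 (by omega)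

/-- Every chord is an accordion for a triangulation. -/
lemma acc_of_maximal {T : Finset (Diagonal n c)} (hT : Maximal IsDissection T) (hn : 3 ≤ n)
    {i j : ℤ} (hj : (j + 1) % 2 = c) : Acc T i j := by
  intro x y hxy
  have h1 := hxy.left; have h2 := hxy.right; have h3 := hxy.left'; have h4 := hxy.right'
  have hp := hxy.bar.parity
  by_cases h : y = x + 2
  · exact Or.inl (by omega)
  · obtain ⟨r, h5, h6, h7, h8⟩ := exists_triangle hT hn hxy.bar (by omega) (by omega)
    have := h7.parity
    by_cases hr : r < j
    · exact Or.inr (Or.inr ⟨r, h5, hr, h8⟩)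
    · exact Or.inr (Or.inl ⟨r, by omega, h6, h7⟩)

lemma isAccordionDiagonal_of_maximal {T : Finset (Diagonal n c)} (hT : Maximal IsDissection T)
    (hn : 3 ≤ n) (hcc : c + c' = 1) (η : Diagonal n c') : IsAccordionDiagonal T η := by
  obtain ⟨i, j, hij, hji, hη⟩ := exists_lift η
  rw [isAccordionDiagonal_iff T hT.prop hn hcc hij hji hη]
  exact acc_of_maximal hT hn (parity_swap hcc hη.parity.2)

/-! ### Shear coordinates -/

/-- The two triangles with the common side `pq` have the other vertices `r` and `s`. -/
structure Quad (T : Finset (Diagonal n c)) (p r q s : ℤ) : Prop where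
  pr_lt : p < r
  rq_lt : r < q
  qs_lt : q < s
  sp_lt : s < p + 2 * n
  pq : bar T p q
  pr : bar T p r
  rq : bar T r q
  qs : bar T q s
  ps : bar T p s

lemma exists_quad {T : Finset (Diagonal n c)} (hT : Maximal IsDissection T) (hn : 3 ≤ n)
    {δ : Diagonal n c} (hδ : δ ∈ T) :
    ∃ p r q s, Joins δ (pt p) (pt q) ∧ Quad T p r q s := by
  obtain ⟨p, q, h1, h2, h3⟩ := exists_lift δ
  have hb := bar_of_mem hδ h3
  have hnb := hT.prop.1 δ hδ
  rw [h3.isBoundary_iff h1 h2] at hnb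
  have hp := hb.parity
  obtain ⟨r, h4, h5, h6, h7⟩ := exists_triangle hT hn hb (by omega) h2
  obtain ⟨s, h8, h9, h10, h11⟩ := exists_triangle hT hn (bar_add_iff.2 hb.symm) (by omega)
    (by omega)
  exact ⟨p, r, q, s, h3, h4, h5, h8, h9, hb, h6, h7, h10, (bar_add_iff.1 h11).symm⟩

/-- No chord leaves p between q and s, since it would cross qs. A crossed chord beyond ps forces ps
to be crossed as well, so only the sides of the two triangles matter. -/
lemma Quad.zSlalom_iff {T : Finset (Diagonal n c)} (hT : IsDissection T) {p r q s i j : ℤ}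
    (h : Quad T p r q s) :
    ZSlalom T p q i j ↔ Cr n p q i j ∧ Cr n p s i j ∧ Cr n q r i j := by
  obtain ⟨h1, h2, h3, h4, h5, h6, h7, h8, h9⟩ := h
  refine and_congr_right fun hc => and_congr ⟨?_, fun h => ⟨s, h3, h4, h9, h⟩⟩
    ⟨?_, fun h => ⟨r, h1, h2, h7.symm, h⟩⟩
  · rintro ⟨u, g1, g2, g3, g4⟩
    rcases lt_trichotomy u s with hu | rfl | hu
    · exact (g3.not_cross hT h8 (by omega) g1 hu (by omega)).elim
    · exact g4
    · exact hc.between g4 (by omega) h3 hu g2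
  · rintro ⟨w, g1, g2, g3, g4⟩
    rcases lt_trichotomy w r with hw | rfl | hw
    · exact (h6.not_cross hT g3.symm g1 hw h2 (by omega)).elim
    · exact g4
    · have e : Cr n q (r + 2 * n) i j := Cr.between (q := p + 2 * n) (u := w + 2 * n)
        ((cr_congr_left rfl (pt_add p)).2 hc.swap_left) ((cr_congr_left rfl (pt_add w)).2 g4)
        (by omega) (by omega) (by omega) (by omega)
      exact (cr_congr_left rfl (pt_add r)).1 e

lemma Quad.sSlalom_iff {T : Finset (Diagonal n c)} (hT : IsDissection T) {p r q s i j : ℤ}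
    (h : Quad T p r q s) :
    SSlalom T p q i j ↔ Cr n p q i j ∧ Cr n p r i j ∧ Cr n q s i j := by
  obtain ⟨h1, h2, h3, h4, h5, h6, h7, h8, h9⟩ := h
  refine and_congr_right fun hc => and_congr ⟨?_, fun h => ⟨r, h1, h2, h6, h⟩⟩
    ⟨?_, fun h => ⟨s, h3, h4, h8, h⟩⟩
  · rintro ⟨u, g1, g2, g3, g4⟩
    rcases lt_trichotomy u r with hu | rfl | hu
    · exact g4.between hc g1 hu h2 (by omega)
    · exact g4
    · exact (g3.not_cross hT h7 h1 hu g2 (by omega)).elim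
  · rintro ⟨w, g1, g2, g3, g4⟩
    rcases lt_trichotomy w s with hw | rfl | hw
    · exact g4.between ((cr_congr_left rfl (pt_add p)).2 hc.swap_left) g1 hw h4 (by omega)
    · exact g4
    · exact (g3.not_cross hT (bar_add_iff.2 h9.symm) h3 hw g2 (by omega)).elim

open Classical in
/-- The indicator function of crossing. -/
noncomputable def crInd (n : ℕ) [NeZero n] (x y i j : ℤ) : ℤ := if Cr n x y i j then 1 else 0

/-- For a triangulation, the slalom signs are shear coordinates. -/
lemma Quad.two_mul_slalomSign {T : Finset (Diagonal n c)} (hT : IsDissection T)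
    (hcc : c + c' = 1) {p r q s i j : ℤ} (h : Quad T p r q s) {δ : Diagonal n c}
    (hδT : δ ∈ T) (hδ : Joins δ (pt p) (pt q)) {η : Diagonal n c'} (hij : i < j)
    (hji : j < i + 2 * n) (hη : Joins η (pt i) (pt j)) :
    2 * slalomSign T δ η = crInd n p s i j + crInd n q r i j - crInd n p r i j - crInd n q s i j := by
  have h1 := h.pr_lt; have h2 := h.rq_lt; have h3 := h.qs_lt; have h4 := h.sp_lt
  have hp := h.pq.parity
  have hr := h.pr.parity
  have hs := h.qs.parity
  have hi := hη.parity
  rw [slalomSign_eq_ite_slalom hT hδT hδ (by omega) (by omega) hη]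
  classical
  simp only [h.zSlalom_iff hT, h.sSlalom_iff hT]
  -- All five indicators are functions of the sides of ij on which p, q, r, s lie, which leaves 16
  -- cases.
  have e : ∀ x y : ℤ, x % 2 = c → y % 2 = c → (Cr n x y i j ↔ ¬ (Side n i j x ↔ Side n i j y)) :=
    fun x y hx hy => cr_iff_side hij hji (by omega) (by omega) (by omega) (by omega)
  unfold crInd
  simp only [e p q hp.1 hp.2, e p s hp.1 hs.2, e q r hp.2 hr.2, e p r hp.1 hr.2, e q s hp.2 hs.2]
  by_cases a1 : Side n i j p <;> by_cases a2 : Side n i j q <;> by_cases a3 : Side n i j r <;>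
    by_cases a4 : Side n i j s <;> simp [a1, a2, a3, a4]

/-- Two chords that slalom on the same diagonal as a `Z` and as an `S` cross. -/
lemma crosses_of_slalomSign {T : Finset (Diagonal n c)} (hT : Maximal IsDissection T)
    (hn : 3 ≤ n) {δ : Diagonal n c} (hδT : δ ∈ T)
    {μ ν : Diagonal n c'} (hμ : slalomSign T δ μ = 1) (hν : slalomSign T δ ν = -1) :
    Crosses μ ν := by
  obtain ⟨p, r, q, s, hδ, h⟩ := exists_quad hT hn hδT
  have h1 := h.pr_lt; have h2 := h.rq_lt; have h3 := h.qs_lt; have h4 := h.sp_lt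
  have lift : ∀ η : Diagonal n c', ∃ i j, p ≤ i ∧ i < j ∧ j < p + 2 * n ∧
      Joins η (pt i) (pt j) := by
    intro η
    obtain ⟨i, i1, i2, i3⟩ := exists_pt p η.1.1
    obtain ⟨j, j1, j2, j3⟩ := exists_pt p η.1.2
    rcases lt_trichotomy i j with hij | rfl | hij
    · exact ⟨i, j, i1, hij, j2, Or.inl ⟨i3.symm, j3.symm⟩⟩
    · exact absurd (i3.symm.trans j3) η.2.1.ne
    · exact ⟨j, i, j1, hij, i2, Or.inr ⟨i3.symm, j3.symm⟩⟩
  obtain ⟨i, j, i1, i2, i3, hi⟩ := lift μ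
  obtain ⟨k, l, k1, k2, k3, hk⟩ := lift ν
  rw [slalomSign_eq_ite_slalom hT.prop hδT hδ (by omega) (by omega) hi] at hμ
  rw [slalomSign_eq_ite_slalom hT.prop hδT hδ (by omega) (by omega) hk] at hν
  -- A Z separates {p, r} from {q, s} and an S separates {p, s} from {q, r}; two such chords must
  -- cross.
  have hZ : Cr n p q i j ∧ Cr n p s i j ∧ Cr n q r i j := by
    rw [← h.zSlalom_iff hT.prop]
    by_contra hc
    rw [if_neg hc] at hμ
    split_ifs at hμ
    exact absurd hμ (by decide)
  have hS : Cr n p q k l ∧ Cr n p r k l ∧ Cr n q s k l := by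
    rw [← h.sSlalom_iff hT.prop]
    split_ifs at hν with _ h'
    exact h'
  have w : ∀ {x y i j : ℤ}, i < j → p ≤ i → j < p + 2 * n → p ≤ x → x < p + 2 * n → p ≤ y →
      y < p + 2 * n → (Cr n x y i j ↔ _) := fun {x y i j} => cr_iff_of_window (n := n) p
  rw [w, w, w] at hZ hS <;> try omega
  rw [hi.crosses_iff hk]
  change Cr n i j k l
  rw [w] <;> omega

/-- Passing from the diagonals ae, bd of the quadrilateral to its sides ab, ed never adds crossings.
For chords that avoid its vertices, crossings are lost only if the chord joins the arc be to the arc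
da: it crosses both diagonals and neither side. -/
lemma crInd_exchange {a b e d x y : ℤ} (hab : a < b) (hbe : b < e) (hed : e < d)
    (hda : d < a + 2 * n) (hx : a ≤ x) (hx' : x < a + 2 * n) (hy : a ≤ y) (hy' : y < a + 2 * n) :
    crInd n x y a b + crInd n x y e d ≤ crInd n x y a e + crInd n x y b d ∧
    (x ≠ a → x ≠ b → x ≠ e → x ≠ d → y ≠ a → y ≠ b → y ≠ e → y ≠ d →
      ¬ (b < x ∧ x < e ∧ d < y) → ¬ (b < y ∧ y < e ∧ d < x) →
      crInd n x y a b + crInd n x y e d = crInd n x y a e + crInd n x y b d) := by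
  have h1 := cr_iff_of_window (n := n) a (i := a) (j := b) (by omega) (by omega) (by omega) hx hx' hy hy'
  have h2 := cr_iff_of_window (n := n) a (i := e) (j := d) (by omega) (by omega) (by omega) hx hx' hy hy'
  have h3 := cr_iff_of_window (n := n) a (i := a) (j := e) (by omega) (by omega) (by omega) hx hx' hy hy'
  have h4 := cr_iff_of_window (n := n) a (i := b) (j := d) (by omega) (by omega) (by omega) hx hx' hy hy'
  unfold crInd
  classical
  simp only [h1, h2, h3, h4]
  clear h1 h2 h3 h4
  constructor
  · split_ifs <;> omega
  · intro n1 n2 n3 n4 n5 n6 n7 n8 n9 n10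
    have ax : (x < b) ∨ (b < x ∧ x < e) ∨ (e < x ∧ x < d) ∨ d < x := by omega
    have ay : (y < b) ∨ (b < y ∧ y < e) ∨ (e < y ∧ y < d) ∨ d < y := by omega
    rcases ax with ax | ax | ax | ax <;> rcases ay with ay | ay | ay | ay <;>
      split_ifs <;> omega

/-! ### Exchanging crossing accordion diagonals -/

open Classical in
/-- The indicator function of crossing. -/
noncomputable def crossInd (ξ : Diagonal n c) (γ : Diagonal n c') : ℤ :=
  if Crosses ξ γ then 1 else 0

lemma Joins.crossInd_eq {ξ : Diagonal n c} {γ : Diagonal n c'} {x y i j : ℤ}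
    (h : Joins ξ (pt x) (pt y)) (h' : Joins γ (pt i) (pt j)) :
    crossInd ξ γ = crInd n x y i j := by
  unfold crossInd crInd
  classical
  exact if_congr (h.crosses_iff h') rfl rfl

/-- The diagonals `μ` and `ν` result from the crossing diagonals `γ` and `γ'` by exchange: they are
opposite sides of the quadrilateral with diagonals `γ` and `γ'`. -/
structure Exchange (D : Finset (Diagonal n c)) (γ γ' μ ν : Diagonal n c') : Prop where
  sign : ∀ δ ∈ D, slalomSign D δ γ + slalomSign D δ γ' = slalomSign D δ μ + slalomSign D δ ν
  le : ∀ ξ : Diagonal n c', crossInd ξ μ + crossInd ξ ν ≤ crossInd ξ γ + crossInd ξ γ'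
  not_cross : ¬ Crosses μ ν
  not_cross_left : ¬ Crosses γ μ ∧ ¬ Crosses γ ν
  not_cross_right : ¬ Crosses γ' μ ∧ ¬ Crosses γ' ν

lemma Exchange.swap {D : Finset (Diagonal n c)} {γ γ' μ ν : Diagonal n c'}
    (h : Exchange D γ γ' μ ν) : Exchange D γ' γ μ ν :=
  ⟨fun δ hδ => by rw [← h.sign δ hδ, add_comm], fun ξ => by rw [add_comm (crossInd ξ γ')]; exact h.le ξ,
    h.not_cross, h.not_cross_right, h.not_cross_left⟩

/-- `hno` excludes from T the chords that lose crossings, so every chord of T has the same crossing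
count with both pairs. Shear coordinates are linear in these counts. -/
lemma exchange_of_quadrilateral {T : Finset (Diagonal n c)} (hT : Maximal IsDissection T)
    (hn : 3 ≤ n) (hcc : c + c' = 1) {a b e d : ℤ} (hab : a < b) (hbe : b < e) (hed : e < d)
    (hda : d < a + 2 * n) {γ γ' : Diagonal n c'} (hγ : Joins γ (pt a) (pt e))
    (hγ' : Joins γ' (pt b) (pt d))
    (hno : ∀ x y, bar T x y → b < x → x < e → d < y → y < a + 2 * n → False) :
    ∃ μ ν, Exchange T γ γ' μ ν := by
  have p1 := hγ.parity
  have p2 := hγ'.parity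
  obtain ⟨μ, hμ⟩ := exists_joins_of_lt (n := n) p1.1 p2.1 hab (by omega)
  obtain ⟨ν, hν⟩ := exists_joins_of_lt (n := n) p1.2 p2.2 hed (by omega)
  have hbar : ∀ x y, bar T x y →
      crInd n x y a b + crInd n x y e d = crInd n x y a e + crInd n x y b d := by
    intro x y hxy
    obtain ⟨x', h1, h2, h3⟩ := exists_pt a (pt x : Fin (2 * n))
    obtain ⟨y', h4, h5, h6⟩ := exists_pt a (pt y : Fin (2 * n))
    have hb' : bar T x' y' := by unfold bar; rw [h3, h6]; exact hxy
    have hp := hb'.parity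
    have := (crInd_exchange hab hbe hed hda h1 h2 h4 h5).2 (by omega) (by omega) (by omega)
      (by omega) (by omega) (by omega) (by omega) (by omega)
      (fun h => hno x' y' hb' h.1 h.2.1 h.2.2 h5) (fun h => hno y' x' hb'.symm h.1 h.2.1 h.2.2 h2)
    unfold crInd Cr at this ⊢
    rw [← h3, ← h6]
    exact this
  have w := fun {x y i j : ℤ} => cr_iff_of_window (n := n) (x := x) (y := y) (i := i) (j := j) a
  refine ⟨μ, ν, ⟨?_, ?_, ?_, ?_, ?_⟩⟩
  · intro δ hδT
    obtain ⟨p, r, q, s, hδ, h⟩ := exists_quad hT hn hδT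
    have e1 := h.two_mul_slalomSign hT.prop hcc hδT hδ (by omega) (by omega) hγ
    have e2 := h.two_mul_slalomSign hT.prop hcc hδT hδ (by omega) (by omega) hγ'
    have e3 := h.two_mul_slalomSign hT.prop hcc hδT hδ (by omega) (by omega) hμ
    have e4 := h.two_mul_slalomSign hT.prop hcc hδT hδ (by omega) (by omega) hν
    have b1 := hbar p s h.ps
    have b2 := hbar q r h.rq.symm
    have b3 := hbar p r h.pr
    have b4 := hbar q s h.qs
    omega
  · intro ξ
    obtain ⟨x', h1, h2, h3⟩ := exists_pt a ξ.1.1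
    obtain ⟨y', h4, h5, h6⟩ := exists_pt a ξ.1.2
    have hξ : Joins ξ (pt x') (pt y') := Or.inl ⟨h3.symm, h6.symm⟩
    rw [hξ.crossInd_eq hμ, hξ.crossInd_eq hν, hξ.crossInd_eq hγ, hξ.crossInd_eq hγ']
    exact (crInd_exchange hab hbe hed hda h1 h2 h4 h5).1
  · rw [hμ.crosses_iff hν]; change ¬ Cr n _ _ _ _
    rw [w] <;> omega
  · rw [hγ.crosses_iff hμ, hγ.crosses_iff hν]; change ¬ Cr n _ _ _ _ ∧ ¬ Cr n _ _ _ _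
    rw [w, w] <;> omega
  · rw [hγ'.crosses_iff hμ, hγ'.crosses_iff hν]; change ¬ Cr n _ _ _ _ ∧ ¬ Cr n _ _ _ _
    rw [w, w] <;> omega

/-- Chords joining the arcs be and da cross those joining the arcs ab and ed, so T misses one of the
two kinds. This decides which pair of opposite sides is used. -/
lemma exists_exchange_of_maximal {T : Finset (Diagonal n c)} (hT : Maximal IsDissection T)
    (hn : 3 ≤ n) (hcc : c + c' = 1) {γ γ' : Diagonal n c'} (h : Crosses γ γ') :
    ∃ μ ν, Exchange T γ γ' μ ν := by
  obtain ⟨a, e, hae, hea, hγ⟩ := exists_lift γ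
  obtain ⟨b, d, h1, h2, h3, h4, hγ'⟩ := exists_lift_of_cr hae hea (joins_self γ')
    (((joins_self γ').crosses_iff hγ).1 h.symm)
  by_cases hex : ∃ x y, bar T x y ∧ b < x ∧ x < e ∧ d < y ∧ y < a + 2 * n
  · obtain ⟨x, y, h5, h6, h7, h8, h9⟩ := hex
    obtain ⟨μ, ν, hE⟩ := exchange_of_quadrilateral hT hn hcc (a := b) (b := e) (e := d)
      (d := a + 2 * n) h2 h3 h4 (by omega) hγ' (γ' := γ) (by rw [pt_add]; exact hγ.symm)
      fun x' y' h5' h6' h7' h8' h9' =>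
        h5.not_cross hT.prop h5' (by omega) (by omega) (by omega) (by omega)
    exact ⟨μ, ν, hE.swap⟩
  · exact exchange_of_quadrilateral hT hn hcc h1 h2 h3 h4 hγ hγ'
      fun x y h5 h6 h7 h8 h9 => hex ⟨x, y, h5, h6, h7, h8, h9⟩

lemma slalomSign_trichotomy (D : Finset (Diagonal n c)) (δ : Diagonal n c) (η : Diagonal n c') :
    slalomSign D δ η = 1 ∨ slalomSign D δ η = -1 ∨ slalomSign D δ η = 0 := by
  unfold slalomSign
  split_ifs <;> simp

/-- Two crossing accordion diagonals can be exchanged for two accordion diagonals with the same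
sum of slalom signs. -/
theorem exists_exchange {D : Finset (Diagonal n c)} (hD : IsDissection D)
    (hn : 3 ≤ n) (hcc : c + c' = 1) {γ γ' : Diagonal n c'} (hγ : IsAccordionDiagonal D γ)
    (hγ' : IsAccordionDiagonal D γ') (h : Crosses γ γ') :
    ∃ μ ν, IsAccordionDiagonal D μ ∧ IsAccordionDiagonal D ν ∧ Exchange D γ γ' μ ν := by
  obtain ⟨T, hDT, hT⟩ := hD.exists_maximal
  obtain ⟨μ, ν, hE⟩ := exists_exchange_of_maximal hT hn hcc h
  -- The two signs add up to 0 off D. If nonzero they would be 1 and -1, and μ, ν would cross.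
  have hz : ∀ δ ∈ T, δ ∉ D → slalomSign T δ μ = 0 ∧ slalomSign T δ ν = 0 := by
    intro δ hδ hδD
    have h1 := hE.sign δ hδ
    rw [(slalomSign_of_subset hT.prop hD hDT hn hcc hγ hδ).2 hδD,
      (slalomSign_of_subset hT.prop hD hDT hn hcc hγ' hδ).2 hδD] at h1
    have h2 : ¬ (slalomSign T δ μ = 1 ∧ slalomSign T δ ν = -1) := fun h =>
      hE.not_cross (crosses_of_slalomSign hT hn hδ h.1 h.2)
    have h3 : ¬ (slalomSign T δ ν = 1 ∧ slalomSign T δ μ = -1) := fun h =>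
      hE.not_cross (crosses_of_slalomSign hT hn hδ h.1 h.2).symm
    have := slalomSign_trichotomy T δ μ
    have := slalomSign_trichotomy T δ ν
    omega
  have hμ := isAccordionDiagonal_of_slalomSign hT.prop hD hDT hn hcc
    (isAccordionDiagonal_of_maximal hT hn hcc μ) fun δ h1 h2 => (hz δ h1 h2).1
  have hν := isAccordionDiagonal_of_slalomSign hT.prop hD hDT hn hcc
    (isAccordionDiagonal_of_maximal hT hn hcc ν) fun δ h1 h2 => (hz δ h1 h2).2
  refine ⟨μ, ν, hμ, hν, ⟨fun δ hδ => ?_, hE.le, hE.not_cross, hE.not_cross_left,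
    hE.not_cross_right⟩⟩
  have h1 := fun {η : Diagonal n c'} (hη : IsAccordionDiagonal D η) =>
    (slalomSign_of_subset hT.prop hD hDT hn hcc hη (hDT hδ)).1 hδ
  rw [← h1 hγ, ← h1 hγ', ← h1 hμ, ← h1 hν]
  exact hE.sign δ (hDT hδ)

/-- Accordion diagonals stay accordion diagonals when the dissection is refined, and their slalom
signs on the new diagonals vanish. -/
theorem IsAccordionDiagonal.refine {D D' : Finset (Diagonal n c)} (hD : IsDissection D)
    (hD' : IsDissection D') (hDD' : D ⊆ D') (hn : 3 ≤ n) (hcc : c + c' = 1) {η : Diagonal n c'}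
    (h : IsAccordionDiagonal D η) : IsAccordionDiagonal D' η := by
  obtain ⟨T, hDT, hT⟩ := hD'.exists_maximal
  exact isAccordionDiagonal_of_slalomSign hT.prop hD' hDT hn hcc
    (isAccordionDiagonal_of_maximal hT hn hcc η) fun δ h1 h2 =>
    (slalomSign_of_subset hT.prop hD (hDD'.trans hDT) hn hcc h h1).2 fun h3 => h2 (hDD' h3)

/-! ### Maximal accordion dissections -/

lemma acc_boundary (D : Finset (Diagonal n c)) (hn : 3 ≤ n) {a : ℤ} (ha : (a + 1) % 2 = c) :
    Acc D a (a + 2) := by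
  intro x y h
  have h1 := h.left; have h2 := h.right; have h3 := h.left'
  have hp := h.bar.parity
  by_cases hy : y = a + 3
  · exact Or.inl (by omega)
  · refine Or.inr (Or.inl ⟨a + 3, by omega, by omega, ?_⟩)
    have := bar_add_two D hn hp.1
    rwa [show x + 2 = a + 3 by omega] at this

lemma isAccordionDiagonal_of_isBoundary {D : Finset (Diagonal n c)} (hD : IsDissection D)
    (hn : 3 ≤ n) (hcc : c + c' = 1) {η : Diagonal n c'} (h : IsBoundary η) :
    IsAccordionDiagonal D η := by
  obtain ⟨a, b, hab, hba, hη⟩ := exists_lift η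
  have pa := parity_swap hcc hη.parity.1
  have pb := parity_swap hcc hη.parity.2
  rcases (hη.isBoundary_iff hab hba).1 h with rfl | hb
  · exact (isAccordionDiagonal_iff D hD hn hcc hab hba hη).2 (acc_boundary D hn pa)
  · obtain rfl : a = b + 2 - 2 * n := by omega
    rw [pt_sub] at hη
    exact (isAccordionDiagonal_iff D hD hn hcc (by omega) (by omega) hη.symm).2
      (acc_boundary D hn pb)

lemma acc_of_bar {D : Finset (Diagonal n c)} (hD : IsDissection D) (hn : 3 ≤ n)
    (hcc : c + c' = 1) {E : Finset (Diagonal n c')} (hE : IsAccordionDissection D E) {a b : ℤ}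
    (h : bar E a b) (hab : a < b) (hba : b < a + 2 * n) : Acc D a b := by
  obtain ⟨η, h1, h2⟩ := h
  rw [← isAccordionDiagonal_iff D hD hn hcc hab hba h2]
  rcases h1 with h1 | h1
  exacts [hE.2 η h1, isAccordionDiagonal_of_isBoundary hD hn hcc h1]

lemma bar_of_acc {D : Finset (Diagonal n c)} (hD : IsDissection D) (hn : 3 ≤ n)
    (hcc : c + c' = 1) {E : Finset (Diagonal n c')} (hE : IsMaximalAccordionDissection D E)
    {a b : ℤ} (ha : a % 2 = c') (hb : b % 2 = c') (hab : a < b) (hba : b < a + 2 * n)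
    (h : Acc D a b)
    (hno : ∀ p q, bar E p q → a < p → p < b → b < q → q < a + 2 * n → False) : bar E a b :=
  bar_of_maximal_of_forall hE ha hb hab hba
    (fun _ hδ => (isAccordionDiagonal_iff D hD hn hcc hab hba hδ).2 h) hno

/-- If `D` has a chord that separates `aa'` from `b'b`, and `ab` and `a'b'` are accordions, so
is `ab'`. -/
lemma Acc.transversal {D : Finset (Diagonal n c)} (hD : IsDissection D) (hcc : c + c' = 1)
    {a a' b' b x₀ y₀ : ℤ} (hac : a' % 2 = c') (hbc : b' % 2 = c') (hbc' : b % 2 = c')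
    (h1 : a < a') (h2 : a' < y₀) (h3 : y₀ < b') (h4 : b' < b)
    (h5 : b < x₀) (h6 : x₀ < a + 2 * n) (hδ : bar D y₀ x₀) (h : Acc D a b) (h' : Acc D a' b') :
    Acc D a b' := by
  intro x y hxy
  have g1 := hxy.left; have g2 := hxy.right; have g3 := hxy.left'; have g4 := hxy.right'
  have gp := hxy.bar.parity
  rcases lt_or_gt_of_ne (show x ≠ a' by omega) with hx | hx
  -- Starting before a', the chord must pass outside y₀x₀, so it is also cut by ab. Its successor
  -- there serves for ab' too, unless it shares y and starts at or beyond b'; then y = x₀ and y₀x₀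
  -- itself is a successor.
  · have hyx : x₀ ≤ y := by
      by_contra hcon
      exact hxy.bar.not_cross hD hδ (by omega) (by omega) (by omega) (by omega)
    rcases h x y ⟨g1, by omega, by omega, g4, hxy.bar⟩ with e | ⟨y', e1, e2, e3⟩ | ⟨x', e1, e2, e3⟩
    · omega
    · exact Or.inr (Or.inl ⟨y', by omega, e2, e3⟩)
    · by_cases hx' : x' < b'
      · exact Or.inr (Or.inr ⟨x', e1, hx', e3⟩)
      · have hy : y = x₀ := by
          by_contra hcon
          have := e3.parity
          exact hδ.not_cross hD e3 (by omega) (by omega) (by omega) (by omega)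
        subst hy
        exact Or.inr (Or.inr ⟨y₀, by omega, h3, hδ⟩)
  · exact h' x y ⟨hx, g2, g3, by omega, hxy.bar⟩

/-- The diagonals of `D` are accordions for the maximal `D`-accordion dissections. -/
theorem acc_of_isMaximal {D : Finset (Diagonal n c)} (hD : IsDissection D) (hn : 3 ≤ n)
    (hcc : c + c' = 1) {E : Finset (Diagonal n c')} (hE : IsMaximalAccordionDissection D E)
    {x₀ y₀ : ℤ} (hδ : bar D x₀ y₀) (hxy : x₀ < y₀) (hyx : y₀ < x₀ + 2 * n) : Acc E x₀ y₀ := by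
  have hp := hδ.parity
  intro a b hab
  by_contra hcon
  simp only [not_or] at hcon
  obtain ⟨hnl, hNX, hNY⟩ := hcon
  have g1 := hab.left; have g2 := hab.right; have g3 := hab.left'; have g4 := hab.right'
  have gp := hab.bar.parity
  have hlast := cut_last E hn (i := x₀) (j := y₀) (by omega) (by omega) hxy hyx
  -- a'b' is the widest chord of E crossed after ab; `hcon` says that it shares neither end with ab.
  obtain ⟨m, ⟨a', b', rfl, hne, ha', hb', hcut⟩, hmax⟩ := Int.exists_greatest_of_bdd
    (P := fun m => ∃ a' b', m = b' - a' ∧ ¬ (a' = a ∧ b' = b) ∧ a ≤ a' ∧ b' ≤ b ∧ Cut E x₀ y₀ a' b')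
    ⟨b - a, by rintro z ⟨a', b', rfl, -, h1, h2, -⟩; omega⟩
    ⟨_, _, _, rfl, fun h => hnl ⟨h.1.symm, h.2.symm⟩, by omega, by omega, hlast⟩
  have l1 := hcut.left; have l2 := hcut.right; have l3 := hcut.left'; have l4 := hcut.right'
  have lp := hcut.bar.parity
  have ha : a < a' := by
    by_contra hc
    obtain rfl : a' = a := by omega
    exact hNX ⟨b', l3, by omega, hcut.bar⟩
  have hb : b' < b := by
    by_contra hc
    obtain rfl : b' = b := by omega
    exact hNY ⟨a', by omega, l2, hcut.bar⟩
  have hacc : Acc D a b' := Acc.transversal hD hcc (a' := a') (b := b) (x₀ := x₀ + 2 * n)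
    (y₀ := y₀) lp.1 lp.2 gp.2 ha l2 l3 hb (by omega) (by omega) (bar_add_iff.2 hδ.symm)
    (acc_of_bar hD hn hcc hE.prop hab.bar (by omega) (by omega))
    (acc_of_bar hD hn hcc hE.prop hcut.bar (by omega) (by omega))
  -- A chord of E across ab' crosses neither ab nor a'b', so it lies between them and contradicts
  -- the choice of a'b'. By maximality ab' is in E or a boundary edge; it is then a later chord at
  -- a, against `hNX`.
  have hbar := bar_of_acc hD hn hcc hE gp.1 lp.2 (by omega) (by omega) hacc (by
    intro p q hpq e1 e2 e3 e4
    have hq : q ≤ b := by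
      by_contra hc
      exact hab.bar.not_cross hE.prop.1 hpq e1 (by omega) (by omega) e4
    have hp : p ≤ a' := by
      by_contra hc
      exact hcut.bar.not_cross hE.prop.1 hpq (by omega) e2 e3 (by omega)
    have := hmax _ ⟨p, q, rfl, by omega, by omega, hq, by omega, by omega, by omega, by omega, hpq⟩
    omega)
  exact hNX ⟨b', l3, hb, hbar⟩

/-! ### Duality of `g`-vectors and `c`-vectors -/

open Classical in
/-- The indicator of a proposition. -/
noncomputable def ind (p : Prop) : ℤ := if p then 1 else 0

lemma ind_true {p : Prop} (h : p) : ind p = 1 := if_pos h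

lemma ind_false {p : Prop} (h : ¬ p) : ind p = 0 := if_neg h

lemma ind_congr {p q : Prop} (h : p ↔ q) : ind p = ind q := by rw [propext h]

/-- All elements but the maximum have a larger one, all but the minimum have a smaller one: both
counts are |S| - 1 when S is nonempty. -/
lemma sum_ind_lt_sub (S : Finset ℤ) :
    ∑ y ∈ S, (ind (∃ z ∈ S, y < z) - ind (∃ z ∈ S, z < y)) = 0 := by
  rcases S.eq_empty_or_nonempty with rfl | hS
  · rfl
  have h1 : ∀ y ∈ S, ind (∃ z ∈ S, y < z) = 1 - if y = S.max' hS then 1 else 0 := by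
    intro y hy
    have hle := S.le_max' y hy
    split_ifs with h
    · rw [ind_false]; · rfl
      rintro ⟨z, hz, hyz⟩
      have := S.le_max' z hz
      omega
    · rw [ind_true ⟨_, S.max'_mem hS, by omega⟩]; rfl
  have h2 : ∀ y ∈ S, ind (∃ z ∈ S, z < y) = 1 - if y = S.min' hS then 1 else 0 := by
    intro y hy
    have hle := S.min'_le y hy
    split_ifs with h
    · rw [ind_false]; · rfl
      rintro ⟨z, hz, hyz⟩
      have := S.min'_le z hz
      omega
    · rw [ind_true ⟨_, S.min'_mem hS, by omega⟩]; rfl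
  rw [Finset.sum_sub_distrib, Finset.sum_congr rfl h1, Finset.sum_congr rfl h2,
    Finset.sum_sub_distrib, Finset.sum_sub_distrib, Finset.sum_ite_eq', Finset.sum_ite_eq',
    if_pos (S.max'_mem hS), if_pos (S.min'_mem hS), sub_self]

open Classical in
/-- The chords of `D` crossed by `ij`. -/
noncomputable def cuts (D : Finset (Diagonal n c)) (i j : ℤ) : Finset (ℤ × ℤ) :=
  (Finset.Ioo i j ×ˢ Finset.Ioo j (i + 2 * n)).filter fun z => bar D z.1 z.2

lemma mem_cuts {D : Finset (Diagonal n c)} {i j : ℤ} {z : ℤ × ℤ} :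
    z ∈ cuts D i j ↔ Cut D i j z.1 z.2 := by
  simp only [cuts, Finset.mem_filter, Finset.mem_product, Finset.mem_Ioo]
  exact ⟨fun ⟨⟨⟨h1, h2⟩, h3, h4⟩, h5⟩ => ⟨h1, h2, h3, h4, h5⟩,
    fun ⟨h1, h2, h3, h4, h5⟩ => ⟨⟨⟨h1, h2⟩, h3, h4⟩, h5⟩⟩

/-- For fixed x the cuts form a fan ordered by y. Each fan contributes its weight times the
vanishing sum of `sum_ind_lt_sub`. -/
lemma sum_cuts_fst (D : Finset (Diagonal n c)) (i j : ℤ) (φ : ℤ → ℤ) :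
    ∑ z ∈ cuts D i j, φ z.1 * (ind (PX D i j z.1 z.2) - ind (NX D i j z.1 z.2)) = 0 := by
  classical
  rw [cuts, Finset.sum_filter, Finset.sum_product]
  refine Finset.sum_eq_zero fun x _ => ?_
  simp only
  rw [← Finset.sum_filter, ← Finset.mul_sum]
  have h := sum_ind_lt_sub ((Finset.Ioo j (i + 2 * n)).filter fun y => bar D x y)
  rw [← mul_zero (φ x), ← h]
  congr 1
  refine Finset.sum_congr rfl fun y hy => ?_
  rw [Finset.mem_filter, Finset.mem_Ioo] at hy
  congr 1
  · refine ind_congr ⟨?_, ?_⟩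
    · rintro ⟨y', h1, h2, h3⟩
      exact ⟨y', Finset.mem_filter.2 ⟨Finset.mem_Ioo.2 ⟨by omega, h2⟩, h3⟩, h1⟩
    · rintro ⟨y', h1, h2⟩
      rw [Finset.mem_filter, Finset.mem_Ioo] at h1
      exact ⟨y', h2, h1.1.2, h1.2⟩
  · refine ind_congr ⟨?_, ?_⟩
    · rintro ⟨y', h1, h2, h3⟩
      exact ⟨y', Finset.mem_filter.2 ⟨Finset.mem_Ioo.2 ⟨h1, by omega⟩, h3⟩, h2⟩
    · rintro ⟨y', h1, h2⟩
      rw [Finset.mem_filter, Finset.mem_Ioo] at h1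
      exact ⟨y', h1.1.1, h2, h1.2⟩

lemma sum_cuts_snd (D : Finset (Diagonal n c)) (i j : ℤ) (φ : ℤ → ℤ) :
    ∑ z ∈ cuts D i j, φ z.2 * (ind (NY D i j z.1 z.2) - ind (PY D i j z.1 z.2)) = 0 := by
  classical
  rw [cuts, Finset.sum_filter, Finset.sum_product_right]
  refine Finset.sum_eq_zero fun y _ => ?_
  simp only
  rw [← Finset.sum_filter, ← Finset.mul_sum]
  have h := sum_ind_lt_sub ((Finset.Ioo i j).filter fun x => bar D x y)
  rw [← mul_zero (φ y), ← h]
  congr 1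
  refine Finset.sum_congr rfl fun x hx => ?_
  rw [Finset.mem_filter, Finset.mem_Ioo] at hx
  congr 1
  · refine ind_congr ⟨?_, ?_⟩
    · rintro ⟨x', h1, h2, h3⟩
      exact ⟨x', Finset.mem_filter.2 ⟨Finset.mem_Ioo.2 ⟨by omega, h2⟩, h3⟩, h1⟩
    · rintro ⟨x', h1, h2⟩
      rw [Finset.mem_filter, Finset.mem_Ioo] at h1
      exact ⟨x', h2, h1.1.2, h1.2⟩
  · refine ind_congr ⟨?_, ?_⟩
    · rintro ⟨x', h1, h2, h3⟩
      exact ⟨x', Finset.mem_filter.2 ⟨Finset.mem_Ioo.2 ⟨h1, by omega⟩, h3⟩, h2⟩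
    · rintro ⟨x', h1, h2⟩
      rw [Finset.mem_filter, Finset.mem_Ioo] at h1
      exact ⟨x', h1.1.1, h2, h1.2⟩

/-- A sum over the diagonals of `D` crossed by a chord, as a sum over their lifts. -/
lemma sum_add_ends_eq_sum_cuts {D : Finset (Diagonal n c)} (hD : IsDissection D) (hn : 3 ≤ n)
    (hcc : c + c' = 1) {γ : Diagonal n c'} {i j : ℤ} (hij : i < j) (hji : j < i + 2 * n)
    (hγ : Joins γ (pt i) (pt j)) {f : Diagonal n c → ℤ} {g : ℤ × ℤ → ℤ}
    (hf : ∀ δ, ¬ Crosses δ γ → f δ = 0)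
    (hfg : ∀ δ ∈ D, ∀ x y, Cut D i j x y → Joins δ (pt x) (pt y) → f δ = g (x, y)) :
    ∑ δ ∈ D, f δ + g (i + 1, i + 2 * n - 1) + g (j - 1, j + 1) = ∑ z ∈ cuts D i j, g z := by
  classical
  have pi := parity_swap hcc hγ.parity.1
  have pj := parity_swap hcc hγ.parity.2
  have hfirst := (mem_cuts (z := (i + 1, i + 2 * (n : ℤ) - 1))).2
    (cut_first D hn pi pj hij hji)
  have hlast := (mem_cuts (z := (j - 1, j + 1))).2 (cut_last D hn pi pj hij hji)
  have hne : ((j - 1, j + 1) : ℤ × ℤ) ≠ (i + 1, i + 2 * n - 1) := by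
    intro h
    simp only [Prod.mk.injEq] at h
    omega
  rw [← Finset.add_sum_erase _ _ hfirst, ← Finset.add_sum_erase (a := ((j - 1, j + 1) : ℤ × ℤ)) _ _
    (Finset.mem_erase.2 ⟨hne, hlast⟩)]
  have key : ∑ z ∈ ((cuts D i j).erase (i + 1, i + 2 * (n : ℤ) - 1)).erase (j - 1, j + 1), g z
      = ∑ δ ∈ D.filter (Crosses · γ), f δ := by
    have hmem : ∀ z ∈ ((cuts D i j).erase (i + 1, i + 2 * (n : ℤ) - 1)).erase (j - 1, j + 1),
        Cut D i j z.1 z.2 ∧ ∃ δ ∈ D, Joins δ (pt z.1) (pt z.2) := by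
      rintro ⟨x, y⟩ hz
      rw [Finset.mem_erase, Finset.mem_erase, mem_cuts] at hz
      obtain ⟨h1, h2, h3⟩ := hz
      refine ⟨h3, ?_⟩
      obtain ⟨δ, hδ, hj⟩ := id h3.bar
      refine ⟨δ, hδ.resolve_right fun hb => ?_, hj⟩
      have g1 := h3.left; have g2 := h3.right; have g3 := h3.left'; have g4 := h3.right'
      rw [hj.isBoundary_iff (by simp only at *; omega) (by simp only at *; omega)] at hb
      simp only [ne_eq, Prod.mk.injEq] at *
      omega
    have : Nonempty (Diagonal n c) := ⟨(mem_cuts.1 hfirst).bar.choose⟩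
    choose! d hd using fun z hz => (hmem z hz).2
    refine Finset.sum_bij (fun z _ => d z) ?_ ?_ ?_ ?_
    · intro z hz
      exact Finset.mem_filter.2 ⟨(hd z hz).1, ((hd z hz).2.crosses_iff hγ).2 (hmem z hz).1.cr⟩
    · intro z hz z' hz' he
      have j1 := (hd z hz).2
      have j2 := (hd z' hz').2
      rw [← he] at j2
      have c1 := (hmem z hz).1
      have c2 := (hmem z' hz').1
      have g1 := c1.left; have g2 := c1.right; have g3 := c1.left'; have g4 := c1.right'
      have k1 := c2.left; have k2 := c2.right; have k3 := c2.left'; have k4 := c2.right'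
      rcases j1.eq_or j2 with ⟨e1, e2⟩ | ⟨e1, e2⟩
      · exact Prod.ext (pt_inj i (by omega) (by omega) (by omega) (by omega) e1.symm)
          (pt_inj i (by omega) (by omega) (by omega) (by omega) e2.symm)
      · have := pt_inj i (by omega) (by omega) (by omega) (by omega) e1
        omega
    · intro δ hδ
      rw [Finset.mem_filter] at hδ
      obtain ⟨x, y, hxy, hj⟩ := exists_cut (D := D) hij hji hγ ⟨Or.inl hδ.1, hδ.2⟩
      have hz : (x, y) ∈ ((cuts D i j).erase (i + 1, i + 2 * (n : ℤ) - 1)).erase (j - 1, j + 1) := by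
        have hb := hD.1 δ hδ.1
        have g1 := hxy.left; have g2 := hxy.right; have g3 := hxy.left'; have g4 := hxy.right'
        rw [hj.isBoundary_iff (by omega) (by omega)] at hb
        rw [Finset.mem_erase, Finset.mem_erase, mem_cuts]
        simp only [ne_eq, Prod.mk.injEq]
        exact ⟨by omega, by omega, hxy⟩
      exact ⟨(x, y), hz, (hd _ hz).2.unique hj⟩
    · intro z hz
      exact (hfg _ (hd z hz).1 _ _ (hmem z hz).1 (hd z hz).2).symm
  rw [key, Finset.sum_filter_of_ne]
  · ring
  · intro δ _ h
    by_contra hc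
    exact h (hf δ hc)

/-- The slalom sign of an accordion diagonal is a difference of indicators. -/
lemma Acc.slalomSign_eq_sub {D : Finset (Diagonal n c)} (hD : IsDissection D) (hn : 3 ≤ n)
    (hcc : c + c' = 1) {γ : Diagonal n c'} {i j : ℤ} (hij : i < j) (hji : j < i + 2 * n)
    (hγ : Joins γ (pt i) (pt j)) (h : Acc D i j) {δ : Diagonal n c} (hδD : δ ∈ D) {x y : ℤ}
    (hxy : Cut D i j x y) (hδ : Joins δ (pt x) (pt y)) :
    slalomSign D δ γ = ind (PX D i j x y) - ind (NX D i j x y) ∧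
    slalomSign D δ γ = ind (NY D i j x y) - ind (PY D i j x y) := by
  have g1 := hxy.left; have g2 := hxy.right; have g3 := hxy.left'; have g4 := hxy.right'
  have hb := hD.1 δ hδD
  rw [hδ.isBoundary_iff (by omega) (by omega)] at hb
  have hP : PX D i j x y ∨ PY D i j x y := (h.prev hD hn hcc hij hji hγ hxy).resolve_left (by omega)
  have hN : NX D i j x y ∨ NY D i j x y := (h x y hxy).resolve_left (by omega)
  have hP' : PX D i j x y → ¬ PY D i j x y := fun h => h.not_PY hD g2 g3
  have hN' : NX D i j x y → ¬ NY D i j x y := fun h => h.not_NY hD g1 g4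
  rw [slalomSign_eq_ite hD hδD hδ hxy hγ]
  unfold ind
  by_cases a1 : PX D i j x y
  · have a2 := hP' a1
    by_cases a3 : NX D i j x y
    · simp [a1, a2, a3, hN' a3]
    · simp [a1, a2, a3, hN.resolve_left a3]
  · have a2 := hP.resolve_left a1
    by_cases a3 : NX D i j x y
    · simp [a1, a2, a3, hN' a3]
    · simp [a1, a2, a3, hN.resolve_left a3]

/-- The coordinates of `c`-vectors as differences of indicators. -/
lemma neg_slalomSign_eq_sub {E : Finset (Diagonal n c')} (hE : IsDissection E)
    {η : Diagonal n c'} {δ : Diagonal n c} (hηE : η ∈ E) {k l x y : ℤ} (h1 : k < x) (h2 : x < l)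
    (h3 : l < y) (h4 : y < k + 2 * n)
    (hη : Joins η (pt k) (pt l)) (hδ : Joins δ (pt x) (pt y)) (hacc : Acc E x y)
    (hacc' : Acc E y (x + 2 * n)) :
    - slalomSign E η δ = ind (∃ a, x < a ∧ a < l ∧ bar E k a) - ind (∃ b, l < b ∧ b < y ∧ bar E k b) := by
  have hkl := bar_of_mem hηE hη
  have hb := hE.1 η hηE
  rw [hη.isBoundary_iff (by omega) (by omega)] at hb
  -- Since δ is an accordion for E in both directions, on each side of η the chain continues at k or
  -- at l, never at both. The indicators at k therefore determine the sign; one depends only on x,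
  -- the other only on y.
  have hB := (hacc l (k + 2 * n) ⟨h2, h3, by omega, by omega, bar_add_iff.2 hkl.symm⟩).resolve_left
    (by omega)
  have hA := (hacc' (k + 2 * n) (l + 2 * n) ⟨by omega, by omega, by omega, by omega,
    bar_add_iff.2 (bar_add_iff.2 hkl.symm).symm⟩).resolve_left (by omega)
  have eZ : ZSlalom E k l x y ↔ (∃ b, l < b ∧ b < y ∧ bar E k b) ∧ ∃ w, k < w ∧ w < x ∧ bar E w l := by
    refine (and_iff_right ((cr_iff_of_lt (by omega) (by omega) (by omega) (by omega) (by omega)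
      (by omega)).2 (by omega))).trans (and_congr ⟨?_, ?_⟩ ⟨?_, ?_⟩)
    · rintro ⟨u, g1, g2, g3, g4⟩
      rw [cr_iff_of_lt (by omega) (by omega) (by omega) (by omega) (by omega) (by omega)] at g4
      exact ⟨u, g1, by omega, g3⟩
    · rintro ⟨b, g1, g2, g3⟩
      exact ⟨b, g1, by omega, g3, cr_of_lt (by omega) (by omega) g2 h4⟩
    · rintro ⟨w, g1, g2, g3, g4⟩
      have g4 := g4.swap_left
      rw [cr_iff_of_window k (by omega) (by omega) (by omega) (by omega) (by omega) (by omega)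
        (by omega)] at g4
      exact ⟨w, g1, by omega, g3.symm⟩
    · rintro ⟨w, g1, g2, g3⟩
      exact ⟨w, g1, by omega, g3.symm, (cr_of_lt (n := n) g2 h2 h3 (by omega)).swap_left⟩
  have eS : SSlalom E k l x y ↔ (∃ a, x < a ∧ a < l ∧ bar E k a) ∧
      ∃ w, y < w ∧ w < k + 2 * n ∧ bar E l w := by
    refine (and_iff_right ((cr_iff_of_lt (by omega) (by omega) (by omega) (by omega) (by omega)
      (by omega)).2 (by omega))).trans (and_congr ⟨?_, ?_⟩ ⟨?_, ?_⟩)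
    · rintro ⟨u, g1, g2, g3, g4⟩
      rw [cr_iff_of_lt (by omega) (by omega) (by omega) (by omega) (by omega) (by omega)] at g4
      exact ⟨u, by omega, g2, g3⟩
    · rintro ⟨b, g1, g2, g3⟩
      exact ⟨b, by omega, g2, g3, cr_of_lt h1 g1 (by omega) h4⟩
    · rintro ⟨w, g1, g2, g3, g4⟩
      rw [cr_iff_of_window k (by omega) (by omega) (by omega) (by omega) (by omega) (by omega)
        (by omega)] at g4
      exact ⟨w, by omega, g2, g3⟩
    · rintro ⟨w, g1, g2, g3⟩
      exact ⟨w, by omega, by omega, g3, (cr_of_lt (n := n) h2 h3 g1 (by omega)).symm⟩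
  have hB1 : (∃ b, l < b ∧ b < y ∧ bar E k b) ∨ ∃ w, y < w ∧ w < k + 2 * n ∧ bar E l w := by
    rcases hB with ⟨w, g1, g2, g3⟩ | ⟨b, g1, g2, g3⟩
    · exact Or.inr ⟨w, g1, g2, g3⟩
    · exact Or.inl ⟨b, g1, g2, (bar_add_iff.1 g3).symm⟩
  have hA1 : (∃ a, x < a ∧ a < l ∧ bar E k a) ∨ ∃ w, k < w ∧ w < x ∧ bar E w l := by
    rcases hA with ⟨a, g1, g2, g3⟩ | ⟨w, g1, g2, g3⟩
    · exact Or.inl ⟨a - 2 * n, by omega, by omega,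
        bar_sub_iff.2 (bar_add_iff.1 g3.symm).symm⟩
    · exact Or.inr ⟨w - 2 * n, by omega, by omega, (bar_sub_iff.2 (bar_add_iff.1 g3).symm).symm⟩
  have hB2 : ¬ ((∃ b, l < b ∧ b < y ∧ bar E k b) ∧ ∃ w, y < w ∧ w < k + 2 * n ∧ bar E l w) := by
    rintro ⟨⟨b, g1, g2, g3⟩, ⟨w, g4, g5, g6⟩⟩
    exact g3.not_cross hE g6 (by omega) g1 (by omega) g5
  have hA2 : ¬ ((∃ a, x < a ∧ a < l ∧ bar E k a) ∧ ∃ w, k < w ∧ w < x ∧ bar E w l) := by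
    rintro ⟨⟨b, g1, g2, g3⟩, ⟨w, g4, g5, g6⟩⟩
    exact g3.not_cross hE g6 g4 (by omega) g2 (by omega)
  rw [slalomSign_eq_ite_slalom hE hηE hη (by omega) (by omega) hδ]
  classical
  simp only [eZ, eS]
  generalize (∃ a, x < a ∧ a < l ∧ bar E k a) = AK at *
  generalize (∃ b, l < b ∧ b < y ∧ bar E k b) = BK at *
  generalize (∃ w, k < w ∧ w < x ∧ bar E w l) = AL at *
  generalize (∃ w, y < w ∧ w < k + 2 * n ∧ bar E l w) = BL at *
  unfold ind
  by_cases a1 : AK <;> by_cases a2 : AL <;> by_cases a3 : BK <;> by_cases a4 : BL <;>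
    simp_all

set_option maxHeartbeats 1000000 in
/-- The pairing of the `g`-vectors of two noncrossing diagonals with the `c`-vectors, when `η` is on
the side of `γ` between `i` and `j`. -/
lemma sum_slalomSign_mul_of_lift {D : Finset (Diagonal n c)} (hD : IsDissection D) (hn : 3 ≤ n)
    (hcc : c + c' = 1) {E : Finset (Diagonal n c')} (hE : IsMaximalAccordionDissection D E)
    {γ η : Diagonal n c'} (hγE : γ ∈ E) (hηE : η ∈ E) {i j k l : ℤ} (hij : i < j)
    (hji : j < i + 2 * n) (hγ : Joins γ (pt i) (pt j)) (hη : Joins η (pt k) (pt l))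
    (hik : i ≤ k) (hkl : k < l) (hlj : l ≤ j) :
    ∑ δ ∈ D, slalomSign D δ γ * (-slalomSign E η δ) = if k = i ∧ l = j then 1 else 0 := by
  have hAcc := acc_of_bar hD hn hcc hE.prop (bar_of_mem hγE hγ) hij hji
  have hbγ := hE.prop.1.1 γ hγE
  have hbη := hE.prop.1.1 η hηE
  rw [hγ.isBoundary_iff hij hji] at hbγ
  rw [hη.isBoundary_iff hkl (by omega)] at hbη
  have pγ := hγ.parity
  have pη := hη.parity
  have hbarη := bar_of_mem hηE hη
  have hbarγ := bar_of_mem hγE hγ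
  have hkb : bar E k (k + 2) := bar_add_two E hn pη.1
  have cval : ∀ δ ∈ D, ∀ x y, Cut D i j x y → Joins δ (pt x) (pt y) → k < x → x < l →
      - slalomSign E η δ =
        ind (∃ a, x < a ∧ a < l ∧ bar E k a) - ind (∃ b, l < b ∧ b < y ∧ bar E k b) := by
    intro δ hδ x y hxy hj h1 h2
    have g3 := hxy.left'; have g4 := hxy.right'
    exact neg_slalomSign_eq_sub hE.prop.1 hηE h1 h2 (by omega) (by omega) hη hj
      (acc_of_isMaximal hD hn hcc hE hxy.bar (by omega) (by omega))
      (acc_of_isMaximal hD hn hcc hE (bar_add_iff.2 hxy.bar.symm) (by omega) (by omega))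
  have f0 : ∀ δ, ¬ Crosses δ γ → slalomSign D δ γ * (-slalomSign E η δ) = 0 := fun δ h => by
    rw [slalomSign_of_not_crosses h, zero_mul]
  have pfirst : ∀ y, ¬ PX D i j y (i + 2 * n - 1) := by
    rintro y ⟨y', h1, h2, -⟩; omega
  have pi := parity_swap hcc pγ.1
  have pj := parity_swap hcc pγ.2
  split_ifs with hc
  · obtain ⟨rfl, rfl⟩ := hc
    -- The sign on γ equals PX - NX and also NY - PY. The first form multiplies the indicator in x,
    -- the second the one in y, so both sums over all cuts vanish and only the boundary cuts remain.
    have s1 := sum_add_ends_eq_sum_cuts hD hn hcc hij hji hγ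
      (f := fun δ => slalomSign D δ γ * (-slalomSign E η δ))
      (g := fun z => ind (∃ a, z.1 < a ∧ a < l ∧ bar E k a) *
          (ind (PX D k l z.1 z.2) - ind (NX D k l z.1 z.2)) -
        ind (∃ b, l < b ∧ b < z.2 ∧ bar E k b) *
          (ind (NY D k l z.1 z.2) - ind (PY D k l z.1 z.2))) f0 (by
        intro δ hδ x y hxy hj
        simp only
        have e := hAcc.slalomSign_eq_sub hD hn hcc hij hji hγ hδ hxy hj
        rw [cval δ hδ x y hxy hj hxy.left hxy.right, mul_sub]
        nth_rw 1 [e.1]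
        rw [e.2]
        ring)
    rw [Finset.sum_sub_distrib, sum_cuts_fst D k l fun x => ind (∃ a, x < a ∧ a < l ∧ bar E k a),
      sum_cuts_snd D k l fun y => ind (∃ b, l < b ∧ b < y ∧ bar E k b)] at s1
    simp only at s1
    rw [ind_false (pfirst (k + 1)), ind_true (p := ∃ a, k + 1 < a ∧ a < l ∧ bar E k a)
        ⟨k + 2, by omega, by omega, hkb⟩,
      ind_true (p := ∃ b, l < b ∧ b < k + 2 * (n : ℤ) - 1 ∧ bar E k b)
        ⟨k + 2 * n - 2, by omega, by omega, ?_⟩,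
      ind_false (p := PY D k l (k + 1) _) (by rintro ⟨x', h1, h2, -⟩; omega),
      ind_false (p := ∃ a, l - 1 < a ∧ a < l ∧ bar E k a) (by rintro ⟨x', h1, h2, -⟩; omega),
      ind_false (p := ∃ b, l < b ∧ b < l + 1 ∧ bar E k b) (by rintro ⟨x', h1, h2, -⟩; omega)] at s1
    · have hf := cut_first D hn pi pj hij hji
      -- The first cut contributes -(NX + NY) = -1 and the last one 0, hence the pairing is 1.
      have hN : ind (NX D k l (k + 1) (k + 2 * n - 1)) + ind (NY D k l (k + 1) (k + 2 * n - 1)) = 1 := by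
        rcases hAcc _ _ hf with h | h | h
        · omega
        · rw [ind_true h, ind_false (h.not_NY hD (by omega) (by omega))]; rfl
        · rw [ind_true h, ind_false fun h' => h'.not_NY hD (by omega) (by omega) h]; rfl
      linarith
    · have := (bar_add_two E hn (a := k - 2) (by omega)).symm
      rw [sub_add_cancel, ← bar_add_iff] at this
      rwa [show k + 2 * (n : ℤ) - 2 = k - 2 + 2 * n by ring]
  -- The bound b < y may be replaced by b ≤ j: a chord at k cannot cross γ, and for k = i the chord
  -- γ itself is a witness. The c-coordinate then depends only on x, and both boundary terms vanish.
  · have s1 := sum_add_ends_eq_sum_cuts hD hn hcc hij hji hγ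
      (f := fun δ => slalomSign D δ γ * (-slalomSign E η δ))
      (g := fun z => ind (k < z.1 ∧ z.1 < l) * (ind (∃ a, z.1 < a ∧ a < l ∧ bar E k a) -
          ind (∃ b, l < b ∧ b ≤ j ∧ bar E k b)) *
          (ind (PX D i j z.1 z.2) - ind (NX D i j z.1 z.2))) f0 (by
        intro δ hδ x y hxy hj
        simp only
        have e := hAcc.slalomSign_eq_sub hD hn hcc hij hji hγ hδ hxy hj
        have g1 := hxy.left; have g2 := hxy.right; have g3 := hxy.left'; have g4 := hxy.right'
        have px := hxy.bar.parity
        by_cases hx : k < x ∧ x < l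
        · rw [cval δ hδ x y hxy hj hx.1 hx.2, e.1, ind_true hx, one_mul, mul_comm,
            ind_congr (p := ∃ b, l < b ∧ b < y ∧ bar E k b)
              (q := ∃ b, l < b ∧ b ≤ j ∧ bar E k b) ⟨?_, ?_⟩]
          · rintro ⟨b, b1, b2, b3⟩
            by_cases hki : k = i
            · subst hki
              exact ⟨j, by omega, le_rfl, hbarγ⟩
            · refine ⟨b, b1, ?_, b3⟩
              by_contra hb
              exact hbarγ.not_cross hE.prop.1 b3 (by omega) (by omega) (by omega) (by omega)
          · rintro ⟨b, b1, b2, b3⟩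
            exact ⟨b, b1, by omega, b3⟩
        · rw [ind_false hx, zero_mul, zero_mul, slalomSign_of_not_crosses (D := E), neg_zero, mul_zero]
          rw [hη.crosses_iff hj]
          change ¬ Cr n k l x y
          intro h
          have h := h.symm
          rw [cr_iff_of_window i hkl hik (by omega) (by omega) (by omega) (by omega) g4] at h
          rcases h with h | h
          · exact hx ⟨h.1, h.2.1⟩
          · omega)
    rw [sum_cuts_fst D i j fun x => ind (k < x ∧ x < l) * (ind (∃ a, x < a ∧ a < l ∧ bar E k a) -
          ind (∃ b, l < b ∧ b ≤ j ∧ bar E k b))] at s1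
    simp only at s1
    have z1 : ind (k < i + 1 ∧ i + 1 < l) * (ind (∃ a, i + 1 < a ∧ a < l ∧ bar E k a) -
          ind (∃ b, l < b ∧ b ≤ j ∧ bar E k b)) = 0 := by
      by_cases h : k = i
      · subst h
        rw [ind_true (p := ∃ a, k + 1 < a ∧ a < l ∧ bar E k a) ⟨k + 2, by omega, by omega, hkb⟩,
          ind_true (p := ∃ b, l < b ∧ b ≤ j ∧ bar E k b) ⟨j, by omega, le_rfl, hbarγ⟩, sub_self,
          mul_zero]
      · rw [ind_false (by omega), zero_mul]
    have z2 : ind (k < j - 1 ∧ j - 1 < l) * (ind (∃ a, j - 1 < a ∧ a < l ∧ bar E k a) -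
          ind (∃ b, l < b ∧ b ≤ j ∧ bar E k b)) = 0 := by
      by_cases h : l = j
      · subst h
        rw [ind_false (p := ∃ a, l - 1 < a ∧ a < l ∧ bar E k a) (by rintro ⟨a, h1, h2, -⟩; omega),
          ind_false (p := ∃ b, l < b ∧ b ≤ l ∧ bar E k b) (by rintro ⟨a, h1, h2, -⟩; omega), sub_self,
          mul_zero]
      · rw [ind_false (by omega), zero_mul]
    rw [z1, z2] at s1
    linarith

/-- `g`-vectors and `c`-vectors of a maximal accordion dissection are dual to each other. -/
theorem sum_slalomSign_mul {D : Finset (Diagonal n c)} (hD : IsDissection D) (hn : 3 ≤ n)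
    (hcc : c + c' = 1) {E : Finset (Diagonal n c')} (hE : IsMaximalAccordionDissection D E)
    {γ η : Diagonal n c'} (hγE : γ ∈ E) (hηE : η ∈ E) [Decidable (γ = η)] :
    ∑ δ ∈ D, slalomSign D δ γ * (-slalomSign E η δ) = if γ = η then 1 else 0 := by
  obtain ⟨i, j, hij, hji, hγ⟩ := exists_lift γ
  obtain ⟨k, l, k1, k2, l2, hη⟩ : ∃ k l, i ≤ k ∧ k < l ∧ l < i + 2 * n ∧ Joins η (pt k) (pt l) := by
    obtain ⟨a, a1, a2, a3⟩ := exists_pt i η.1.1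
    obtain ⟨b, b1, b2, b3⟩ := exists_pt i η.1.2
    rcases lt_trichotomy a b with hab | rfl | hab
    · exact ⟨a, b, a1, hab, b2, Or.inl ⟨a3.symm, b3.symm⟩⟩
    · exact absurd (a3.symm.trans b3) η.2.1.ne
    · exact ⟨b, a, b1, hab, a2, Or.inr ⟨a3.symm, b3.symm⟩⟩
  have hbarγ := bar_of_mem hγE hγ
  have hbarη := bar_of_mem hηE hη
  have hγ' : Joins γ (pt j) (pt (i + 2 * n)) := by rw [pt_add]; exact hγ.symm
  have eq_iff : γ = η ↔ k = i ∧ l = j := by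
    constructor
    · rintro rfl
      rcases hγ.eq_or hη with ⟨e1, e2⟩ | ⟨e1, e2⟩
      · exact ⟨pt_inj i (by omega) (by omega) (by omega) (by omega) e1,
          pt_inj i (by omega) (by omega) (by omega) (by omega) e2⟩
      · have := pt_inj i (by omega) (by omega) (by omega) (by omega) e1
        have := pt_inj i (by omega) (by omega) (by omega) (by omega) e2
        omega
    · rintro ⟨rfl, rfl⟩
      exact hγ.unique hη
  simp only [eq_iff]
  by_cases hlj : l ≤ j
  · exact sum_slalomSign_mul_of_lift hD hn hcc hE hγE hηE hij hji hγ hη k1 k2 hlj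
  · rw [if_neg (by omega)]
    -- Being noncrossing with γ, the diagonal η now lies on the arc from j to i + 2n; if k = i, it
    -- is read from l to k + 2n.
    by_cases hkj : j ≤ k
    · rw [sum_slalomSign_mul_of_lift hD hn hcc hE hγE hηE hji (by omega) hγ' hη hkj k2 l2.le,
        if_neg (by omega)]
    · have hki : k = i := by
        by_contra hc
        exact hbarγ.not_cross hE.prop.1 hbarη (by omega) (by omega) (by omega) l2
      subst hki
      rw [sum_slalomSign_mul_of_lift hD hn hcc hE hγE hηE hji (by omega) hγ'
        (k := l) (l := k + 2 * n) (by rw [pt_add]; exact hη.symm) (by omega) l2 le_rfl,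
        if_neg (by omega)]

/-! ### Rotated diagonals -/

/-- Rotating a diagonal of `D` clockwise gives an accordion that slaloms only on this diagonal. -/
lemma exists_rotate_clockwise {D : Finset (Diagonal n c)} (hD : IsDissection D) (hn : 3 ≤ n)
    (hcc : c + c' = 1) {δ : Diagonal n c} (hδ : δ ∈ D) :
    ∃ η : Diagonal n c', IsAccordionDiagonal D η ∧ slalomSign D δ η = -1 ∧
      ∀ ε ∈ D, ε ≠ δ → slalomSign D ε η = 0 := by
  obtain ⟨p, q, hpq, hqp, hj⟩ := exists_lift δ
  have hp := hj.parity
  have hbar := bar_of_mem hδ hj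
  have hb := hD.1 δ hδ
  rw [hj.isBoundary_iff hpq hqp] at hb
  have hbq := bar_add_two D hn hp.2
  have hbp : bar D (p + 2) (p + 2 * n) := bar_add_iff.2 (bar_add_two D hn hp.1).symm
  obtain ⟨η, hη⟩ := exists_joins_of_lt (n := n) (c := c') (a := p + 1) (b := q + 1)
    (by omega) (by omega) (by omega) (by omega)
  have hbar' : bar D q (p + 2 * n) := bar_add_iff.2 hbar.symm
  -- A chord crossed by η that avoids both ends of δ would cross δ. So the chain is a fan at p
  -- followed by a fan at q, with δ as their common chord and only turn.
  have key : ∀ x y, Cut D (p + 1) (q + 1) x y → x = q ∨ y = p + 2 * n := by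
    intro x y h
    by_contra hc
    have g1 := h.left; have g2 := h.right; have g3 := h.left'; have g4 := h.right'
    exact h.bar.not_cross hD hbar' (by omega) (by omega) (by omega) (by omega)
  have hcδ : Cut D (p + 1) (q + 1) q (p + 2 * n) :=
    ⟨by omega, by omega, by omega, by omega, hbar'⟩
  have hacc : IsAccordionDiagonal D η := by
    rw [isAccordionDiagonal_iff D hD hn hcc (by omega) (by omega) hη]
    intro x y h
    have g1 := h.left; have g2 := h.right; have g3 := h.left'; have g4 := h.right'
    have hxy := h.bar.parity
    by_cases hx : x = q
    · subst hx
      by_cases hy : y = x + 2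
      · exact Or.inl (by omega)
      · exact Or.inr (Or.inl ⟨x + 2, by omega, by omega, hbq⟩)
    · obtain rfl := (key x y h).resolve_left hx
      exact Or.inr (Or.inr ⟨q, by omega, by omega, hbar'⟩)
  refine ⟨η, hacc, ?_, ?_⟩
  · rw [slalomSign_eq_ite hD hδ (by rw [pt_add]; exact hj.symm) hcδ hη, if_neg, if_pos]
    · exact ⟨⟨p + 2, by omega, by omega, hbp⟩, ⟨q + 2, by omega, by omega, hbq⟩⟩
    · rintro ⟨-, ⟨x', h1, h2, -⟩⟩
      omega
  · intro ε hε hne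
    by_cases hx : Crosses ε η
    swap
    · exact slalomSign_of_not_crosses hx
    obtain ⟨x, y, hxy, hjε⟩ := exists_cut (D := D) (by omega) (by omega) hη ⟨Or.inl hε, hx⟩
    have g1 := hxy.left; have g2 := hxy.right; have g3 := hxy.left'; have g4 := hxy.right'
    rw [slalomSign_eq_ite hD hε hjε hxy hη, if_neg, if_neg]
    · rintro ⟨⟨x', h1, h2, h3⟩, ⟨y', h4, h5, h6⟩⟩
      have := key x' y ⟨h1, by omega, g3, g4, h3⟩
      have := key x y' ⟨g1, g2, h4, by omega, h6⟩
      obtain rfl : x = q := by omega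
      obtain rfl : y = p + 2 * n := by omega
      rw [pt_add] at hjε
      exact hne (hjε.symm.unique hj)
    · rintro ⟨⟨y', h1, h2, h3⟩, ⟨x', h4, h5, h6⟩⟩
      have := key x y hxy
      omega

/-- Rotating a diagonal of `D` counterclockwise gives an accordion that slaloms only on this
diagonal. -/
lemma exists_rotate_counterclockwise {D : Finset (Diagonal n c)} (hD : IsDissection D) (hn : 3 ≤ n)
    (hcc : c + c' = 1) {δ : Diagonal n c} (hδ : δ ∈ D) :
    ∃ η : Diagonal n c', IsAccordionDiagonal D η ∧ slalomSign D δ η = 1 ∧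
      ∀ ε ∈ D, ε ≠ δ → slalomSign D ε η = 0 := by
  obtain ⟨p, q, hpq, hqp, hj⟩ := exists_lift δ
  have hp := hj.parity
  have hbar := bar_of_mem hδ hj
  have hb := hD.1 δ hδ
  rw [hj.isBoundary_iff hpq hqp] at hb
  have hbq := bar_add_two D hn (a := q - 2) (by omega)
  have hbp := bar_add_iff.2 (bar_add_two D hn (a := p - 2) (by omega)).symm
  rw [sub_add_cancel] at hbp hbq
  obtain ⟨η, hη⟩ := exists_joins_of_lt (n := n) (c := c') (a := p - 1) (b := q - 1)
    (by omega) (by omega) (by omega) (by omega)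
  have key : ∀ x y, Cut D (p - 1) (q - 1) x y → x = p ∨ y = q := by
    intro x y h
    by_contra hc
    have g1 := h.left; have g2 := h.right; have g3 := h.left'; have g4 := h.right'
    exact hbar.not_cross hD h.bar (by omega) (by omega) (by omega) (by omega)
  have hcδ : Cut D (p - 1) (q - 1) p q := ⟨by omega, by omega, by omega, by omega, hbar⟩
  have hacc : IsAccordionDiagonal D η := by
    rw [isAccordionDiagonal_iff D hD hn hcc (by omega) (by omega) hη]
    intro x y h
    have g1 := h.left; have g2 := h.right; have g3 := h.left'; have g4 := h.right'
    have hxy := h.bar.parity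
    by_cases hy : y = q
    · subst hy
      by_cases hx : x = y - 2
      · exact Or.inl (by omega)
      · exact Or.inr (Or.inr ⟨y - 2, by omega, by omega, hbq⟩)
    · obtain rfl := (key x y h).resolve_right hy
      exact Or.inr (Or.inl ⟨q, by omega, by omega, hbar⟩)
  refine ⟨η, hacc, ?_, ?_⟩
  · rw [slalomSign_eq_ite hD hδ hj hcδ hη, if_pos]
    exact ⟨⟨p - 2 + 2 * n, by omega, by omega, hbp⟩, ⟨q - 2, by omega, by omega, hbq⟩⟩
  · intro ε hε hne
    by_cases hx : Crosses ε η
    swap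
    · exact slalomSign_of_not_crosses hx
    obtain ⟨x, y, hxy, hjε⟩ := exists_cut (D := D) (by omega) (by omega) hη ⟨Or.inl hε, hx⟩
    have g1 := hxy.left; have g2 := hxy.right; have g3 := hxy.left'; have g4 := hxy.right'
    rw [slalomSign_eq_ite hD hε hjε hxy hη, if_neg, if_neg]
    · rintro ⟨⟨x', h1, h2, h3⟩, ⟨y', h4, h5, h6⟩⟩
      have := key x y hxy
      omega
    · rintro ⟨⟨y', h1, h2, h3⟩, ⟨x', h4, h5, h6⟩⟩
      have := key x y' ⟨g1, g2, by omega, h2, h3⟩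
      have := key x' y ⟨by omega, h5, g3, g4, h6⟩
      obtain rfl : x = p := by omega
      obtain rfl : y = q := by omega
      exact hne (hjε.unique hj)

/-- Boundary edges do not slalom. -/
lemma slalomSign_of_isBoundary {D : Finset (Diagonal n c)} (hD : IsDissection D)
    {η : Diagonal n c'} (hη : IsBoundary η) {δ : Diagonal n c} (hδ : δ ∈ D) :
    slalomSign D δ η = 0 := by
  have main : ∀ a, Joins η (pt a) (pt (a + 2)) → 3 ≤ n → slalomSign D δ η = 0 := by
    intro a ha hn
    by_cases hx : Crosses δ η
    swap
    · exact slalomSign_of_not_crosses hx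
    obtain ⟨x, y, hxy, hj⟩ := exists_cut (D := D) (by omega) (by omega) ha ⟨Or.inl hδ, hx⟩
    have g1 := hxy.left; have g2 := hxy.right
    rw [slalomSign_eq_ite hD hδ hj hxy ha, if_neg, if_neg]
    · rintro ⟨⟨x', h1, h2, -⟩, -⟩; omega
    · rintro ⟨-, ⟨x', h1, h2, -⟩⟩; omega
  have hn : 3 ≤ n := by
    obtain ⟨p, q, h1, h2, h3⟩ := exists_lift δ
    have hb := hD.1 δ hδ
    rw [h3.isBoundary_iff h1 h2] at hb
    have := h3.parity
    omega
  obtain ⟨a, b, hab, hba, h⟩ := exists_lift η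
  rcases (h.isBoundary_iff hab hba).1 hη with rfl | hb
  · exact main a h hn
  · refine main b ?_ hn
    rw [hb, pt_add]
    exact h.symm

/-! ### Heights and `g`-vectors -/

lemma crossInd_nonneg (ξ : Diagonal n c) (γ : Diagonal n c') : 0 ≤ crossInd ξ γ := by
  unfold crossInd; split_ifs <;> simp

lemma crossInd_eq_one {ξ : Diagonal n c} {γ : Diagonal n c'} (h : Crosses ξ γ) :
    crossInd ξ γ = 1 := if_pos h

lemma crossInd_eq_zero {ξ : Diagonal n c} {γ : Diagonal n c'} (h : ¬ Crosses ξ γ) :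
    crossInd ξ γ = 0 := if_neg h

open Classical in
lemma height_eq_sum (D : Finset (HollowDiagonal n)) (γ : SolidDiagonal n) :
    (height D γ : ℤ) = ∑ ξ : SolidDiagonal n with IsAccordionDiagonal D ξ, crossInd ξ γ := by
  unfold crossInd
  rw [Finset.sum_boole, Finset.filter_filter, height, Set.ncard_eq_toFinset_card']
  norm_cast
  congr 1
  ext; simp

/-- Strictness comes from ξ = γ', which crosses γ but neither μ nor ν. -/
lemma Exchange.sum_lt {D : Finset (HollowDiagonal n)} {γ γ' μ ν : SolidDiagonal n}
    (h : Exchange D γ γ' μ ν) (hx : Crosses γ γ') {A : Finset (SolidDiagonal n)}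
    (hA : γ' ∈ A) : ∑ ξ ∈ A, crossInd ξ μ + ∑ ξ ∈ A, crossInd ξ ν <
      ∑ ξ ∈ A, crossInd ξ γ + ∑ ξ ∈ A, crossInd ξ γ' := by
  rw [← Finset.sum_add_distrib, ← Finset.sum_add_distrib]
  refine Finset.sum_lt_sum (fun ξ _ => h.le ξ) ⟨γ', hA, ?_⟩
  rw [crossInd_eq_zero h.not_cross_right.1, crossInd_eq_zero h.not_cross_right.2,
    crossInd_eq_one hx.symm]
  have := crossInd_nonneg γ' γ'
  omega

lemma Exchange.height_lt {D D' : Finset (HollowDiagonal n)} {γ γ' μ ν : SolidDiagonal n}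
    (h : Exchange D γ γ' μ ν) (hx : Crosses γ γ') (hA : IsAccordionDiagonal D' γ') :
    height D' μ + height D' ν < height D' γ + height D' γ' := by
  classical
  have := h.sum_lt hx (A := Finset.univ.filter (IsAccordionDiagonal D' ·)) (by simpa using hA)
  rw [← height_eq_sum, ← height_eq_sum, ← height_eq_sum, ← height_eq_sum] at this
  exact_mod_cast this

lemma Exchange.gVector {D : Finset (HollowDiagonal n)} {γ γ' μ ν : SolidDiagonal n}
    (h : Exchange D γ γ' μ ν) : gVector D γ + gVector D γ' = gVector D μ + gVector D ν := by
  ext δ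
  simp only [AccordionComplex.gVector, PiLp.add_apply]
  exact_mod_cast h.sign δ.1 δ.2

lemma gVector_of_isBoundary {D : Finset (HollowDiagonal n)} (hD : IsDissection D)
    {γ : SolidDiagonal n} (h : IsBoundary γ) : gVector D γ = 0 := by
  ext δ
  simp [gVector, slalomSign_of_isBoundary hD h δ.2]

lemma inner_gVector_cVector {D : Finset (HollowDiagonal n)} (hD : IsDissection D) (hn : 3 ≤ n)
    {E : Finset (SolidDiagonal n)} (hE : IsMaximalAccordionDissection D E) {γ η : SolidDiagonal n}
    (hγ : γ ∈ E) (hη : η ∈ E) [Decidable (γ = η)] :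
    ⟪gVector D γ, cVector D E η⟫_ℝ = if γ = η then 1 else 0 := by
  have h := sum_slalomSign_mul hD hn rfl hE hγ hη
  rw [PiLp.inner_apply]
  simp only [gVector, cVector]
  rw [Finset.sum_coe_sort D fun δ =>
    ⟪(slalomSign D δ γ : ℝ), (-slalomSign E η δ : ℝ)⟫_ℝ]
  have h' := congrArg (fun z : ℤ => (z : ℝ)) h
  push_cast at h'
  rw [← h']
  exact Finset.sum_congr rfl fun δ _ => by simp [mul_comm]

lemma inner_gVector_heightPoint {D : Finset (HollowDiagonal n)} (hD : IsDissection D) (hn : 3 ≤ n)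
    (D' : Finset (HollowDiagonal n)) {E : Finset (SolidDiagonal n)}
    (hE : IsMaximalAccordionDissection D E) {γ : SolidDiagonal n} (hγ : γ ∈ E) :
    ⟪gVector D γ, heightPoint D' D E⟫_ℝ = height D' γ := by
  classical
  rw [heightPoint, inner_sum]
  rw [Finset.sum_congr rfl fun η hη => by
    rw [inner_smul_right, inner_gVector_cVector hD hn hE hγ hη, mul_ite, mul_one, mul_zero]]
  rw [Finset.sum_ite_eq, if_pos hγ]

/-- A diagonal that is compatible with a maximal accordion dissection belongs to it. -/
lemma mem_of_forall_not_crosses {D : Finset (HollowDiagonal n)} {E : Finset (SolidDiagonal n)}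
    (hE : IsMaximalAccordionDissection D E) {γ : SolidDiagonal n} (hγ : IsAccordionDiagonal D γ)
    (hb : ¬ IsBoundary γ) (h : ∀ η ∈ E, ¬ Crosses γ η) : γ ∈ E := by
  obtain ⟨a, b, hab, hba, hj⟩ := exists_lift γ
  refine (hj.mem_withBoundary (bar_of_maximal_of_forall hE hj.parity.1 hj.parity.2 hab hba
    (fun δ hδ => hδ.unique hj ▸ hγ) ?_)).resolve_right hb
  rintro p q ⟨η, hη, hpq⟩ h1 h2 h3 h4
  have hx : Crosses γ η := (hj.crosses_iff hpq).2 (cr_of_lt h1 h2 h3 h4)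
  rcases hη with hη | hη
  · exact h η hη hx
  · have := hpq.parity
    have := hj.parity
    rw [hpq.isBoundary_iff (by omega) (by omega)] at hη
    omega

/-- The points defined by maximal accordion dissections satisfy the inequalities of the
accordiohedron, and the inequalities that are tight come from the diagonals of the dissection. -/
theorem inner_heightPoint_le {D D' : Finset (HollowDiagonal n)} (hD : IsDissection D)
    (hD' : IsDissection D') (hDD' : D ⊆ D') (hn : 3 ≤ n) {E : Finset (SolidDiagonal n)}
    (hE : IsMaximalAccordionDissection D E) {γ : SolidDiagonal n} (hγ : IsAccordionDiagonal D γ) :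
    ⟪gVector D γ, heightPoint D' D E⟫_ℝ ≤ height D' γ ∧
      (⟪gVector D γ, heightPoint D' D E⟫_ℝ = height D' γ → ¬ IsBoundary γ → γ ∈ E) := by
  -- Induction on the number of diagonals of E crossed by γ. Exchanging γ with some η ∈ E yields μ,
  -- ν with fewer crossings, as η crosses none of E. Their inequalities and the equality for η give
  -- a strict inequality for γ.
  generalize hk : (∑ ξ ∈ E, crossInd ξ γ).toNat = k
  induction k using Nat.strong_induction_on generalizing γ with
  | _ k ih =>
  by_cases hx : ∃ η ∈ E, Crosses γ η
  · obtain ⟨η, hη, hx⟩ := hx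
    obtain ⟨μ, ν, hμ, hν, hex⟩ := exists_exchange hD hn rfl hγ (hE.prop.2 η hη) hx
    have hsum := hex.sum_lt hx hη
    have h0 : ∑ ξ ∈ E, crossInd ξ η = 0 :=
      Finset.sum_eq_zero fun ξ hξ => crossInd_eq_zero (hE.prop.1.2 ξ hξ η hη)
    have nn : ∀ ε : SolidDiagonal n, 0 ≤ ∑ ξ ∈ E, crossInd ξ ε := fun ε =>
      Finset.sum_nonneg fun ξ _ => crossInd_nonneg ξ ε
    have n1 := nn μ
    have n2 := nn ν
    have i1 := (ih _ (by omega) hμ rfl).1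
    have i2 := (ih _ (by omega) hν rfl).1
    have hlt := hex.height_lt hx ((hE.prop.2 η hη).refine hD hD' hDD' hn rfl)
    have hg := congrArg (fun v => ⟪v, heightPoint D' D E⟫_ℝ) hex.gVector
    simp only [inner_add_left] at hg
    rw [inner_gVector_heightPoint hD hn D' hE hη] at hg
    have hlt' : (height D' μ : ℝ) + height D' ν < height D' γ + height D' η := by exact_mod_cast hlt
    exact ⟨by linarith, fun h => by linarith⟩
  · push Not at hx
    by_cases hb : IsBoundary γ
    · rw [gVector_of_isBoundary hD hb, inner_zero_left]
      exact ⟨Nat.cast_nonneg _, fun _ h => absurd hb h⟩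
    · have hm := mem_of_forall_not_crosses hE hγ hb hx
      exact ⟨(inner_gVector_heightPoint hD hn D' hE hm).le, fun _ _ => hm⟩

/-! ### The fan is complete -/

open Classical in
-- The two rotations of δ have g-vectors e_δ and -e_δ, so the g-vectors span positively.
lemma exists_nonneg_combination {D : Finset (HollowDiagonal n)} (hD : IsDissection D) (hn : 3 ≤ n)
    (v : EuclideanSpace ℝ D) :
    ∃ a : {γ : SolidDiagonal n // IsAccordionDiagonal D γ} → ℝ, (∀ γ, 0 ≤ a γ) ∧
      ∑ γ, a γ • gVector D γ.1 = v := by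
  have hv : ∀ v : EuclideanSpace ℝ D, v ∈ Submodule.span NNReal (Set.range
      fun γ : {γ : SolidDiagonal n // IsAccordionDiagonal D γ} => gVector D γ.1) := by
    intro v
    have hs : v = ∑ δ : D, EuclideanSpace.single δ (v δ) := by
      ext ε
      simp
    rw [hs]
    refine Submodule.sum_mem _ fun δ _ => ?_
    have main : ∀ (s : ℤ) (t : ℝ) (η : SolidDiagonal n), 0 ≤ t →
        IsAccordionDiagonal D η → slalomSign D δ.1 η = s → (∀ ε ∈ D, ε ≠ δ.1 → slalomSign D ε η = 0) →
        EuclideanSpace.single δ (t * s) ∈ Submodule.span NNReal (Set.range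
          fun γ : {γ : SolidDiagonal n // IsAccordionDiagonal D γ} => gVector D γ.1) := by
      intro s t η ht h1 h2 h3
      have : EuclideanSpace.single δ (t * s) = (⟨t, ht⟩ : NNReal) • gVector D η := by
        ext ε
        by_cases he : ε = δ
        · subst he
          simp [gVector, h2]
        · simp [gVector, he, h3 ε.1 ε.2 fun h => he (Subtype.ext h)]
      rw [this]
      exact Submodule.smul_mem _ _ (Submodule.subset_span ⟨⟨η, h1⟩, rfl⟩)
    rcases le_total 0 (v δ) with h | h
    · obtain ⟨η, h1, h2, h3⟩ := exists_rotate_counterclockwise hD hn (c' := 0) rfl δ.2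
      have := main 1 (v δ) η h h1 h2 h3
      simpa using this
    · obtain ⟨η, h1, h2, h3⟩ := exists_rotate_clockwise hD hn (c' := 0) rfl δ.2
      have := main (-1) (-v δ) η (by linarith) h1 h2 h3
      simpa using this
  obtain ⟨a, ha⟩ := (Submodule.mem_span_range_iff_exists_fun NNReal).1 (hv v)
  exact ⟨fun γ => a γ, fun γ => (a γ).2, ha⟩

/-- Every vector lies in the relative interior of a cone of the `g`-vector fan. -/
theorem exists_mem_cone {D : Finset (HollowDiagonal n)} (hD : IsDissection D) (hn : 3 ≤ n)
    (v : EuclideanSpace ℝ D) :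
    ∃ (E : Finset (SolidDiagonal n)) (a : SolidDiagonal n → ℝ), IsAccordionDissection D E ∧
      (∀ γ ∈ E, 0 < a γ) ∧ ∑ γ ∈ E, a γ • gVector D γ = v := by
  classical
  let J := {γ : SolidDiagonal n // IsAccordionDiagonal D γ}
  obtain ⟨a₀, h₀, hv₀⟩ : ∃ a : J → ℝ, (∀ γ, 0 ≤ a γ) ∧ ∑ γ, a γ • gVector D γ.1 = v :=
    exists_nonneg_combination hD hn v
  -- The cost of a diagonal counts its crossings; the extra 1 bounds the coefficients by the cost
  -- and makes the sublevel set compact.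
  let κ : J → ℝ := fun γ => 1 + ((∑ ξ : SolidDiagonal n, crossInd ξ γ.1 : ℤ) : ℝ)
  have hκ : ∀ γ, 1 ≤ κ γ := fun γ => by
    have : (0 : ℝ) ≤ ((∑ ξ : SolidDiagonal n, crossInd ξ γ.1 : ℤ) : ℝ) := by
      exact_mod_cast Finset.sum_nonneg fun ξ _ => crossInd_nonneg ξ γ.1
    simp only [κ]; linarith
  let S : Set (J → ℝ) := {a | (∀ γ, 0 ≤ a γ) ∧ ∑ γ, a γ • gVector D γ.1 = v ∧
    ∑ γ, a γ * κ γ ≤ ∑ γ, a₀ γ * κ γ}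
  have hcont : Continuous fun a : J → ℝ => ∑ γ, a γ * κ γ :=
    continuous_finsetSum _ fun γ _ => (continuous_apply γ).mul continuous_const
  have hS : IsCompact S := by
    refine (isCompact_Icc (a := (0 : J → ℝ)) (b := fun _ => ∑ γ, a₀ γ * κ γ)).of_isClosed_subset
      ?_ ?_
    · refine IsClosed.inter ?_ (IsClosed.inter ?_ ?_)
      · exact isClosed_Ici (a := (0 : J → ℝ))
      · exact isClosed_eq (continuous_finsetSum _ fun γ _ =>
          (continuous_apply γ).smul continuous_const) continuous_const
      · exact isClosed_le (hcont) continuous_const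
    · rintro a ⟨h1, -, h3⟩
      refine ⟨fun γ => h1 γ, fun γ => ?_⟩
      calc a γ ≤ a γ * κ γ := le_mul_of_one_le_right (h1 γ) (hκ γ)
        _ ≤ ∑ γ, a γ * κ γ := Finset.single_le_sum (f := fun γ => a γ * κ γ)
            (fun γ _ => mul_nonneg (h1 γ) (zero_le_one.trans (hκ γ))) (Finset.mem_univ γ)
        _ ≤ _ := h3
  obtain ⟨a, ⟨ha, hv, hle⟩, hmin⟩ := hS.exists_isMinOn ⟨a₀, h₀, hv₀, le_rfl⟩
    (f := fun a => ∑ γ, a γ * κ γ) hcont.continuousOn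
  have hnc : ∀ γ γ' : J, 0 < a γ → 0 < a γ' → ¬ Crosses γ.1 γ'.1 := by
    intro γ γ' hγ hγ' hx
    obtain ⟨μ, ν, hμ, hν, hex⟩ := exists_exchange hD hn rfl γ.2 γ'.2 hx
    -- Moving the smaller weight from γ, γ' to μ, ν keeps the combination nonnegative and its value
    -- fixed, and strictly lowers the cost.
    set t := min (a γ) (a γ')
    have ht : 0 < t := lt_min hγ hγ'
    have hne : γ ≠ γ' := by
      rintro rfl
      exact not_crosses_self _ hx
    let b : J → ℝ := a + (Pi.single ⟨μ, hμ⟩ t + Pi.single ⟨ν, hν⟩ t - Pi.single γ t - Pi.single γ' t)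
    have hb : ∀ {V : Type} [AddCommGroup V] [Module ℝ V] (f : J → V),
        ∑ ε, b ε • f ε = ∑ ε, a ε • f ε + t • (f ⟨μ, hμ⟩ + f ⟨ν, hν⟩ - f γ - f γ') := by
      intro V _ _ f
      have hs : ∀ ε₀ : J, ∑ ε, (Pi.single ε₀ t : J → ℝ) ε • f ε = t • f ε₀ := fun ε₀ => by
        rw [Finset.sum_eq_single ε₀ (fun ε _ h => by rw [Pi.single_eq_of_ne h, zero_smul])
          (fun h => absurd (Finset.mem_univ _) h), Pi.single_eq_same]
      simp only [b, Pi.add_apply, Pi.sub_apply, add_smul, sub_smul, Finset.sum_add_distrib,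
        Finset.sum_sub_distrib, hs, smul_add, smul_sub]
    have hcost : ∑ ε, b ε * κ ε < ∑ ε, a ε * κ ε := by
      have h1 := hb κ
      simp only [smul_eq_mul] at h1
      have h2 : κ ⟨μ, hμ⟩ + κ ⟨ν, hν⟩ < κ γ + κ γ' := by
        have h3 := hex.sum_lt hx (Finset.mem_univ γ'.1)
        have h4 := Int.cast_lt (R := ℝ).2 h3
        rw [Int.cast_add, Int.cast_add] at h4
        simp only [κ]; linarith
      have := mul_pos ht (sub_pos.2 h2)
      linarith
    have hbS : b ∈ S := by
      refine ⟨fun ε => ?_, ?_, hcost.le.trans hle⟩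
      · have h1 : t ≤ a γ := min_le_left _ _
        have h2 : t ≤ a γ' := min_le_right _ _
        have h3 := ha ε
        simp only [b, Pi.add_apply, Pi.sub_apply, Pi.single_apply]
        by_cases e1 : ε = γ
        · have e2 : ε ≠ γ' := fun h => hne (e1.symm.trans h)
          rw [if_pos e1, if_neg e2, e1]
          split_ifs <;> linarith
        · rw [if_neg e1]
          by_cases e2 : ε = γ'
          · rw [if_pos e2, e2]
            split_ifs <;> linarith
          · rw [if_neg e2]
            split_ifs <;> linarith
      · rw [hb fun γ : J => gVector D γ.1, hv, ← hex.gVector]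
        simp
    have := hmin hbS
    simp only [Set.mem_ofPred_eq] at this
    linarith
  -- Boundary edges may carry weight but have zero g-vectors, so they are dropped.
  let E : Finset (SolidDiagonal n) :=
    (Finset.univ.filter fun γ : J => 0 < a γ ∧ ¬ IsBoundary γ.1).map (Function.Embedding.subtype _)
  have memE : ∀ γ, γ ∈ E → ∃ h : IsAccordionDiagonal D γ, 0 < a ⟨γ, h⟩ ∧ ¬ IsBoundary γ := by
    intro γ h
    simp only [E, Finset.mem_map, Finset.mem_filter, Finset.mem_univ, true_and] at h
    obtain ⟨γ', h1, rfl⟩ := h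
    exact ⟨γ'.2, h1⟩
  let w : SolidDiagonal n → ℝ := fun γ => if h : IsAccordionDiagonal D γ then a ⟨γ, h⟩ else 0
  have hw : ∀ γ : J, w γ.1 = a γ := fun γ => dif_pos γ.2
  refine ⟨E, w, ⟨⟨fun γ hγ => ?_, fun γ hγ γ' hγ' => ?_⟩, fun γ hγ => ?_⟩, fun γ hγ => ?_, ?_⟩
  · exact (memE γ hγ).choose_spec.2
  · obtain ⟨h, h1, -⟩ := memE γ hγ
    obtain ⟨h', h1', -⟩ := memE γ' hγ'
    exact hnc ⟨γ, h⟩ ⟨γ', h'⟩ h1 h1'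
  · exact (memE γ hγ).choose
  · obtain ⟨h, h1, -⟩ := memE γ hγ
    exact (hw ⟨γ, h⟩).symm ▸ h1
  · rw [Finset.sum_map, ← hv, Finset.sum_filter]
    refine Finset.sum_congr rfl fun γ _ => ?_
    by_cases h : 0 < a γ ∧ ¬ IsBoundary γ.1
    · rw [if_pos h, Function.Embedding.subtype_apply, hw]
    · rw [if_neg h]
      rw [not_and_or, not_not] at h
      rcases h with h | h
      · rw [le_antisymm (not_lt.1 h) (ha γ), zero_smul]
      · rw [gVector_of_isBoundary hD h, smul_zero]

/-! ### The polyhedron of the heights -/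

/-- The intersection of the half-spaces orthogonal to the `g`-vectors of the `D`-accordion
diagonals, at distances given by the `D'`-heights. -/
def heightPolyhedron (D D' : Finset (HollowDiagonal n)) : Set (EuclideanSpace ℝ D) :=
  {x | ∀ γ : SolidDiagonal n, IsAccordionDiagonal D γ → ⟪gVector D γ, x⟫_ℝ ≤ (height D' γ : ℝ)}

/-- The points of the polyhedron at which the inequalities of the diagonals of `E` are tight. -/
def heightFace (D D' : Finset (HollowDiagonal n)) (E : Finset (SolidDiagonal n)) :
    Set (EuclideanSpace ℝ D) :=
  {x ∈ heightPolyhedron D D' | ∀ γ ∈ E, ⟪gVector D γ, x⟫_ℝ = height D' γ}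

lemma IsAccordionDissection.exists_isMaximal {D : Finset (HollowDiagonal n)}
    {E : Finset (SolidDiagonal n)} (hE : IsAccordionDissection D E) :
    ∃ M, IsMaximalAccordionDissection D M ∧ E ⊆ M := by
  obtain ⟨M, h, hM⟩ := Finite.exists_le_maximal hE
  exact ⟨M, hM, h⟩

lemma IsAccordionDissection.refine {D D' : Finset (HollowDiagonal n)} (hD : IsDissection D)
    (hD' : IsDissection D') (hDD' : D ⊆ D') (hn : 3 ≤ n) {E : Finset (SolidDiagonal n)}
    (hE : IsAccordionDissection D E) : IsAccordionDissection D' E :=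
  ⟨hE.1, fun η hη => (hE.2 η hη).refine hD hD' hDD' hn rfl⟩

lemma inner_sum_gVector_cVector {D : Finset (HollowDiagonal n)} (hD : IsDissection D) (hn : 3 ≤ n)
    {M : Finset (SolidDiagonal n)} (hM : IsMaximalAccordionDissection D M)
    (a : SolidDiagonal n → ℝ) {η : SolidDiagonal n} (hη : η ∈ M) :
    ⟪∑ γ ∈ M, a γ • gVector D γ, cVector D M η⟫_ℝ = a η := by
  classical
  rw [sum_inner, Finset.sum_congr rfl fun γ hγ => by
    rw [real_inner_smul_left, inner_gVector_cVector hD hn hM hγ hη, mul_ite, mul_one, mul_zero]]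
  rw [Finset.sum_ite_eq', if_pos hη]

lemma inner_sum_gVector_le {D D' : Finset (HollowDiagonal n)} {E : Finset (SolidDiagonal n)}
    (hE : IsAccordionDissection D E) {a : SolidDiagonal n → ℝ} (ha : ∀ γ ∈ E, 0 ≤ a γ)
    {x : EuclideanSpace ℝ D} (hx : x ∈ heightPolyhedron D D') :
    ⟪∑ γ ∈ E, a γ • gVector D γ, x⟫_ℝ ≤ ∑ γ ∈ E, a γ * height D' γ := by
  rw [sum_inner]
  refine Finset.sum_le_sum fun γ hγ => ?_
  rw [real_inner_smul_left]
  exact mul_le_mul_of_nonneg_left (hx γ (hE.2 γ hγ)) (ha γ hγ)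

lemma inner_sum_gVector_of_mem_heightFace {D D' : Finset (HollowDiagonal n)}
    {E : Finset (SolidDiagonal n)} (a : SolidDiagonal n → ℝ)
    {x : EuclideanSpace ℝ D} (hx : x ∈ heightFace D D' E) :
    ⟪∑ γ ∈ E, a γ • gVector D γ, x⟫_ℝ = ∑ γ ∈ E, a γ * height D' γ := by
  rw [sum_inner]
  exact Finset.sum_congr rfl fun γ hγ => by rw [real_inner_smul_left, hx.2 γ hγ]

/-- Equality in a sum of valid inequalities with positive weights makes each of them an equality. -/
lemma mem_heightFace_of_le {D D' : Finset (HollowDiagonal n)}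
    {E : Finset (SolidDiagonal n)} (hE : IsAccordionDissection D E) {a : SolidDiagonal n → ℝ}
    (ha : ∀ γ ∈ E, 0 < a γ) {x : EuclideanSpace ℝ D} (hx : x ∈ heightPolyhedron D D')
    (h : ∑ γ ∈ E, a γ * height D' γ ≤ ⟪∑ γ ∈ E, a γ • gVector D γ, x⟫_ℝ) :
    x ∈ heightFace D D' E := by
  refine ⟨hx, fun γ hγ => ?_⟩
  rw [sum_inner] at h
  have hle : ∀ γ ∈ E, ⟪a γ • gVector D γ, x⟫_ℝ ≤ a γ * height D' γ := fun γ hγ => by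
    rw [real_inner_smul_left]
    exact mul_le_mul_of_nonneg_left (hx γ (hE.2 γ hγ)) (ha γ hγ).le
  have := (Finset.sum_eq_sum_iff_of_le hle).1 (le_antisymm (Finset.sum_le_sum hle) h) γ hγ
  rw [real_inner_smul_left] at this
  exact mul_left_cancel₀ (ha γ hγ).ne' this

/-- A closed convex subset of the polyhedron that meets the faces of all accordion dissections
is the whole polyhedron. -/
lemma eq_heightPolyhedron {D D' : Finset (HollowDiagonal n)} (hD : IsDissection D) (hn : 3 ≤ n)
    {K : Set (EuclideanSpace ℝ D)} (hK : Convex ℝ K) (hc : IsClosed K)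
    (hsub : K ⊆ heightPolyhedron D D')
    (h : ∀ E, IsAccordionDissection D E → (K ∩ heightFace D D' E).Nonempty) :
    K = heightPolyhedron D D' := by
  refine hsub.antisymm fun x hx => ?_
  by_contra hxK
  -- The separating functional lies in some cone; its maximum over the polyhedron is attained on the
  -- corresponding face, which K meets.
  obtain ⟨f, u, h1, h2⟩ := geometric_hahn_banach_closed_point hK hc hxK
  obtain ⟨E, a, hE, ha, hv⟩ :=
    exists_mem_cone hD hn ((InnerProductSpace.toDual ℝ (EuclideanSpace ℝ D)).symm f)
  obtain ⟨k, hk, hkE⟩ := h E hE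
  have e1 := h1 k hk
  have e2 := inner_sum_gVector_le hE (fun γ hγ => (ha γ hγ).le) hx
  rw [← InnerProductSpace.toDual_symm_apply, ← hv,
    inner_sum_gVector_of_mem_heightFace a hkE] at e1
  rw [hv, InnerProductSpace.toDual_symm_apply] at e2
  linarith

lemma heightPoint_mem_heightPolyhedron {D D' : Finset (HollowDiagonal n)} (hD : IsDissection D)
    (hD' : IsDissection D') (hDD' : D ⊆ D') (hn : 3 ≤ n) {M : Finset (SolidDiagonal n)}
    (hM : IsMaximalAccordionDissection D M) : heightPoint D' D M ∈ heightPolyhedron D D' :=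
  fun _ hγ => (inner_heightPoint_le hD hD' hDD' hn hM hγ).1

lemma heightPoint_mem_heightFace_iff {D D' : Finset (HollowDiagonal n)} (hD : IsDissection D)
    (hD' : IsDissection D') (hDD' : D ⊆ D') (hn : 3 ≤ n) {M E : Finset (SolidDiagonal n)}
    (hM : IsMaximalAccordionDissection D M) (hE : IsAccordionDissection D E) :
    heightPoint D' D M ∈ heightFace D D' E ↔ E ⊆ M :=
  ⟨fun h γ hγ => (inner_heightPoint_le hD hD' hDD' hn hM (hE.2 γ hγ)).2 (h.2 γ hγ) (hE.1.1 γ hγ),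
    fun h => ⟨heightPoint_mem_heightPolyhedron hD hD' hDD' hn hM, fun _ hγ =>
      inner_gVector_heightPoint hD hn D' hM (h hγ)⟩⟩

lemma heightFace_nonempty {D D' : Finset (HollowDiagonal n)} (hD : IsDissection D)
    (hD' : IsDissection D') (hDD' : D ⊆ D') (hn : 3 ≤ n) {E : Finset (SolidDiagonal n)}
    (hE : IsAccordionDissection D E) : (heightFace D D' E).Nonempty := by
  obtain ⟨M, hM, hEM⟩ := hE.exists_isMaximal
  exact ⟨_, (heightPoint_mem_heightFace_iff hD hD' hDD' hn hM hE).2 hEM⟩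

/-- The set of maximizers over the polyhedron of a vector in the relative interior of the cone
of `E`. -/
lemma setOf_maximizers_eq_heightFace {D D' : Finset (HollowDiagonal n)} (hD : IsDissection D)
    (hD' : IsDissection D') (hDD' : D ⊆ D') (hn : 3 ≤ n) {E : Finset (SolidDiagonal n)}
    (hE : IsAccordionDissection D E) {a : SolidDiagonal n → ℝ} (ha : ∀ γ ∈ E, 0 < a γ) :
    {x ∈ heightPolyhedron D D' | ∀ y ∈ heightPolyhedron D D',
      ⟪∑ γ ∈ E, a γ • gVector D γ, y⟫_ℝ ≤ ⟪∑ γ ∈ E, a γ • gVector D γ, x⟫_ℝ} =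
      heightFace D D' E := by
  ext x
  constructor
  · rintro ⟨hx, h⟩
    obtain ⟨y, hy⟩ := heightFace_nonempty hD hD' hDD' hn hE
    refine mem_heightFace_of_le hE ha hx ?_
    rw [← inner_sum_gVector_of_mem_heightFace a hy]
    exact h y hy.1
  · intro hx
    refine ⟨hx.1, fun y hy => ?_⟩
    rw [inner_sum_gVector_of_mem_heightFace a hx]
    exact inner_sum_gVector_le hE (fun γ hγ => (ha γ hγ).le) hy

/-! ### Normal cones -/

/-- Any diagonal of a maximal accordion dissection can be exchanged. -/
lemma exists_isMaximal_exchange {D : Finset (HollowDiagonal n)} (hD : IsDissection D) (hn : 3 ≤ n)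
    [DecidableEq (SolidDiagonal n)] {M : Finset (SolidDiagonal n)}
    (hM : IsMaximalAccordionDissection D M) {γ : SolidDiagonal n} (hγ : γ ∈ M) :
    ∃ M', IsMaximalAccordionDissection D M' ∧ M.erase γ ⊆ M' ∧ γ ∉ M' := by
  have hE : IsAccordionDissection D (M.erase γ) :=
    ⟨⟨fun η hη => hM.prop.1.1 η (Finset.mem_of_mem_erase hη), fun η hη η' hη' =>
      hM.prop.1.2 η (Finset.mem_of_mem_erase hη) η' (Finset.mem_of_mem_erase hη')⟩,
      fun η hη => hM.prop.2 η (Finset.mem_of_mem_erase hη)⟩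
  let p := heightPoint D D
  have hp : ∀ M', IsMaximalAccordionDissection D M' → p M' ∈ heightPolyhedron D D :=
    fun M' => heightPoint_mem_heightPolyhedron hD hD subset_rfl hn
  let v := ∑ η ∈ M.erase γ, (1 : ℝ) • gVector D η
  -- v is strictly larger at p M than at p M' whenever M' does not contain M \ γ. As there are
  -- finitely many M', this persists for v - t g(γ) with small t > 0.
  have hev : ∀ᶠ t in nhdsWithin (0 : ℝ) (Set.Ioi 0), ∀ M', IsMaximalAccordionDissection D M' →
      ¬ M.erase γ ⊆ M' → ⟪v - t • gVector D γ, p M'⟫_ℝ < ⟪v - t • gVector D γ, p M⟫_ℝ := by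
    rw [Filter.eventually_all]
    intro M'
    by_cases h : IsMaximalAccordionDissection D M' ∧ ¬ M.erase γ ⊆ M'
    · have hlt : ⟪v - (0 : ℝ) • gVector D γ, p M'⟫_ℝ < ⟪v - (0 : ℝ) • gVector D γ, p M⟫_ℝ := by
        rw [zero_smul, sub_zero]
        have h1 := (heightPoint_mem_heightFace_iff hD hD subset_rfl hn hM hE).2
          (Finset.erase_subset _ _)
        rw [inner_sum_gVector_of_mem_heightFace (fun _ => 1) h1]
        by_contra h2
        exact h.2 ((heightPoint_mem_heightFace_iff hD hD subset_rfl hn h.1 hE).1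
          (mem_heightFace_of_le hE (fun _ _ => one_pos) (hp M' h.1) (not_lt.1 h2)))
      have hcont : ∀ x : EuclideanSpace ℝ D,
          Continuous fun t : ℝ => ⟪v - t • gVector D γ, x⟫_ℝ := fun x => by fun_prop
      have := (isOpen_lt (hcont (p M')) (hcont (p M))).mem_nhds hlt
      filter_upwards [nhdsWithin_le_nhds this] with t ht _ _ using ht
    · exact Filter.Eventually.of_forall fun t h1 h2 => absurd ⟨h1, h2⟩ h
  obtain ⟨t, h1, ht⟩ := (hev.and self_mem_nhdsWithin).exists
  obtain ⟨E, a, hEa, ha, hv⟩ := exists_mem_cone hD hn (v - t • gVector D γ)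
  obtain ⟨M', hM', hEM'⟩ := hEa.exists_isMaximal
  have hsub : M.erase γ ⊆ M' := by
    by_contra h2
    have h3 := h1 M' hM' h2
    rw [← hv, inner_sum_gVector_of_mem_heightFace a
      ((heightPoint_mem_heightFace_iff hD hD subset_rfl hn hM' hEa).2 hEM')] at h3
    exact absurd (inner_sum_gVector_le hEa (fun γ hγ => (ha γ hγ).le) (hp M hM)) (not_le.2 h3)
  refine ⟨M', hM', hsub, fun hγM' => ?_⟩
  have hMM' : M ⊆ M' := by
    rw [← Finset.insert_erase hγ]
    exact Finset.insert_subset hγM' hsub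
  obtain rfl : M = M' := hMM'.antisymm (hM.2 hM'.prop hMM')
  -- If γ were in M', then M' = M, and pairing with the c-vector of γ would give the coefficient -t
  -- < 0 in one expansion and a nonnegative one in the other.
  have e1 := inner_sum_gVector_cVector hD hn hM (fun η => if η ∈ E then a η else 0) hγ
  have e2 := inner_sum_gVector_cVector hD hn hM (fun η => if η = γ then -t else 1) hγ
  have s1 : ∑ η ∈ M, (if η ∈ E then a η else 0) • gVector D η = v - t • gVector D γ := by
    rw [← hv, ← Finset.sum_subset hEM' fun η _ hη => by rw [if_neg hη, zero_smul]]
    exact Finset.sum_congr rfl fun η hη => by rw [if_pos hη]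
  have s2 : ∑ η ∈ M, (if η = γ then -t else 1 : ℝ) • gVector D η = v - t • gVector D γ := by
    rw [← Finset.sum_erase_add _ _ hγ, if_pos rfl, neg_smul, ← sub_eq_add_neg]
    congr 1
    exact Finset.sum_congr rfl fun η hη => by rw [if_neg (Finset.ne_of_mem_erase hη)]
  rw [s1] at e1
  rw [s2, e1, if_pos rfl] at e2
  have ht' : 0 < t := ht
  split_ifs at e2 with h
  · have := ha γ h
    linarith
  · linarith

lemma mem_span_gVector_iff {D : Finset (HollowDiagonal n)} {E : Finset (SolidDiagonal n)}
    {w : EuclideanSpace ℝ D} :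
    w ∈ Submodule.span NNReal (gVector D '' (E : Set (SolidDiagonal n))) ↔
      ∃ a : SolidDiagonal n → ℝ, (∀ γ ∈ E, 0 ≤ a γ) ∧ ∑ γ ∈ E, a γ • gVector D γ = w := by
  constructor
  · intro h
    obtain ⟨a, ha⟩ := (Submodule.mem_span_image_finset_iff_exists_fun' NNReal).1 h
    exact ⟨fun γ => a γ, fun γ _ => (a γ).2, ha⟩
  · rintro ⟨a, ha, rfl⟩
    refine Submodule.sum_mem _ fun γ hγ => ?_
    exact Submodule.smul_mem _ (⟨a γ, ha γ hγ⟩ : NNReal) (Submodule.subset_span ⟨γ, hγ, rfl⟩)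

/-- Let w be normal to the face and lie in the relative interior of the cone of E₁. Maximality of w
at the height point of each maximal M ⊇ E forces E₁ ⊆ M. Exchanging any diagonal outside E then
leaves E₁ ⊆ E. -/
lemma normalCone_heightFace {D D' : Finset (HollowDiagonal n)} (hD : IsDissection D)
    (hD' : IsDissection D') (hDD' : D ⊆ D') (hn : 3 ≤ n) {E : Finset (SolidDiagonal n)}
    (hE : IsAccordionDissection D E) :
    {w | ∀ x ∈ heightFace D D' E, ∀ y ∈ heightPolyhedron D D', ⟪w, y⟫_ℝ ≤ ⟪w, x⟫_ℝ} =
      (Submodule.span NNReal (gVector D '' (E : Set (SolidDiagonal n))) :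
        Set (EuclideanSpace ℝ D)) := by
  classical
  ext w
  rw [SetLike.mem_coe, mem_span_gVector_iff]
  constructor
  · intro hw
    obtain ⟨E₁, b, hE₁, hb, rfl⟩ := exists_mem_cone hD hn w
    have key : ∀ M, IsMaximalAccordionDissection D M → E ⊆ M → E₁ ⊆ M := by
      intro M hM hEM
      obtain ⟨y, hy⟩ := heightFace_nonempty hD hD' hDD' hn hE₁
      have h := hw _ ((heightPoint_mem_heightFace_iff hD hD' hDD' hn hM hE).2 hEM) y hy.1
      rw [inner_sum_gVector_of_mem_heightFace b hy] at h
      exact (heightPoint_mem_heightFace_iff hD hD' hDD' hn hM hE₁).1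
        (mem_heightFace_of_le hE₁ hb (heightPoint_mem_heightPolyhedron hD hD' hDD' hn hM) h)
    obtain ⟨M, hM, hEM⟩ := hE.exists_isMaximal
    have hsub : E₁ ⊆ E := by
      intro γ hγ
      by_contra hγE
      obtain ⟨M', hM', h1, h2⟩ := exists_isMaximal_exchange hD hn hM (key M hM hEM hγ)
      exact h2 (key M' hM' ((Finset.subset_erase.2 ⟨hEM, hγE⟩).trans h1) hγ)
    refine ⟨fun γ => if γ ∈ E₁ then b γ else 0, fun γ _ => ?_, ?_⟩
    · dsimp only
      split_ifs with h
      · exact (hb γ h).le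
      · exact le_rfl
    · rw [← Finset.sum_subset hsub fun η _ hη => by simp only [if_neg hη, zero_smul]]
      exact Finset.sum_congr rfl fun η hη => by simp only [if_pos hη]
  · rintro ⟨a, ha, rfl⟩ x hx y hy
    rw [inner_sum_gVector_of_mem_heightFace a hx]
    exact inner_sum_gVector_le hE ha hy

theorem normalFan_heightPolyhedron {D D' : Finset (HollowDiagonal n)} (hD : IsDissection D)
    (hD' : IsDissection D') (hDD' : D ⊆ D') (hn : 3 ≤ n) :
    normalFan (heightPolyhedron D D') = gVectorFan D := by
  ext K
  constructor
  · rintro ⟨F, hF, hexp, rfl⟩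
    obtain ⟨l, rfl⟩ := hexp hF
    obtain ⟨E, a, hE, ha, hv⟩ :=
      exists_mem_cone hD hn ((InnerProductSpace.toDual ℝ (EuclideanSpace ℝ D)).symm l)
    refine ⟨E, hE, ?_⟩
    have h := setOf_maximizers_eq_heightFace hD hD' hDD' hn hE ha
    simp only [hv, InnerProductSpace.toDual_symm_apply] at h
    rw [h, normalCone_heightFace hD hD' hDD' hn hE]
  · rintro ⟨E, hE, rfl⟩
    refine ⟨heightFace D D' E, heightFace_nonempty hD hD' hDD' hn hE, fun _ =>
      ⟨innerSL ℝ (∑ γ ∈ E, (1 : ℝ) • gVector D γ), ?_⟩,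
      (normalCone_heightFace hD hD' hDD' hn hE).symm⟩
    rw [← setOf_maximizers_eq_heightFace hD hD' hDD' hn hE (a := fun _ => 1) fun _ _ => one_pos]
    rfl

/-! ### The convex hull of the height points -/

lemma isCompact_convexHull_heightPoint (D D' : Finset (HollowDiagonal n)) :
    IsCompact (convexHull ℝ {x | ∃ E : Finset (SolidDiagonal n),
      IsMaximalAccordionDissection D E ∧ x = heightPoint D' D E}) := by
  have hfin : Set.Finite {x | ∃ E : Finset (SolidDiagonal n),
      IsMaximalAccordionDissection D E ∧ x = heightPoint D' D E} := by
    refine (Set.finite_range (heightPoint D' D)).subset ?_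
    rintro _ ⟨E, -, rfl⟩
    exact ⟨E, rfl⟩
  exact hfin.isCompact_convexHull ℝ

theorem convexHull_heightPoint {D D' : Finset (HollowDiagonal n)} (hD : IsDissection D)
    (hD' : IsDissection D') (hDD' : D ⊆ D') (hn : 3 ≤ n) :
    convexHull ℝ {x | ∃ E : Finset (SolidDiagonal n),
      IsMaximalAccordionDissection D E ∧ x = heightPoint D' D E} = heightPolyhedron D D' := by
  refine eq_heightPolyhedron hD hn (convex_convexHull ℝ _) ?_ ?_ ?_
  · exact (isCompact_convexHull_heightPoint D D').isClosed
  · refine convexHull_min ?_ ?_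
    · rintro _ ⟨E, hE, rfl⟩
      exact heightPoint_mem_heightPolyhedron hD hD' hDD' hn hE
    · intro x hx y hy a b ha hb hab γ hγ
      rw [inner_add_right, real_inner_smul_right, real_inner_smul_right]
      calc _ ≤ a * (height D' γ : ℝ) + b * height D' γ :=
            add_le_add (mul_le_mul_of_nonneg_left (hx γ hγ) ha)
              (mul_le_mul_of_nonneg_left (hy γ hγ) hb)
        _ = _ := by rw [← add_mul, hab, one_mul]
  · intro E hE
    obtain ⟨M, hM, hEM⟩ := hE.exists_isMaximal
    exact ⟨_, subset_convexHull ℝ _ ⟨M, hM, rfl⟩,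
      (heightPoint_mem_heightFace_iff hD hD' hDD' hn hM hE).2 hEM⟩

/-! ### The projected accordiohedron -/

/-- Restriction of the coordinates. -/
def coordRestriction {D D' : Finset (HollowDiagonal n)} (hDD' : D ⊆ D') :
    EuclideanSpace ℝ D' →ₗ[ℝ] EuclideanSpace ℝ D where
  toFun x := WithLp.toLp 2 fun δ => x ⟨δ.1, hDD' δ.2⟩
  map_add' _ _ := rfl
  map_smul' _ _ := rfl

lemma coordRestriction_apply {D D' : Finset (HollowDiagonal n)} (hDD' : D ⊆ D')
    (x : EuclideanSpace ℝ D') (δ : D) : coordRestriction hDD' x δ = x ⟨δ.1, hDD' δ.2⟩ := rfl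

lemma coordRestriction_coordEmbedding {D D' : Finset (HollowDiagonal n)} (hDD' : D ⊆ D')
    (x : EuclideanSpace ℝ D) : coordRestriction hDD' (coordEmbedding D D' x) = x := by
  ext δ
  simp [coordRestriction_apply, coordEmbedding]

lemma starProjection_coordSubspace {D D' : Finset (HollowDiagonal n)} (hDD' : D ⊆ D')
    (z : EuclideanSpace ℝ D') : (coordSubspace D D').starProjection z =
      coordEmbedding D D' (coordRestriction hDD' z) := by
  classical
  refine Submodule.eq_starProjection_of_mem_orthogonal ?_ ?_
  · have : coordEmbedding D D' (coordRestriction hDD' z) =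
        ∑ δ : D', (if δ.1 ∈ D then z δ else 0) • EuclideanSpace.single δ (1 : ℝ) := by
      ext ε
      have h : (coordEmbedding D D' (coordRestriction hDD' z)) ε =
          if ε.1 ∈ D then z ε else 0 := by
        by_cases hε : ε.1 ∈ D <;> simp [coordRestriction_apply, coordEmbedding, hε]
      rw [h]
      simp only [WithLp.ofLp_sum, Finset.sum_apply, PiLp.smul_apply, PiLp.single_apply,
        smul_eq_mul, mul_ite, mul_one, mul_zero, Finset.sum_ite_eq, Finset.mem_univ, if_true]
    rw [this]
    refine Submodule.sum_mem _ fun δ _ => ?_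
    split_ifs with h
    · exact Submodule.smul_mem _ _ (Submodule.subset_span ⟨δ, h, rfl⟩)
    · rw [zero_smul]
      exact Submodule.zero_mem _
  · rw [Submodule.mem_orthogonal]
    intro u hu
    induction hu using Submodule.span_induction with
    | mem x hx =>
      obtain ⟨δ, hδ, rfl⟩ := hx
      rw [EuclideanSpace.inner_single_left]
      simp [coordRestriction_apply, coordEmbedding, hδ]
    | zero => exact inner_zero_left _
    | add x y _ _ hx hy => rw [inner_add_left, hx, hy, add_zero]
    | smul a x _ hx => rw [real_inner_smul_left, hx, mul_zero]

lemma projectedAcco_eq_image {D D' : Finset (HollowDiagonal n)} (hDD' : D ⊆ D') :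
    projectedAcco D D' = coordRestriction hDD' '' Acco D' := by
  ext x
  constructor
  · rintro ⟨z, hz, hx⟩
    rw [starProjection_coordSubspace hDD'] at hx
    refine ⟨z, hz, ?_⟩
    rw [← coordRestriction_coordEmbedding hDD' x, ← hx, coordRestriction_coordEmbedding]
  · rintro ⟨z, hz, rfl⟩
    exact ⟨z, hz, starProjection_coordSubspace hDD' z⟩

/-- For a D-accordion diagonal, passing from D to D' leaves the g-coordinates on D unchanged and
adds only zeros. -/
lemma inner_gVector_coordRestriction {D D' : Finset (HollowDiagonal n)} (hD : IsDissection D)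
    (hD' : IsDissection D') (hDD' : D ⊆ D') (hn : 3 ≤ n) {γ : SolidDiagonal n}
    (hγ : IsAccordionDiagonal D γ) (z : EuclideanSpace ℝ D') :
    ⟪gVector D γ, coordRestriction hDD' z⟫_ℝ = ⟪gVector D' γ, z⟫_ℝ := by
  rw [PiLp.inner_apply, PiLp.inner_apply]
  refine Fintype.sum_of_injective (fun δ : D => (⟨δ.1, hDD' δ.2⟩ : D')) ?_ _ _ ?_ ?_
  · intro δ ε h
    exact Subtype.ext (congrArg (fun x : D' => x.1) h)
  · intro δ hδ
    have hδD : δ.1 ∉ D := fun h => hδ ⟨⟨δ.1, h⟩, rfl⟩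
    have : gVector D' γ δ = 0 := by
      simp [gVector, (slalomSign_of_subset hD' hD hDD' hn rfl hγ δ.2).2 hδD]
    rw [this, inner_zero_left]
  · intro δ
    have : gVector D' γ ⟨δ.1, hDD' δ.2⟩ = gVector D γ δ := by
      simp [gVector, (slalomSign_of_subset hD' hD hDD' hn rfl hγ (hDD' δ.2)).1 δ.2]
    rw [this]
    rfl

/-- The inequalities of D-accordion diagonals that define Acco(D') involve only coordinates in D, so
they survive the projection. Each D-accordion dissection E is also a D'-accordion dissection, so its
nonempty face of Acco(D') projects into the face of E. -/
theorem projectedAcco_eq_heightPolyhedron {D D' : Finset (HollowDiagonal n)}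
    (hD : IsDissection D) (hD' : IsDissection D') (hDD' : D ⊆ D') (hn : 3 ≤ n) :
    projectedAcco D D' = heightPolyhedron D D' := by
  have hA : Acco D' = heightPolyhedron D' D' :=
    convexHull_heightPoint hD' hD' subset_rfl hn
  have hcpt : IsCompact (Acco D') := isCompact_convexHull_heightPoint D' D'
  rw [projectedAcco_eq_image hDD']
  refine eq_heightPolyhedron hD hn ((convex_convexHull ℝ _).linear_image _)
    (hcpt.image (LinearMap.continuous_of_finiteDimensional (coordRestriction hDD'))).isClosed ?_ ?_
  · rintro _ ⟨z, hz, rfl⟩ γ hγ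
    rw [inner_gVector_coordRestriction hD hD' hDD' hn hγ]
    rw [hA] at hz
    exact hz γ (hγ.refine hD hD' hDD' hn rfl)
  · intro E hE
    obtain ⟨z, hz⟩ :=
      heightFace_nonempty hD' hD' subset_rfl hn (hE.refine hD hD' hDD' hn)
    refine ⟨_, ⟨z, hA ▸ hz.1, rfl⟩, fun γ hγ => ?_, fun γ hγ => ?_⟩
    · rw [inner_gVector_coordRestriction hD hD' hDD' hn hγ]
      exact hz.1 γ (hγ.refine hD hD' hDD' hn rfl)
    · rw [inner_gVector_coordRestriction hD hD' hDD' hn (hE.2 γ hγ)]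
      exact hz.2 γ hγ

end
end AccordionComplex

theorem mainTheorem4 (n : ℕ) (hn : 3 ≤ n) (D D' : Finset (HollowDiagonal n))
    (hD : IsDissection D) (hD' : IsDissection D') (hDD' : D ⊆ D') :
    normalFan (projectedAcco D D') = gVectorFan D ∧
    projectedAcco D D' =
      convexHull ℝ {x | ∃ E : Finset (SolidDiagonal n),
        IsMaximalAccordionDissection D E ∧ x = heightPoint D' D E} ∧
    projectedAcco D D' =
      {x | ∀ γ : SolidDiagonal n, IsAccordionDiagonal D γ →
        ⟪gVector D γ, x⟫_ℝ ≤ (height D' γ : ℝ)} := by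
  have : NeZero n := ⟨by omega⟩
  rw [projectedAcco_eq_heightPolyhedron hD hD' hDD' hn]
  exact ⟨normalFan_heightPolyhedron hD hD' hDD' hn,
    (convexHull_heightPoint hD hD' hDD' hn).symm, rfl⟩
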